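/- **Notation.** Fix reals $a<b$, an integer $N\ge 0$ and $n=(n_0,\dots,n_N)\in\mathbb N^{N+1}$. Put $n_{\hat{\mathbf x}}=\sum_{i=0}^N n_i$, $n_{S_i}=\sum_{j=i}^N n_j$ and $n_S=\sum_{i=1}^N n_{S_i}$. A signal $f$ on $\mathbb R_+=[0,\infty)$ is in $L_{2e}$ if it is in $L_2[0,T]$ for every $T\ge 0$; it is in $W_{1e}$ if it is in $L_{2e}$ and, on every $[0,T]$, absolutely continuous with derivative in $L_2$. $\|\cdot\|_{L_2}$ is the (possibly infinite) $L_2(\mathbb R_+)$ norm, with the Euclidean norm on $\mathbb R^m$. $W_0=L_2[a,b]$, and for $k\ge1$, $W_k$ is the Sobolev space of functions in $C^{k-1}[a,b]$ with $\partial_s^{k-1}f$ absolutely continuous and $\partial_s^kf\in L_2[a,b]$. $\mathbb RL_2^{m,p}=\mathbb R^m\times L_2^p[a,b]$. For $\hat{\mathbf x}=\mathrm{col}(\hat{\mathbf x}_0,\dots,\hat{\mathbf x}_N)$ with $\hat{\mathbf x}_i\in W_i^{n_i}$ let $S^j\hat{\mathbf x}=\mathrm{col}(\hat{\mathbf x}_j,\dots,\hat{\mathbf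 x}_N)$, $\mathcal F\hat{\mathbf x}=\mathrm{col}(\hat{\mathbf x},\partial_sS\hat{\mathbf x},\dots,\partial_s^NS^N\hat{\mathbf x})$ (all partial derivatives), $\mathcal C\hat{\mathbf x}=\mathrm{col}(S\hat{\mathbf x},\partial_sS^2\hat{\mathbf x},\dots,\partial_s^{N-1}S^N\hat{\mathbf x})$ (all continuous ones) and $\mathcal B\hat{\mathbf x}=\mathrm{col}((\mathcal C\hat{\mathbf x})(a),(\mathcal C\hat{\mathbf x})(b))$. **GPDE.** A GPDE is given by $n$; real matrices $\mathbf G_{\mathrm o}=\{A,B_{xw},B_{xu},B_{xr},C_z,D_{zw},D_{zu},D_{zr},C_y,D_{yw},D_{yu},D_{yr},C_v,D_{vw},D_{vu}\}$; $\mathbf G_{\mathrm b}=\{B,B_I,B_v\}$ with $B,B_v$ matrices with $n_{BC}$ rows and $B_I\in L_2[a,b]$; and $\mathbf G_{\mathrm p}=\{A_0,A_1,A_2,B_{xv},B_{xb},C_r,D_{rb}\}$ with $D_{rb}$ a matrix and the others essentially bounded measurable matrix functions ($A_1,A_2$ of $(s,\theta)\in[a,b]^2$, the rest of $s\in[a,b]$).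 Its equations are $$\dot x=Ax+B_{xw}w+B_{xu}u+B_{xr}r,\quad z=C_zx+D_{zw}w+D_{zu}u+D_{zr}r,\quad y=C_yx+D_{yw}w+D_{yu}u+D_{yr}r,\quad v=C_vx+D_{vw}w+D_{vu}u,$$ $$\partial_t\hat{\mathbf x}(t,s)=A_0(s)(\mathcal F\hat{\mathbf x}(t))(s)+\int_a^sA_1(s,\theta)(\mathcal F\hat{\mathbf x}(t))(\theta)d\theta+\int_s^bA_2(s,\theta)(\mathcal F\hat{\mathbf x}(t))(\theta)d\theta+B_{xv}(s)v(t)+B_{xb}(s)\mathcal B\hat{\mathbf x}(t),$$ $$r(t)=\int_a^bC_r(\theta)(\mathcal F\hat{\mathbf x}(t))(\theta)d\theta+D_{rb}\mathcal B\hat{\mathbf x}(t).$$ Let $X_v$ be the set of $\hat{\mathbf x}\in\prod_iW_i^{n_i}$ with $\int_a^bB_I(s)(\mathcal F\hat{\mathbf x})(s)ds+B_vv-B\,\mathcal B\hat{\mathbf x}=0$, and $\mathcal X_{w,u}=\{(x,\hat{\mathbf x}): \hat{\mathbf x}\in X_v,\ v=C_vx+D_{vw}w+D_{vu}u\}$.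 For $\{x^0,\hat{\mathbf x}^0\}\in\mathcal X_{w(0),u(0)}$ and $w,u\in L_{2e}$ with $B_vD_{vw}w,\,B_vD_{vu}u\in W_{1e}$, say that $\{x,\hat{\mathbf x},z,y,v,r\}$ is a *weak-signal solution* of the GPDE with initial condition $\{x^0,\hat{\mathbf x}^0\}$ and input $\{w,u\}$ if $z,y\in L_{2e}$, $\{x(t),\hat{\mathbf x}(t)\}\in\mathcal X_{w(t),u(t)}$ for all $t\ge0$, $x$ is differentiable and $\hat{\mathbf x}$ is Fréchet differentiable in $L_2[a,b]$ for almost all $t\ge 0$, $x(0)=x^0$, $\hat{\mathbf x}(0)=\hat{\mathbf x}^0$, and the equations above hold for almost all $t\ge0$. It *satisfies the GPDE* if moreover $v,r\in L_{2e}$. (If the stated conditions on $\{x^0,\hat{\mathbf x}^0\}$, $w$, $u$ fail, there is no solution of either kind.) **Blocks.** Let $\tau_i(s)=s^i/i!$; $T(s)$ the $n_S\times n_S$ block matrix with blocks ($1\le i,j\le N$) $T_{i,j}(s)=\tau_{j-i}(s)\begin{bmatrix}0\\ I_{n_{S_j}}\end{bmatrix}\in\mathbb R^{n_{S_i}\times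 n_{S_j}}$ for $i\le j$ and $0$ for $i>j$, and $T_1$ its first block row; $Q(s)=\mathrm{col}(Q_1(s),\dots,Q_N(s))$ with $Q_i(s)=\begin{bmatrix}0&\mathrm{diag}(\tau_0(s)I_{n_i},\tau_1(s)I_{n_{i+1}},\dots,\tau_{N-i}(s)I_{n_N})\end{bmatrix}\in\mathbb R^{n_{S_i}\times n_{\hat{\mathbf x}}}$; $U_1,U_2$ the $0$-$1$ matrices for which $\mathcal F\hat{\mathbf x}=U_1\mathcal D\hat{\mathbf x}+U_2\mathcal C\hat{\mathbf x}$, $\mathcal D\hat{\mathbf x}=\mathrm{col}(\hat{\mathbf x}_0,\partial_s\hat{\mathbf x}_1,\dots,\partial_s^N\hat{\mathbf x}_N)$; $$B_T=B\begin{bmatrix}T(0)\\T(b-a)\end{bmatrix}-\int_a^bB_I(s)U_2T(s-a)ds.$$ $\{n,\mathbf G_{\mathrm b}\}$ is *admissible* if $B_T$ is invertible (so $n_{BC}=n_S$). Then put $$B_Q(s)=B_T^{-1}\Big(B_I(s)U_1+\int_s^bB_I(\theta)U_2Q(\theta-s)d\theta-B\begin{bmatrix}0\\Q(b-s)\end{bmatrix}\Big),\quad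 G_0=\begin{bmatrix}I_{n_0}&0\\0&0\end{bmatrix},\quad G_2(s,\theta)=\begin{bmatrix}0\\T_1(s-a)B_Q(\theta)\end{bmatrix},$$ $$G_1(s,\theta)=\begin{bmatrix}0\\Q_1(s-\theta)\end{bmatrix}+G_2(s,\theta),\qquad G_v(s)=\begin{bmatrix}0\\T_1(s-a)B_T^{-1}B_v\end{bmatrix}.$$ **4-PI operators.** $\mathcal P\Big[\begin{smallmatrix}P&Q_1\\Q_2&\{R_i\}\end{smallmatrix}\Big]$ maps $(x,\mathbf x)$ to $$\Big(Px+\int_a^bQ_1(\theta)\mathbf x(\theta)d\theta,\ \ Q_2(s)x+R_0(s)\mathbf x(s)+\int_a^sR_1(s,\theta)\mathbf x(\theta)d\theta+\int_s^bR_2(s,\theta)\mathbf x(\theta)d\theta\Big).$$ For parameters $S=(P,Q_1,Q_2,R_i)$ and $S'=(P',Q_1',Q_2',R_i')$, the composition $\mathbf P^4_\times(S,S')=(\hat P,\hat Q_1,\hat Q_2,\hat R_i)$ has $\hat P=PP'+\int_a^bQ_1Q_2'$, $\hat Q_1(s)=PQ_1'(s)+Q_1(s)R_0'(s)+\int_s^bQ_1(\eta)R_1'(\eta,s)d\eta+\int_a^sQ_1(\eta)R_2'(\eta,s)d\eta$,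 $\hat Q_2(s)=Q_2(s)P'+R_0(s)Q_2'(s)+\int_a^sR_1(s,\eta)Q_2'(\eta)d\eta+\int_s^bR_2(s,\eta)Q_2'(\eta)d\eta$, $\hat R_0=R_0R_0'$, $$\hat R_1(s,\eta)=Q_2(s)Q_1'(\eta)+R_0(s)R_1'(s,\eta)+R_1(s,\eta)R_0'(\eta)+\int_a^\eta R_1(s,\theta)R_2'(\theta,\eta)d\theta+\int_\eta^sR_1(s,\theta)R_1'(\theta,\eta)d\theta+\int_s^bR_2(s,\theta)R_1'(\theta,\eta)d\theta,$$ $$\hat R_2(s,\eta)=Q_2(s)Q_1'(\eta)+R_0(s)R_2'(s,\eta)+R_2(s,\eta)R_0'(\eta)+\int_a^sR_1(s,\theta)R_2'(\theta,\eta)d\theta+\int_s^\eta R_2(s,\theta)R_2'(\theta,\eta)d\theta+\int_\eta^bR_2(s,\theta)R_1'(\theta,\eta)d\theta.$$ **Associated PIE.** Let $\Xi$ have $P=[0\ D_{rb}]$, $Q_1=C_r$, $Q_2=[B_{xv}\ B_{xb}]$, $R_i=A_i$, and let $\Upsilon$ have $$P=\begin{bmatrix}I\\B_T^{-1}B_v\\T(b-a)B_T^{-1}B_v\end{bmatrix},\quad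 Q_1(s)=\begin{bmatrix}0\\B_Q(s)\\T(b-a)B_Q(s)+Q(b-s)\end{bmatrix},\quad Q_2(s)=U_2T(s-a)B_T^{-1}B_v,$$ $$R_0=U_1,\quad R_1(s,\theta)=U_2T(s-a)B_Q(\theta)+U_2Q(s-\theta),\quad R_2(s,\theta)=U_2T(s-a)B_Q(\theta).$$ Write $\mathbf P^4_\times(\Xi,\Upsilon)=\Big[\begin{smallmatrix}D_{rv}&C_{rx}\\ \hat B_{v}&\{\hat A_i\}\end{smallmatrix}\Big]$. The PIE $\mathbf G_{\mathrm{PIE}}$ associated with the GPDE has the twelve 4-PI operators (unlisted or empty blocks are $0$) $$\mathcal T=\mathcal P\Big[\begin{smallmatrix}I&0\\G_vC_v&\{G_i\}\end{smallmatrix}\Big],\quad \mathcal T_w=\Big[\begin{smallmatrix}0\\G_vD_{vw}\end{smallmatrix}\Big],\quad \mathcal T_u=\Big[\begin{smallmatrix}0\\G_vD_{vu}\end{smallmatrix}\Big],\quad \mathcal A=\mathcal P\Big[\begin{smallmatrix}A+B_{xr}D_{rv}C_v&B_{xr}C_{rx}\\\hat B_{v}C_v&\{\hat A_i\}\end{smallmatrix}\Big],$$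 $$\mathcal B_1=\Big[\begin{smallmatrix}B_{xw}+B_{xr}D_{rv}D_{vw}\\\hat B_{v}D_{vw}\end{smallmatrix}\Big],\ \mathcal B_2=\Big[\begin{smallmatrix}B_{xu}+B_{xr}D_{rv}D_{vu}\\\hat B_{v}D_{vu}\end{smallmatrix}\Big],\ \mathcal C_1=\mathcal P[C_z+D_{zr}D_{rv}C_v\ \ D_{zr}C_{rx}],\ \mathcal C_2=\mathcal P[C_y+D_{yr}D_{rv}C_v\ \ D_{yr}C_{rx}],$$ $$\mathcal D_{11}=D_{zw}+D_{zr}D_{rv}D_{vw},\ \mathcal D_{12}=D_{zu}+D_{zr}D_{rv}D_{vu},\ \mathcal D_{21}=D_{yw}+D_{yr}D_{rv}D_{vw},\ \mathcal D_{22}=D_{yu}+D_{yr}D_{rv}D_{vu}.$$ For $w,u\in L_{2e}$ with $(\mathcal T_ww)(\cdot,s),(\mathcal T_uu)(\cdot,s)\in W_{1e}$ for all $s\in[a,b]$, $\{\underline{\mathbf x},z,y\}$ *satisfies the PIE* with initial condition $\underline{\mathbf x}^0\in\mathbb RL_2^{n_x,n_{\hat{\mathbf x}}}$ and input $\{w,u\}$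 if $z,y\in L_{2e}$, $\underline{\mathbf x}(t)\in\mathbb RL_2^{n_x,n_{\hat{\mathbf x}}}$ for all $t\ge0$, $\underline{\mathbf x}(0)=\underline{\mathbf x}^0$, and for almost all $t\ge0$ the curves $\mathcal T\underline{\mathbf x}$, $\mathcal T_ww$, $\mathcal T_uu$ are differentiable at $t$ in $\mathbb RL_2$ with $$\partial_t(\mathcal T\underline{\mathbf x})=\mathcal A\underline{\mathbf x}+\mathcal B_1w+\mathcal B_2u-\partial_t(\mathcal T_ww)-\partial_t(\mathcal T_uu),\quad z=\mathcal C_1\underline{\mathbf x}+\mathcal D_{11}w+\mathcal D_{12}u,\quad y=\mathcal C_2\underline{\mathbf x}+\mathcal D_{21}w+\mathcal D_{22}u.$$ The internal signals of a PIE solution $\underline{\mathbf x}=(x,\underline{\hat{\mathbf x}})$ are $v_{\underline{\mathbf x}}=C_vx+D_{vw}w+D_{vu}u$ and $r_{\underline{\mathbf x}}=D_{rv}v_{\underline{\mathbf x}}+\int_a^bC_{rx}(\theta)\underline{\hat{\mathbf x}}(\theta)d\theta$. **Corollary (input-output properties).** Suppose $\{n,\mathbf G_{\mathrm b}\}$ is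 admissible, $w\in L_{2e}$, $B_vD_{vw}w\in W_{1e}$ and $\gamma\ge0$. Call a pair of inputs $\{w,u\}$ *compatible* (with zero initial conditions) if $\{0,0\}\in\mathcal X_{w(0),u(0)}$, i.e. $B_v(D_{vw}w(0)+D_{vu}u(0))=0$. *Open loop.* Suppose $\{w,0\}$ is compatible. Then (1) $\Leftrightarrow$ (2), and (1') $\Leftrightarrow$ (2'), where 1. if $\{x,\hat{\mathbf x},z,y,v,r\}$ satisfies the GPDE with initial condition $\{0,0\}$ and input $\{w,0\}$, then $\|z\|_{L_2}\le\gamma\|w\|_{L_2}$; 2. if $\{\underline{\mathbf x},z,y\}$ satisfies the PIE $\mathbf G_{\mathrm{PIE}}$ with initial condition $0$ and input $\{w,0\}$, and $v_{\underline{\mathbf x}},r_{\underline{\mathbf x}}\in L_{2e}$, then $\|z\|_{L_2}\le\gamma\|w\|_{L_2}$; and (1') is (1) for all weak-signal solutions of the GPDE, (2') is (2) for all solutions of the PIE, without the condition $v_{\underline{\mathbf x}},r_{\underline{\mathbf x}}\in L_{2e}$. *Closed loop.* Let $\mathcal K$ be any map from $L_{2e}^{n_y}$ to $L_{2e}^{n_u}$.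 Then the same two equivalences hold with $\{w,\mathcal Ky\}$, $y$ being the output of the solution, in place of $\{w,0\}$ on both sides, where on the PIE side only those solutions are considered for which $\{w,\mathcal Ky\}$ is compatible. -/

import Mathlib

open MeasureTheory Set Filter Topology Matrix
open scoped ENNReal NNReal Nat

noncomputable section

namespace GPDE

/-! ## Function spaces -/

/-- The space `L₂ₑ[ℝ₊]`: square integrable on every `[0,T]`. A signal is a function of `t : ℝ`
of which only the values at `t ≥ 0` are ever used. -/
def L2e {ι : Type} [Fintype ι] (f : ℝ → ι → ℝ) : Prop :=
  ∀ T : ℝ, 0 ≤ T → MemLp f 2 (volume.restrict (Icc 0 T))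

/-- The space `W₁ₑ[ℝ₊]`: on every `[0,T]` the signal is absolutely continuous and square integrable
with square integrable derivative. -/
def W1e {ι : Type} [Fintype ι] (f : ℝ → ι → ℝ) : Prop :=
  L2e f ∧ ∀ T : ℝ, 0 ≤ T → ∀ i,
    AbsolutelyContinuousOnInterval (fun t => f t i) 0 T ∧
      MemLp (deriv fun t => f t i) 2 (volume.restrict (Icc 0 T))

/-- The norm `‖z‖_{L₂}` on `ℝ₊` (possibly infinite), with the Euclidean norm on `ℝᵐ`. -/
def L2norm {ι : Type} [Fintype ι] (z : ℝ → ι → ℝ) : ℝ≥0∞ :=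
  eLpNorm (fun t => WithLp.toLp 2 (z t)) 2 (volume.restrict (Ici 0))

/-- The Sobolev space `W_k[a,b]` of scalar functions. For `k ≥ 1` an element is identified with its
continuous representative: `f ∈ C^{k-1}[a,b]`, `f^{(k-1)}` is absolutely continuous and
`f^{(k)} ∈ L₂[a,b]`. -/
def SobolevMem (a b : ℝ) : ℕ → (ℝ → ℝ) → Prop
  | 0, f => MemLp f 2 (volume.restrict (Icc a b))
  | k + 1, f => ContDiffOn ℝ k f (Icc a b) ∧
      AbsolutelyContinuousOnInterval (iteratedDerivWithin k f (Icc a b)) a b ∧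
      MemLp (iteratedDerivWithin (k + 1) f (Icc a b)) 2 (volume.restrict (Icc a b))

/-- Square integrable vector-valued functions on `[a,b]`. -/
def L2Mem {ι : Type} [Fintype ι] (a b : ℝ) (f : ℝ → ι → ℝ) : Prop :=
  MemLp f 2 (volume.restrict (Icc a b))

/-- Equality in `L₂[a,b]`. -/
def L2Eq {ι : Type} (a b : ℝ) (f g : ℝ → ι → ℝ) : Prop :=
  f =ᵐ[volume.restrict (Icc a b)] g

/-- `d ∈ L₂[a,b]` is the derivative at time `t` of the curve `τ ↦ f τ` with respect to the
`L₂[a,b]` norm. -/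
def HasL2DerivAt {ι : Type} [Fintype ι] (a b : ℝ) (f : ℝ → ℝ → ι → ℝ) (d : ℝ → ι → ℝ) (t : ℝ) :
    Prop :=
  L2Mem a b d ∧
    Tendsto (fun h : ℝ => eLpNorm (fun s => h⁻¹ • (f (t + h) s - f t s) - d s) 2
      (volume.restrict (Icc a b))) (𝓝[≠] 0) (𝓝 0)

/-- Elements of `ℝᵐ × L₂ᵖ[a,b]` (as functions; membership and equality are `RL2Mem`, `RL2Eq`). -/
abbrev RL2 (m p : Type) := (m → ℝ) × (ℝ → p → ℝ)

def RL2Mem {m p : Type} [Fintype p] (a b : ℝ) (x : RL2 m p) : Prop := L2Mem a b x.2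

def RL2Eq {m p : Type} (a b : ℝ) (x y : RL2 m p) : Prop := x.1 = y.1 ∧ L2Eq a b x.2 y.2

/-- `d` is the derivative at time `t` of a curve in `ℝᵐ × L₂ᵖ[a,b]`. -/
def HasRL2DerivAt {m p : Type} [Fintype m] [Fintype p] (a b : ℝ) (f : ℝ → RL2 m p) (d : RL2 m p)
    (t : ℝ) : Prop :=
  HasDerivAt (fun τ => (f τ).1) d.1 t ∧ HasL2DerivAt a b (fun τ => (f τ).2) d.2 t

/-- A finite-dimensional vector as an element of `ℝᵐ × L₂⁰`. -/
def RL2.ofVec {m : Type} (u : m → ℝ) : RL2 m Empty := (u, 0)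

/-! ## 4-PI operators -/

/-- Entrywise integral of a matrix-valued function over `[a,b]`. -/
def matInt {m p : Type} (a b : ℝ) (f : ℝ → Matrix m p ℝ) : Matrix m p ℝ :=
  Matrix.of fun i j => ∫ s in a..b, f s i j

/-- Entrywise integral of a vector-valued function over `[a,b]`. -/
def vecInt {m : Type} (a b : ℝ) (f : ℝ → m → ℝ) : m → ℝ :=
  fun i => ∫ s in a..b, f s i

/-- Parameters `[P, Q₁; Q₂, {R₀, R₁, R₂}]` of a 4-PI operator `ℝⁿ × L₂^q → ℝᵐ × L₂^p`. An empty
block is one with an empty index type. -/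
structure PI4 (m n p q : Type) where
  P : Matrix m n ℝ
  Q1 : ℝ → Matrix m q ℝ
  Q2 : ℝ → Matrix p n ℝ
  R0 : ℝ → Matrix p q ℝ
  R1 : ℝ → ℝ → Matrix p q ℝ
  R2 : ℝ → ℝ → Matrix p q ℝ

variable {m n p q k l : Type} [Fintype n] [Fintype q] [Fintype k] [Fintype l]

/-- The action of a 4-PI operator. -/
def PI4.apply (a b : ℝ) (S : PI4 m n p q) (x : RL2 n q) : RL2 m p :=
  (S.P *ᵥ x.1 + vecInt a b (fun θ => S.Q1 θ *ᵥ x.2 θ),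
   fun s => S.Q2 s *ᵥ x.1 + S.R0 s *ᵥ x.2 s
      + vecInt a s (fun θ => S.R1 s θ *ᵥ x.2 θ)
      + vecInt s b (fun θ => S.R2 s θ *ᵥ x.2 θ))

/-- The parameters of the composition of two 4-PI operators (the map `P⁴_×`). -/
def PI4.comp (a b : ℝ) (S : PI4 m k p l) (T : PI4 k n l q) : PI4 m n p q where
  P := S.P * T.P + matInt a b (fun s => S.Q1 s * T.Q2 s)
  Q1 s := S.P * T.Q1 s + S.Q1 s * T.R0 s
    + matInt s b (fun η => S.Q1 η * T.R1 η s) + matInt a s (fun η => S.Q1 η * T.R2 η s)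
  Q2 s := S.Q2 s * T.P + S.R0 s * T.Q2 s
    + matInt a s (fun η => S.R1 s η * T.Q2 η) + matInt s b (fun η => S.R2 s η * T.Q2 η)
  R0 s := S.R0 s * T.R0 s
  R1 s η := S.Q2 s * T.Q1 η + S.R0 s * T.R1 s η + S.R1 s η * T.R0 η
    + matInt a η (fun θ => S.R1 s θ * T.R2 θ η) + matInt η s (fun θ => S.R1 s θ * T.R1 θ η)
    + matInt s b (fun θ => S.R2 s θ * T.R1 θ η)
  R2 s η := S.Q2 s * T.Q1 η + S.R0 s * T.R2 s η + S.R2 s η * T.R0 η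
    + matInt a s (fun θ => S.R1 s θ * T.R2 θ η) + matInt s η (fun θ => S.R2 s θ * T.R2 θ η)
    + matInt η b (fun θ => S.R2 s θ * T.R1 θ η)

/-! ## PIE systems -/

/-- The twelve 4-PI parameters of a PIE with state in `ℝ^{nx} × L₂^X`. -/
structure PIEParams (nx : ℕ) (X : Type) (nw nu nz ny : ℕ) where
  T : PI4 (Fin nx) (Fin nx) X X
  Tw : PI4 (Fin nx) (Fin nw) X Empty
  Tu : PI4 (Fin nx) (Fin nu) X Empty
  A : PI4 (Fin nx) (Fin nx) X X
  B1 : PI4 (Fin nx) (Fin nw) X Empty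
  B2 : PI4 (Fin nx) (Fin nu) X Empty
  C1 : PI4 (Fin nz) (Fin nx) Empty X
  C2 : PI4 (Fin ny) (Fin nx) Empty X
  D11 : PI4 (Fin nz) (Fin nw) Empty Empty
  D12 : PI4 (Fin nz) (Fin nu) Empty Empty
  D21 : PI4 (Fin ny) (Fin nw) Empty Empty
  D22 : PI4 (Fin ny) (Fin nu) Empty Empty

/-- `{x, z, y}` satisfies the PIE with parameters `G`, initial condition `x0` and input `{w, u}`.
Differentiability with respect to the `𝒯`-norm means that `t ↦ 𝒯 x(t)` is differentiable in
`ℝ × L₂`; `𝒯 ẋ`, `𝒯_w ẇ`, `𝒯_u u̇` stand for `∂ₜ(𝒯 x)`, `∂ₜ(𝒯_w w)`, `∂ₜ(𝒯_u u)`. -/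
structure IsPIESolution (a b : ℝ) {nx : ℕ} {X : Type} [Fintype X] {nw nu nz ny : ℕ}
    (G : PIEParams nx X nw nu nz ny) (x0 : RL2 (Fin nx) X)
    (w : ℝ → Fin nw → ℝ) (u : ℝ → Fin nu → ℝ)
    (x : ℝ → RL2 (Fin nx) X) (z : ℝ → Fin nz → ℝ) (y : ℝ → Fin ny → ℝ) : Prop where
  w_mem : L2e w
  u_mem : L2e u
  Tw_mem : ∀ s ∈ Icc a b, W1e (fun t => (G.Tw.apply a b (.ofVec (w t))).1) ∧
    W1e (fun t => (G.Tw.apply a b (.ofVec (w t))).2 s)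
  Tu_mem : ∀ s ∈ Icc a b, W1e (fun t => (G.Tu.apply a b (.ofVec (u t))).1) ∧
    W1e (fun t => (G.Tu.apply a b (.ofVec (u t))).2 s)
  x0_mem : RL2Mem a b x0
  z_mem : L2e z
  y_mem : L2e y
  x_mem : ∀ t, 0 ≤ t → RL2Mem a b (x t)
  init : RL2Eq a b (x 0) x0
  dynamics : ∀ᵐ t ∂(volume.restrict (Ici (0 : ℝ))), ∃ dx dw du : RL2 (Fin nx) X,
    HasRL2DerivAt a b (fun τ => G.T.apply a b (x τ)) dx t ∧
    HasRL2DerivAt a b (fun τ => G.Tw.apply a b (.ofVec (w τ))) dw t ∧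
    HasRL2DerivAt a b (fun τ => G.Tu.apply a b (.ofVec (u τ))) du t ∧
    RL2Eq a b dx (G.A.apply a b (x t) + G.B1.apply a b (.ofVec (w t))
      + G.B2.apply a b (.ofVec (u t)) - (dw + du))
  output_z : ∀ᵐ t ∂(volume.restrict (Ici (0 : ℝ))),
    z t = (G.C1.apply a b (x t) + G.D11.apply a b (.ofVec (w t))
      + G.D12.apply a b (.ofVec (u t))).1
  output_y : ∀ᵐ t ∂(volume.restrict (Ici (0 : ℝ))),
    y t = (G.C2.apply a b (x t) + G.D21.apply a b (.ofVec (w t))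
      + G.D22.apply a b (.ofVec (u t))).1

/-! ## GPDE models -/

/-- Components of the distributed state: component `⟨i, j⟩` is the `j`-th entry of `x̂ᵢ ∈ W_i^{n_i}`,
so there are `n_x̂ = ∑ᵢ nᵢ` of them. -/
abbrev StateIdx {N : ℕ} (n : Fin (N + 1) → ℕ) := Σ i : Fin (N + 1), Fin (n i)

/-- Labels of the entries of `ℱ x̂`: the derivative of order `0 ≤ j ≤ i` of a component of `x̂ᵢ`
(there are `n_S + n_x̂`). -/
abbrev DerIdx {N : ℕ} (n : Fin (N + 1) → ℕ) := Σ α : StateIdx n, Fin ((α.1 : ℕ) + 1)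

/-- Labels of the entries of `𝒞 x̂`: the derivative of order `0 ≤ j < i` of a component of `x̂ᵢ`
(there are `n_S`). -/
abbrev ContIdx {N : ℕ} (n : Fin (N + 1) → ℕ) := Σ α : StateIdx n, Fin (α.1 : ℕ)

/-- Labels of the entries of `ℬ x̂ = col(𝒞 x̂ (a), 𝒞 x̂ (b))`. -/
abbrev BdIdx {N : ℕ} (n : Fin (N + 1) → ℕ) := ContIdx n ⊕ ContIdx n

/-- The matrices `G_o` of the ODE subsystem. -/
structure ODEParams (nx nw nu nz ny nv nr : ℕ) where
  A : Matrix (Fin nx) (Fin nx) ℝ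
  Bxw : Matrix (Fin nx) (Fin nw) ℝ
  Bxu : Matrix (Fin nx) (Fin nu) ℝ
  Bxr : Matrix (Fin nx) (Fin nr) ℝ
  Cz : Matrix (Fin nz) (Fin nx) ℝ
  Dzw : Matrix (Fin nz) (Fin nw) ℝ
  Dzu : Matrix (Fin nz) (Fin nu) ℝ
  Dzr : Matrix (Fin nz) (Fin nr) ℝ
  Cy : Matrix (Fin ny) (Fin nx) ℝ
  Dyw : Matrix (Fin ny) (Fin nw) ℝ
  Dyu : Matrix (Fin ny) (Fin nu) ℝ
  Dyr : Matrix (Fin ny) (Fin nr) ℝ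
  Cv : Matrix (Fin nv) (Fin nx) ℝ
  Dvw : Matrix (Fin nv) (Fin nw) ℝ
  Dvu : Matrix (Fin nv) (Fin nu) ℝ

/-- The parameters `G_b = {B, B_I, B_v}` of the boundary conditions. -/
structure BCParams {N : ℕ} (n : Fin (N + 1) → ℕ) (nBC nv : ℕ) where
  B : Matrix (Fin nBC) (BdIdx n) ℝ
  BI : ℝ → Matrix (Fin nBC) (DerIdx n) ℝ
  Bv : Matrix (Fin nBC) (Fin nv) ℝ

/-- The parameters `G_p` of the in-domain dynamics. -/
structure PDEParams {N : ℕ} (n : Fin (N + 1) → ℕ) (nv nr : ℕ) where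
  A0 : ℝ → Matrix (StateIdx n) (DerIdx n) ℝ
  A1 : ℝ → ℝ → Matrix (StateIdx n) (DerIdx n) ℝ
  A2 : ℝ → ℝ → Matrix (StateIdx n) (DerIdx n) ℝ
  Bxv : ℝ → Matrix (StateIdx n) (Fin nv) ℝ
  Bxb : ℝ → Matrix (StateIdx n) (BdIdx n) ℝ
  Cr : ℝ → Matrix (Fin nr) (DerIdx n) ℝ
  Drb : Matrix (Fin nr) (BdIdx n) ℝ

/-- `B_I` is square integrable on `[a,b]`. -/
def BCParams.SquareIntegrable {N : ℕ} {n : Fin (N + 1) → ℕ} {nBC nv : ℕ} (a b : ℝ)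
    (Gb : BCParams n nBC nv) : Prop :=
  ∀ i j, MemLp (fun s => Gb.BI s i j) 2 (volume.restrict (Icc a b))

/-- The functions in `G_p` are measurable and essentially bounded on `[a,b]`, resp. `[a,b]²`. -/
structure PDEParams.Bounded {N : ℕ} {n : Fin (N + 1) → ℕ} {nv nr : ℕ} (a b : ℝ)
    (Gp : PDEParams n nv nr) : Prop where
  A0 : ∀ i j, MemLp (fun s => Gp.A0 s i j) ∞ (volume.restrict (Icc a b))
  A1 : ∀ i j, MemLp (fun z : ℝ × ℝ => Gp.A1 z.1 z.2 i j) ∞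
    ((volume.restrict (Icc a b)).prod (volume.restrict (Icc a b)))
  A2 : ∀ i j, MemLp (fun z : ℝ × ℝ => Gp.A2 z.1 z.2 i j) ∞
    ((volume.restrict (Icc a b)).prod (volume.restrict (Icc a b)))
  Bxv : ∀ i j, MemLp (fun s => Gp.Bxv s i j) ∞ (volume.restrict (Icc a b))
  Bxb : ∀ i j, MemLp (fun s => Gp.Bxb s i j) ∞ (volume.restrict (Icc a b))
  Cr : ∀ i j, MemLp (fun s => Gp.Cr s i j) ∞ (volume.restrict (Icc a b))

section Model

variable {N : ℕ} {n : Fin (N + 1) → ℕ} {nx nw nu nz ny nv nr nBC : ℕ}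

/-- `∂_s^j` of the component `α` of `x̂` (one-sided at the end points of `[a,b]`). -/
def dComp (a b : ℝ) (j : ℕ) (xh : ℝ → StateIdx n → ℝ) (α : StateIdx n) (s : ℝ) : ℝ :=
  iteratedDerivWithin j (fun σ => xh σ α) (Icc a b) s

/-- `(ℱ x̂)(s)`, all partial derivatives. -/
def opF (a b : ℝ) (xh : ℝ → StateIdx n → ℝ) (s : ℝ) : DerIdx n → ℝ :=
  fun d => dComp a b d.2 xh d.1 s

/-- `(𝒞 x̂)(s)`, all absolutely continuous partial derivatives. -/
def opC (a b : ℝ) (xh : ℝ → StateIdx n → ℝ) (s : ℝ) : ContIdx n → ℝ :=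
  fun c => dComp a b c.2 xh c.1 s

/-- `ℬ x̂`, all boundary values. -/
def opB (a b : ℝ) (xh : ℝ → StateIdx n → ℝ) : BdIdx n → ℝ :=
  Sum.elim (opC a b xh a) (opC a b xh b)

/-- `x̂ ∈ X_v`: Sobolev regularity and boundary conditions. -/
def MemXv (a b : ℝ) (Gb : BCParams n nBC nv) (v : Fin nv → ℝ) (xh : ℝ → StateIdx n → ℝ) : Prop :=
  (∀ α : StateIdx n, SobolevMem a b α.1 (fun s => xh s α)) ∧
    vecInt a b (fun s => Gb.BI s *ᵥ opF a b xh s) + Gb.Bv *ᵥ v - Gb.B *ᵥ opB a b xh = 0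

/-- The interconnection signal `v = C_v x + D_vw w + D_vu u` at one time. -/
def vSig (Go : ODEParams nx nw nu nz ny nv nr) (x : Fin nx → ℝ) (w : Fin nw → ℝ)
    (u : Fin nu → ℝ) : Fin nv → ℝ :=
  Go.Cv *ᵥ x + Go.Dvw *ᵥ w + Go.Dvu *ᵥ u

/-- `{x, x̂} ∈ 𝒳_{w,u}`. -/
def MemXwu (a b : ℝ) (Go : ODEParams nx nw nu nz ny nv nr) (Gb : BCParams n nBC nv)
    (w : Fin nw → ℝ) (u : Fin nu → ℝ) (x : Fin nx → ℝ) (xh : ℝ → StateIdx n → ℝ) : Prop :=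
  MemXv a b Gb (vSig Go x w u) xh

/-- Right-hand side of the in-domain dynamics. -/
def pdeRHS (a b : ℝ) (Gp : PDEParams n nv nr) (v : Fin nv → ℝ) (xh : ℝ → StateIdx n → ℝ) (s : ℝ) :
    StateIdx n → ℝ :=
  Gp.A0 s *ᵥ opF a b xh s + Gp.Bxv s *ᵥ v + Gp.Bxb s *ᵥ opB a b xh
    + vecInt a s (fun θ => Gp.A1 s θ *ᵥ opF a b xh θ)
    + vecInt s b (fun θ => Gp.A2 s θ *ᵥ opF a b xh θ)

/-- Output of the PDE subsystem. -/
def pdeOut (a b : ℝ) (Gp : PDEParams n nv nr) (xh : ℝ → StateIdx n → ℝ) : Fin nr → ℝ :=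
  Gp.Drb *ᵥ opB a b xh + vecInt a b (fun θ => Gp.Cr θ *ᵥ opF a b xh θ)

/-- `{x, x̂, z, y, v, r}` satisfies the GPDE with initial condition `{x0, xh0}` and input `{w, u}`,
except that nothing is required of the integrability in time of the internal signals `v`, `r`. -/
structure IsGPDESolutionCore (a b : ℝ) (Go : ODEParams nx nw nu nz ny nv nr)
    (Gb : BCParams n nBC nv) (Gp : PDEParams n nv nr)
    (x0 : Fin nx → ℝ) (xh0 : ℝ → StateIdx n → ℝ)
    (w : ℝ → Fin nw → ℝ) (u : ℝ → Fin nu → ℝ)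
    (x : ℝ → Fin nx → ℝ) (xh : ℝ → ℝ → StateIdx n → ℝ)
    (z : ℝ → Fin nz → ℝ) (y : ℝ → Fin ny → ℝ) (v : ℝ → Fin nv → ℝ) (r : ℝ → Fin nr → ℝ) :
    Prop where
  init_mem : MemXwu a b Go Gb (w 0) (u 0) x0 xh0
  w_mem : L2e w
  u_mem : L2e u
  Bw_mem : W1e (fun t => (Gb.Bv * Go.Dvw) *ᵥ w t)
  Bu_mem : W1e (fun t => (Gb.Bv * Go.Dvu) *ᵥ u t)
  z_mem : L2e z
  y_mem : L2e y
  state_mem : ∀ t, 0 ≤ t → MemXwu a b Go Gb (w t) (u t) (x t) (xh t)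
  init_x : x 0 = x0
  init_xh : L2Eq a b (xh 0) xh0
  ode : ∀ᵐ t ∂(volume.restrict (Ici (0 : ℝ))),
    HasDerivAt x (Go.A *ᵥ x t + Go.Bxw *ᵥ w t + Go.Bxu *ᵥ u t + Go.Bxr *ᵥ r t) t
  output_z : ∀ᵐ t ∂(volume.restrict (Ici (0 : ℝ))),
    z t = Go.Cz *ᵥ x t + Go.Dzw *ᵥ w t + Go.Dzu *ᵥ u t + Go.Dzr *ᵥ r t
  output_y : ∀ᵐ t ∂(volume.restrict (Ici (0 : ℝ))),
    y t = Go.Cy *ᵥ x t + Go.Dyw *ᵥ w t + Go.Dyu *ᵥ u t + Go.Dyr *ᵥ r t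
  output_v : ∀ᵐ t ∂(volume.restrict (Ici (0 : ℝ))), v t = vSig Go (x t) (w t) (u t)
  pde : ∀ᵐ t ∂(volume.restrict (Ici (0 : ℝ))), HasL2DerivAt a b xh (pdeRHS a b Gp (v t) (xh t)) t
  output_r : ∀ᵐ t ∂(volume.restrict (Ici (0 : ℝ))), r t = pdeOut a b Gp (xh t)

/-- `{x, x̂, z, y, v, r}` satisfies the GPDE with initial condition `{x0, xh0}` and input `{w, u}`. -/
structure IsGPDESolution (a b : ℝ) (Go : ODEParams nx nw nu nz ny nv nr)
    (Gb : BCParams n nBC nv) (Gp : PDEParams n nv nr)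
    (x0 : Fin nx → ℝ) (xh0 : ℝ → StateIdx n → ℝ)
    (w : ℝ → Fin nw → ℝ) (u : ℝ → Fin nu → ℝ)
    (x : ℝ → Fin nx → ℝ) (xh : ℝ → ℝ → StateIdx n → ℝ)
    (z : ℝ → Fin nz → ℝ) (y : ℝ → Fin ny → ℝ) (v : ℝ → Fin nv → ℝ) (r : ℝ → Fin nr → ℝ) :
    Prop extends IsGPDESolutionCore a b Go Gb Gp x0 xh0 w u x xh z y v r where
  v_mem : L2e v
  r_mem : L2e r

/-! ## The associated PIE -/

/-- `τ_k(s) = s^k / k!`. -/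
def tau (k : ℕ) (s : ℝ) : ℝ := s ^ k / (k ! : ℝ)

/-- The matrix `T(s)`. -/
def matT (n : Fin (N + 1) → ℕ) (s : ℝ) : Matrix (ContIdx n) (ContIdx n) ℝ :=
  Matrix.of fun c d =>
    if c.1 = d.1 ∧ (c.2 : ℕ) ≤ d.2 then tau ((d.2 : ℕ) - c.2) s else 0

/-- The matrix `Q(s)`. -/
def matQ (n : Fin (N + 1) → ℕ) (s : ℝ) : Matrix (ContIdx n) (StateIdx n) ℝ :=
  Matrix.of fun c β => if c.1 = β then tau ((c.1.1 : ℕ) - c.2 - 1) s else 0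

/-- The block matrix `[0; T₁(s)]`, with zero rows for the components of `x̂₀`. -/
def matT1 (n : Fin (N + 1) → ℕ) (s : ℝ) : Matrix (StateIdx n) (ContIdx n) ℝ :=
  Matrix.of fun α d => if α = d.1 then tau d.2 s else 0

/-- The block matrix `[0; Q₁(s)]`, with zero rows for the components of `x̂₀`. -/
def matQ1 (n : Fin (N + 1) → ℕ) (s : ℝ) : Matrix (StateIdx n) (StateIdx n) ℝ :=
  Matrix.of fun α β => if α = β ∧ 0 < (α.1 : ℕ) then tau ((α.1 : ℕ) - 1) s else 0

/-- `U₁` selects from `ℱ x̂` the derivatives of maximal order. -/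
def matU1 (n : Fin (N + 1) → ℕ) : Matrix (DerIdx n) (StateIdx n) ℝ :=
  Matrix.of fun d β => if d.1 = β ∧ (d.2 : ℕ) = d.1.1 then 1 else 0

/-- `U₂` selects from `ℱ x̂` the derivatives of non-maximal order. -/
def matU2 (n : Fin (N + 1) → ℕ) : Matrix (DerIdx n) (ContIdx n) ℝ :=
  Matrix.of fun d c => if d.1 = c.1 ∧ (d.2 : ℕ) = c.2 then 1 else 0

/-- The matrix `B_T`. -/
def matBT (a b : ℝ) (Gb : BCParams n nBC nv) : Matrix (Fin nBC) (ContIdx n) ℝ :=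
  Gb.B * Matrix.fromRows (matT n 0) (matT n (b - a))
    - matInt a b (fun s => Gb.BI s * matU2 n * matT n (s - a))

/-- `{n, G_b}` is admissible: `B_T` is invertible (in particular square, `n_BC = n_S`). -/
def Admissible (a b : ℝ) (Gb : BCParams n nBC nv) : Prop :=
  ∃ M : Matrix (ContIdx n) (Fin nBC) ℝ, matBT a b Gb * M = 1 ∧ M * matBT a b Gb = 1

open Classical in
/-- The inverse `B_T⁻¹` (meaningful for admissible boundary conditions). -/
def matBTinv (a b : ℝ) (Gb : BCParams n nBC nv) : Matrix (ContIdx n) (Fin nBC) ℝ :=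
  if h : Admissible a b Gb then h.choose else 0

/-- The matrix function `B_Q`. -/
def matBQ (a b : ℝ) (Gb : BCParams n nBC nv) (s : ℝ) : Matrix (ContIdx n) (StateIdx n) ℝ :=
  matBTinv a b Gb * (Gb.BI s * matU1 n + matInt s b (fun θ => Gb.BI θ * matU2 n * matQ n (θ - s))
    - Gb.B * Matrix.fromRows 0 (matQ n (b - s)))

/-- The matrix `G₀`. -/
def matG0 (n : Fin (N + 1) → ℕ) : Matrix (StateIdx n) (StateIdx n) ℝ :=
  Matrix.of fun α β => if α = β ∧ (α.1 : ℕ) = 0 then 1 else 0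

/-- The kernel `G₂`. -/
def matG2 (a b : ℝ) (Gb : BCParams n nBC nv) (s θ : ℝ) : Matrix (StateIdx n) (StateIdx n) ℝ :=
  matT1 n (s - a) * matBQ a b Gb θ

/-- The kernel `G₁`. -/
def matG1 (a b : ℝ) (Gb : BCParams n nBC nv) (s θ : ℝ) : Matrix (StateIdx n) (StateIdx n) ℝ :=
  matQ1 n (s - θ) + matG2 a b Gb s θ

/-- The matrix function `G_v`. -/
def matGv (a b : ℝ) (Gb : BCParams n nBC nv) (s : ℝ) : Matrix (StateIdx n) (Fin nv) ℝ :=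
  matT1 n (s - a) * matBTinv a b Gb * Gb.Bv

/-- The parameters `Υ`, of the operator that maps `(v, 𝒟 x̂)` to `(col(v, ℬ x̂), ℱ x̂)`. -/
def Upsilon (a b : ℝ) (Gb : BCParams n nBC nv) :
    PI4 (Fin nv ⊕ BdIdx n) (Fin nv) (DerIdx n) (StateIdx n) where
  P := Matrix.fromRows 1 (Matrix.fromRows (matBTinv a b Gb * Gb.Bv)
    (matT n (b - a) * matBTinv a b Gb * Gb.Bv))
  Q1 s := Matrix.fromRows 0 (Matrix.fromRows (matBQ a b Gb s)
    (matT n (b - a) * matBQ a b Gb s + matQ n (b - s)))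
  Q2 s := matU2 n * matT n (s - a) * matBTinv a b Gb * Gb.Bv
  R0 _ := matU1 n
  R1 s θ := matU2 n * matT n (s - a) * matBQ a b Gb θ + matU2 n * matQ n (s - θ)
  R2 s θ := matU2 n * matT n (s - a) * matBQ a b Gb θ

/-- The parameters `Ξ` of the in-domain dynamics. -/
def Xi (Gp : PDEParams n nv nr) :
    PI4 (Fin nr) (Fin nv ⊕ BdIdx n) (StateIdx n) (DerIdx n) where
  P := Matrix.fromCols 0 Gp.Drb
  Q1 := Gp.Cr
  Q2 s := Matrix.fromCols (Gp.Bxv s) (Gp.Bxb s)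
  R0 := Gp.A0
  R1 := Gp.A1
  R2 := Gp.A2

/-- The parameters `[D_rv, C_rx; B_xv, {Â_i}] = P⁴_×(Ξ, Υ)`. -/
def pdePI (a b : ℝ) (Gb : BCParams n nBC nv) (Gp : PDEParams n nv nr) :
    PI4 (Fin nr) (Fin nv) (StateIdx n) (StateIdx n) :=
  (Xi Gp).comp a b (Upsilon a b Gb)

/-- The PIE `𝐌(n, G_b, G_o, G_p)` associated with a GPDE. -/
def associatedPIE (a b : ℝ) (Go : ODEParams nx nw nu nz ny nv nr) (Gb : BCParams n nBC nv)
    (Gp : PDEParams n nv nr) : PIEParams nx (StateIdx n) nw nu nz ny :=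
  let H := pdePI a b Gb Gp
  { T := ⟨1, 0, fun s => matGv a b Gb s * Go.Cv, fun _ => matG0 n, matG1 a b Gb, matG2 a b Gb⟩
    Tw := ⟨0, 0, fun s => matGv a b Gb s * Go.Dvw, 0, 0, 0⟩
    Tu := ⟨0, 0, fun s => matGv a b Gb s * Go.Dvu, 0, 0, 0⟩
    A := ⟨Go.A + Go.Bxr * H.P * Go.Cv, fun s => Go.Bxr * H.Q1 s, fun s => H.Q2 s * Go.Cv,
      H.R0, H.R1, H.R2⟩
    B1 := ⟨Go.Bxw + Go.Bxr * H.P * Go.Dvw, 0, fun s => H.Q2 s * Go.Dvw, 0, 0, 0⟩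
    B2 := ⟨Go.Bxu + Go.Bxr * H.P * Go.Dvu, 0, fun s => H.Q2 s * Go.Dvu, 0, 0, 0⟩
    C1 := ⟨Go.Cz + Go.Dzr * H.P * Go.Cv, fun s => Go.Dzr * H.Q1 s, 0, 0, 0, 0⟩
    C2 := ⟨Go.Cy + Go.Dyr * H.P * Go.Cv, fun s => Go.Dyr * H.Q1 s, 0, 0, 0, 0⟩
    D11 := ⟨Go.Dzw + Go.Dzr * H.P * Go.Dvw, 0, 0, 0, 0, 0⟩
    D12 := ⟨Go.Dzu + Go.Dzr * H.P * Go.Dvu, 0, 0, 0, 0, 0⟩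
    D21 := ⟨Go.Dyw + Go.Dyr * H.P * Go.Dvw, 0, 0, 0, 0, 0⟩
    D22 := ⟨Go.Dyu + Go.Dyr * H.P * Go.Dvu, 0, 0, 0, 0, 0⟩ }

/-- The signal `v = C_v x + D_vw w + D_vu u` along a trajectory of the associated PIE. -/
def pieV (Go : ODEParams nx nw nu nz ny nv nr) (w : ℝ → Fin nw → ℝ) (u : ℝ → Fin nu → ℝ)
    (x : ℝ → RL2 (Fin nx) (StateIdx n)) (t : ℝ) : Fin nv → ℝ :=
  vSig Go (x t).1 (w t) (u t)

/-- The signal `r = 𝒞_r x̲̂ + 𝒟_rv v` along a trajectory of the associated PIE. -/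
def pieR (a b : ℝ) (Go : ODEParams nx nw nu nz ny nv nr) (Gb : BCParams n nBC nv)
    (Gp : PDEParams n nv nr) (w : ℝ → Fin nw → ℝ) (u : ℝ → Fin nu → ℝ)
    (x : ℝ → RL2 (Fin nx) (StateIdx n)) (t : ℝ) : Fin nr → ℝ :=
  ((pdePI a b Gb Gp).apply a b (pieV Go w u x t, (x t).2)).1

end Model

end GPDE

end

noncomputable section

namespace GPDE

/-! ## Taylor expansion with integral remainder in the Sobolev spaces `W_k` -/

section Taylor

variable {a b : ℝ}

/-! Fix one instant. By Taylor's formula with integral remainder, a state amounts to the vector `c`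
of its continuous derivatives at `a` together with its derivatives of maximal order `f ∈ L₂[a,b]`
(`StateSobolev.eq_synthState` in one direction, `stateSobolev_synthState` and `topDer_synthState` in
the other). In these coordinates the boundary conditions become the linear system `B_T c = B_v v +
B_T ∫ B_Q f` (`boundary_defect`), which an invertible `B_T` solves uniquely by `c = bdValue`. Hence
`X_v` is parametrised by an unconstrained `f` (`memXv_iff`, `memXv_synthState`).

Substituting this `c` back makes the state, its boundary values and all its derivatives 4-PI
expressions in `(v, f)` (`state_operator_eq`, `Upsilon_apply_fst`, `Upsilon_apply_snd`). The
right-hand side of the PDE and its output `r` arise by applying `Ξ` to these, and Fubini's theorem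
identifies the composite with the operator whose parameters are `P⁴_×(Ξ, Υ)` (`PI4.comp_apply_fst`,
`PI4.comp_apply_snd`). Since `v` is linear in `(x, w, u)`, the state is `𝒯 x + 𝒯_w w + 𝒯_u u`
(`associatedPIE_state`).

In time, taking `𝒯_w w` and `𝒯_u u` to the other side of the evolution equation produces the terms
`-∂ₜ(𝒯_w w) - ∂ₜ(𝒯_u u)` of the PIE. Trajectories therefore translate both ways with the same `w`,
`u`, `z`, `y` and, almost everywhere, the same `v`, `r` (`IsGPDESolutionCore.isPIESolution`,
`IsPIESolution.isGPDESolutionCore`). Every property of `z` transfers, the gain bound among them; and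
since `y` is shared, so is the input `𝒦 y`, whatever the map `𝒦` is.

Two points are asymmetric. For the PIE, zero initial data means `f = 0`, which leaves `c = B_T⁻¹ B_v
v(0)`; this is the zero state only for compatible inputs. And the PIE constrains `𝒯_u u` pointwise
in `s` where the GPDE constrains `B_v D_vu u`; interpolation in `s` recovers the latter
(`w1e_of_matT1_mulVec`). -/

lemma tau_zero (s : ℝ) : tau 0 s = 1 := by simp [tau]

lemma tau_apply_zero (k : ℕ) : tau k 0 = if k = 0 then 1 else 0 := by
  rcases k with _ | k <;> simp [tau]

@[fun_prop]
lemma contDiff_tau (k : ℕ) {m : WithTop ℕ∞} : ContDiff ℝ m (tau k) := by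
  unfold tau; fun_prop

@[fun_prop]
lemma continuous_tau (k : ℕ) : Continuous (tau k) := by
  unfold tau; fun_prop

lemma hasDerivAt_tau (k : ℕ) (s : ℝ) : HasDerivAt (tau (k + 1)) (tau k s) s := by
  have h := (hasDerivAt_pow (k + 1) s).div_const ((k + 1)! : ℝ)
  convert! h using 1
  simp only [tau, Nat.factorial_succ]
  push_cast
  have : (k ! : ℝ) ≠ 0 := by positivity
  have : (k + 1 : ℝ) ≠ 0 := by positivity
  field_simp

lemma absolutelyContinuousOnInterval_congr {f g : ℝ → ℝ}
    (hf : AbsolutelyContinuousOnInterval f a b) (h : EqOn f g (uIcc a b)) :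
    AbsolutelyContinuousOnInterval g a b := by
  rw [absolutelyContinuousOnInterval_iff] at hf ⊢
  intro ε hε
  obtain ⟨δ, hδ, H⟩ := hf ε hε
  refine ⟨δ, hδ, fun E hE hlt => ?_⟩
  convert! H E hE hlt using 1
  refine Finset.sum_congr rfl fun i hi => ?_
  have := hE.1 i hi
  rw [h this.1, h this.2]

lemma intervalIntegrable_mono_right {f : ℝ → ℝ} (hf : IntervalIntegrable f volume a b)
    {s : ℝ} (hs : s ∈ Icc a b) : IntervalIntegrable f volume a s := by
  refine hf.mono_set ?_
  rw [uIcc_of_le hs.1, uIcc_of_le (hs.1.trans hs.2)]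
  exact Icc_subset_Icc_right hs.2

lemma intervalIntegrable_mono_left {f : ℝ → ℝ} (hf : IntervalIntegrable f volume a b)
    {s : ℝ} (hs : s ∈ Icc a b) : IntervalIntegrable f volume s b := by
  refine hf.mono_set ?_
  rw [uIcc_of_le hs.2, uIcc_of_le (hs.1.trans hs.2)]
  exact Icc_subset_Icc_left hs.1

/-- Integration by parts for the kernel `τ_{m+1}(s - θ)`. -/
lemma integral_tau_succ_mul {f : ℝ → ℝ} {s : ℝ} (hf : IntervalIntegrable f volume a s)
    (m : ℕ) :
    ∫ θ in a..s, tau (m + 1) (s - θ) * f θ =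
      ∫ θ in a..s, tau m (s - θ) * ∫ η in a..θ, f η := by
  have hF := hf.absolutelyContinuousOnInterval_intervalIntegral (left_mem_uIcc : a ∈ uIcc a s)
  have hg : AbsolutelyContinuousOnInterval (fun θ => tau (m + 1) (s - θ)) a s := by
    refine ContDiffOn.absolutelyContinuousOnInterval ?_
    have : ContDiff ℝ 1 (fun θ => tau (m + 1) (s - θ)) :=
      (contDiff_tau (m + 1)).comp (by fun_prop)
    exact this.contDiffOn
  have hparts := hg.integral_mul_deriv_eq_deriv_mul hF
  have hd : ∀ θ, deriv (fun θ => tau (m + 1) (s - θ)) θ = - tau m (s - θ) := fun θ => by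
    have := (hasDerivAt_tau m (s - θ)).comp_const_sub s θ
    exact this.deriv
  -- By Lebesgue differentiation `f` is almost everywhere the derivative of its primitive, which is
  -- absolutely continuous; integration by parts then applies although `f` is merely integrable.
  have h1 : ∫ θ in a..s, tau (m + 1) (s - θ) * f θ =
      ∫ θ in a..s, tau (m + 1) (s - θ) * deriv (fun x => ∫ v in a..x, f v) θ := by
    refine intervalIntegral.integral_congr_ae ?_
    filter_upwards [hf.ae_hasDerivAt_integral] with x hx hx'
    rw [(hx (uIoc_subset_uIcc hx') a left_mem_uIcc).deriv]
  rw [h1, hparts]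
  -- Both boundary terms vanish: the kernel is zero at `θ = s` and the primitive is zero at `θ = a`.
  simp [hd, tau_apply_zero]

lemma hasDerivWithinAt_integral_of_continuousOn {f : ℝ → ℝ} (hf : ContinuousOn f (Icc a b))
    {s : ℝ} (hs : s ∈ Icc a b) :
    HasDerivWithinAt (fun s => ∫ θ in a..s, f θ) (f s) (Icc a b) s := by
  have : Fact (s ∈ Icc a b) := ⟨hs⟩
  have hI : IntervalIntegrable f volume a s :=
    (hf.mono (by rw [uIcc_of_le hs.1]; exact Icc_subset_Icc_right hs.2)).intervalIntegrable
  exact intervalIntegral.integral_hasDerivWithinAt_right hI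
    (hf.stronglyMeasurableAtFilter_nhdsWithin measurableSet_Icc s) (hf s hs)

lemma continuousOn_primitive {f : ℝ → ℝ} (hab : a ≤ b)
    (hf : IntervalIntegrable f volume a b) :
    ContinuousOn (fun s => ∫ θ in a..s, f θ) (Icc a b) := by
  rw [← uIcc_of_le hab]
  exact (hf.absolutelyContinuousOnInterval_intervalIntegral
    (left_mem_uIcc : a ∈ uIcc a b)).continuousOn

/-- Integration by parts lowers the kernel by one order and replaces `f` by its primitive, so
induction over all `f` reduces to `m = 0`. There the integrand has become a continuous primitive and
the fundamental theorem holds at every point, not just almost everywhere. -/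
lemma hasDerivWithinAt_integral_tau_succ (hab : a ≤ b) (m : ℕ) :
    ∀ {f : ℝ → ℝ}, IntervalIntegrable f volume a b → ∀ {s : ℝ}, s ∈ Icc a b →
    HasDerivWithinAt (fun s => ∫ θ in a..s, tau (m + 1) (s - θ) * f θ)
      (∫ θ in a..s, tau m (s - θ) * f θ) (Icc a b) s := by
  induction m with
  | zero =>
    intro f hf s hs
    have h := hasDerivWithinAt_integral_of_continuousOn (continuousOn_primitive hab hf) hs
    have e : ∀ s ∈ Icc a b, ∫ θ in a..s, tau (0 + 1) (s - θ) * f θ =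
        ∫ θ in a..s, ∫ η in a..θ, f η := fun s hs => by
      rw [integral_tau_succ_mul (intervalIntegrable_mono_right hf hs) 0]
      simp [tau_zero]
    simp only [tau_zero, one_mul]
    exact h.congr e (e s hs)
  | succ m ih =>
    intro f hf s hs
    have hF : IntervalIntegrable (fun s => ∫ θ in a..s, f θ) volume a b := by
      refine ContinuousOn.intervalIntegrable ?_
      rw [uIcc_of_le hab]
      exact continuousOn_primitive hab hf
    have h := ih hF hs
    have e : ∀ m, ∀ s ∈ Icc a b, ∫ θ in a..s, tau (m + 1) (s - θ) * f θ =
        ∫ θ in a..s, tau m (s - θ) * ∫ η in a..θ, f η := fun m s hs =>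
      integral_tau_succ_mul (intervalIntegrable_mono_right hf hs) m
    rw [e m s hs]
    exact h.congr (e (m + 1)) (e (m + 1) s hs)

/-- The `j`-th derivative of the function whose derivatives at `a` are `c` and whose `k`-th
derivative is `f`. -/
def taylorSynth (a : ℝ) {k : ℕ} (c : Fin k → ℝ) (f : ℝ → ℝ) (j : ℕ) (s : ℝ) : ℝ :=
  (∑ l : Fin k, (if j ≤ (l : ℕ) then tau ((l : ℕ) - j) (s - a) else 0) * c l) +
    ∫ θ in a..s, tau (k - j - 1) (s - θ) * f θ

variable {k : ℕ}

lemma taylorSynth_left (c : Fin k → ℝ) (f : ℝ → ℝ) (j : Fin k) :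
    taylorSynth a c f j a = c j := by
  unfold taylorSynth
  rw [intervalIntegral.integral_same, add_zero, Finset.sum_eq_single j]
  · simp [tau_zero]
  · intro l _ hl
    split_ifs with h
    · rw [sub_self, tau_apply_zero, if_neg, zero_mul]
      have : (j : ℕ) ≠ l := fun h => hl (Fin.ext h.symm)
      omega
    · simp
  · simp

/-- The bound `j + 1 < k` keeps the remainder kernel of order at least one, so the derivative exists
everywhere. The last derivative, from order `k - 1` to `k`, exists only almost everywhere; see
`iteratedDerivWithin_taylorSynth_top`. -/
lemma hasDerivWithinAt_taylorSynth (hab : a ≤ b) (c : Fin k → ℝ) {f : ℝ → ℝ}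
    (hf : IntervalIntegrable f volume a b) {j : ℕ} (hj : j + 1 < k) {s : ℝ} (hs : s ∈ Icc a b) :
    HasDerivWithinAt (taylorSynth a c f j) (taylorSynth a c f (j + 1) s) (Icc a b) s := by
  unfold taylorSynth
  refine HasDerivWithinAt.add ?_ ?_
  · refine HasDerivWithinAt.fun_sum fun l _ => HasDerivWithinAt.mul_const ?_ (c l)
    -- Monomials with `l < j` have already vanished, the one with `l = j` is a constant about to
    -- vanish, and those with `l > j` lose one degree.
    rcases lt_trichotomy (l : ℕ) j with h | h | h
    · rw [if_neg (by omega)]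
      simp only [if_neg (show ¬ j ≤ (l : ℕ) by omega)]
      exact hasDerivWithinAt_const _ _ _
    · rw [if_neg (by omega)]
      simp only [h, le_refl, if_true, Nat.sub_self, tau_zero]
      exact hasDerivWithinAt_const _ _ _
    · rw [if_pos (by omega)]
      simp only [if_pos (show j ≤ (l : ℕ) by omega)]
      obtain ⟨d, hd⟩ : ∃ d, (l : ℕ) - j = d + 1 := ⟨(l : ℕ) - j - 1, by omega⟩
      rw [hd, show (l : ℕ) - (j + 1) = d by omega]
      exact ((hasDerivAt_tau d (s - a)).comp_sub_const s a).hasDerivWithinAt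
  · obtain ⟨d, hd⟩ : ∃ d, k - j - 1 = d + 1 := ⟨k - j - 2, by omega⟩
    rw [hd, show k - (j + 1) - 1 = d by omega]
    exact hasDerivWithinAt_integral_tau_succ hab d hf hs

lemma taylorSynth_last {c : Fin (k + 1) → ℝ} {f : ℝ → ℝ} (s : ℝ) :
    taylorSynth a c f k s = c (Fin.last k) + ∫ θ in a..s, f θ := by
  unfold taylorSynth
  rw [Finset.sum_eq_single (Fin.last k)]
  · simp [tau_zero]
  · intro l _ hl
    rw [if_neg, zero_mul]
    have := l.2
    have : (l : ℕ) ≠ k := fun h => hl (Fin.ext h)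
    omega
  · simp

lemma iteratedDerivWithin_taylorSynth (hab : a < b) (c : Fin k → ℝ) {f : ℝ → ℝ}
    (hf : IntervalIntegrable f volume a b) {j : ℕ} (hj : j < k) :
    EqOn (iteratedDerivWithin j (taylorSynth a c f 0) (Icc a b)) (taylorSynth a c f j)
      (Icc a b) := by
  induction j with
  | zero => intro s _; simp
  | succ j ih =>
    intro s hs
    rw [iteratedDerivWithin_succ]
    have h := (hasDerivWithinAt_taylorSynth hab.le c hf hj hs).congr (ih (by omega))
      (ih (by omega) hs)
    exact h.derivWithin (uniqueDiffOn_Icc hab s hs)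

lemma ae_restrict_Icc_mem_Ioo : ∀ᵐ s ∂(volume.restrict (Icc a b)), s ∈ Ioo a b := by
  rw [← restrict_Ioo_eq_restrict_Icc]
  exact ae_restrict_mem measurableSet_Ioo

/-- The derivative of order `k` is a constant plus the primitive of `f`, so this is Lebesgue's
differentiation theorem. -/
lemma iteratedDerivWithin_taylorSynth_top (hab : a < b) (c : Fin (k + 1) → ℝ) {f : ℝ → ℝ}
    (hf : IntervalIntegrable f volume a b) :
    iteratedDerivWithin (k + 1) (taylorSynth a c f 0) (Icc a b)
      =ᵐ[volume.restrict (Icc a b)] f := by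
  rw [iteratedDerivWithin_succ]
  have h := hf.ae_hasDerivAt_integral
  filter_upwards [ae_restrict_of_ae h, ae_restrict_Icc_mem_Ioo] with s hs hs'
  have hsI := Ioo_subset_Icc_self hs'
  rw [uIcc_of_le hab.le] at hs
  have e : EqOn (iteratedDerivWithin k (taylorSynth a c f 0) (Icc a b))
      (fun s => c (Fin.last k) + ∫ θ in a..s, f θ) (Icc a b) := fun s hs => by
    rw [iteratedDerivWithin_taylorSynth hab c hf (Nat.lt_succ_self k) hs, taylorSynth_last]
  have hd := ((hs hsI a (left_mem_Icc.2 hab.le)).const_add (c (Fin.last k))).hasDerivWithinAt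
    (s := Icc a b)
  exact (hd.congr e (e hsI)).derivWithin (uniqueDiffOn_Icc hab s hsI)

lemma intervalIntegrable_of_memLp_two {f : ℝ → ℝ} (hab : a ≤ b)
    (hf : MemLp f 2 (volume.restrict (Icc a b))) : IntervalIntegrable f volume a b := by
  rw [intervalIntegrable_iff_integrableOn_Icc_of_le hab]
  exact hf.integrable (by norm_num)

lemma sobolevMem_taylorSynth (hab : a < b) (c : Fin (k + 1) → ℝ) {f : ℝ → ℝ}
    (hf : MemLp f 2 (volume.restrict (Icc a b))) :
    SobolevMem a b (k + 1) (taylorSynth a c f 0) := by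
  have hI := intervalIntegrable_of_memLp_two hab.le hf
  have hAC : AbsolutelyContinuousOnInterval
      (iteratedDerivWithin k (taylorSynth a c f 0) (Icc a b)) a b := by
    have h1 : AbsolutelyContinuousOnInterval
        (fun s => c (Fin.last k) + ∫ θ in a..s, f θ) a b := by
      refine AbsolutelyContinuousOnInterval.fun_add ?_
        (hI.absolutelyContinuousOnInterval_intervalIntegral left_mem_uIcc)
      exact ContDiffOn.absolutelyContinuousOnInterval contDiffOn_const
    refine absolutelyContinuousOnInterval_congr h1 fun s hs => ?_
    rw [uIcc_of_le hab.le] at hs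
    rw [iteratedDerivWithin_taylorSynth hab c hI (Nat.lt_succ_self k) hs, taylorSynth_last]
  have hdiff : ∀ j < k, DifferentiableOn ℝ
      (iteratedDerivWithin j (taylorSynth a c f 0) (Icc a b)) (Icc a b) := fun j hj s hs =>
    ((hasDerivWithinAt_taylorSynth hab.le c hI (Nat.succ_lt_succ hj) hs).congr
      (iteratedDerivWithin_taylorSynth hab c hI (by omega))
      (iteratedDerivWithin_taylorSynth hab c hI (by omega) hs)).differentiableWithinAt
  refine ⟨?_, hAC, ?_⟩
  · rw [contDiffOn_nat_iff_continuousOn_differentiableOn_deriv (uniqueDiffOn_Icc hab)]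
    refine ⟨fun j hj => ?_, hdiff⟩
    rcases hj.eq_or_lt with rfl | hj
    · have := hAC.continuousOn
      rwa [uIcc_of_le hab.le] at this
    · exact (hdiff j hj).continuousOn
  · exact hf.ae_eq (iteratedDerivWithin_taylorSynth_top hab c hI).symm

/-! ### Regularity and Taylor expansion of a given Sobolev function. -/

lemma SobolevMem.memLp_top {g : ℝ → ℝ} (hg : SobolevMem a b k g) :
    MemLp (iteratedDerivWithin k g (Icc a b)) 2 (volume.restrict (Icc a b)) := by
  cases k with
  | zero => simpa [SobolevMem] using hg
  | succ k => exact hg.2.2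

lemma SobolevMem.continuousOn (hab : a < b) {g : ℝ → ℝ} (hg : SobolevMem a b k g) {j : ℕ}
    (hj : j < k) :
    ContinuousOn (iteratedDerivWithin j g (Icc a b)) (Icc a b) := by
  obtain _ | k := k
  · omega
  · exact hg.1.continuousOn_iteratedDerivWithin (by exact_mod_cast Nat.lt_succ_iff.1 hj)
      (uniqueDiffOn_Icc hab)

/-- Taylor's formula with integral remainder for all derivatives of a function in `W_k`. -/
lemma SobolevMem.eqOn_taylorSynth (hab : a < b) {g : ℝ → ℝ} (hg : SobolevMem a b k g) {j : ℕ}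
    (hj : j < k) :
    EqOn (iteratedDerivWithin j g (Icc a b))
      (taylorSynth a (fun l : Fin k => iteratedDerivWithin l g (Icc a b) a)
        (iteratedDerivWithin k g (Icc a b)) j) (Icc a b) := by
  obtain _ | k := k
  · omega
  obtain ⟨hC, hAC, hL⟩ := id hg
  have hI := intervalIntegrable_of_memLp_two hab.le hL
  -- Downward induction on the order of the derivative: the highest absolutely continuous derivative
  -- is expanded first, and each lower one is integrated from the next.
  obtain ⟨i, rfl⟩ : ∃ i, j = k - i := ⟨k - j, by omega⟩
  clear hj
  induction i with
  | zero =>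
    intro s hs
    rw [Nat.sub_zero, taylorSynth_last]
    -- Start of the induction: the fundamental theorem of calculus for absolutely continuous
    -- functions.
    have hACs := hAC.mono (c := a) (d := s) (by
      rw [uIcc_of_le hs.1, uIcc_of_le hab.le]; exact Icc_subset_Icc_right hs.2)
    have h1 := hACs.integral_deriv_eq_sub
    have h2 : ∫ θ in a..s, iteratedDerivWithin (k + 1) g (Icc a b) θ =
        ∫ θ in a..s, deriv (iteratedDerivWithin k g (Icc a b)) θ := by
      refine intervalIntegral.integral_congr_uIoo fun θ hθ => ?_
      rw [uIoo_of_le hs.1] at hθ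
      rw [iteratedDerivWithin_succ, derivWithin_of_mem_nhds]
      exact Icc_mem_nhds hθ.1 (hθ.2.trans_le hs.2)
    rw [h2, h1]
    simp
  | succ i ih =>
    -- Subtraction is truncated, so past `i = k` the order stays at zero and there is nothing new to
    -- prove.
    by_cases hi : k ≤ i
    · rwa [show k - (i + 1) = k - i by omega]
    set j := k - (i + 1) with hjdef
    rw [show k - i = j + 1 by omega] at ih
    have hjk : j < k := by omega
    intro s hs
    -- By the induction hypothesis both sides have the same derivative, so their difference is
    -- constant; it vanishes at `a` by `taylorSynth_left`.
    have hcl := constant_of_has_deriv_right_zero (f := fun s =>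
      iteratedDerivWithin j g (Icc a b) s -
      taylorSynth a (fun l : Fin (k + 1) => iteratedDerivWithin l g (Icc a b) a)
        (iteratedDerivWithin (k + 1) g (Icc a b)) j s) (a := a) (b := b) ?_ ?_ s hs
    · have hl := taylorSynth_left (a := a)
        (fun l : Fin (k + 1) => iteratedDerivWithin l g (Icc a b) a)
        (iteratedDerivWithin (k + 1) g (Icc a b)) ⟨j, by omega⟩
      simp only at hl hcl
      rw [hl, sub_self] at hcl
      exact sub_eq_zero.1 hcl
    · refine (hg.continuousOn hab (by omega)).sub fun x hx => ?_
      exact (hasDerivWithinAt_taylorSynth hab.le _ hI (by omega) hx).continuousWithinAt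
    · intro x hx
      have hx' := Ico_subset_Icc_self hx
      have hd : HasDerivWithinAt (iteratedDerivWithin j g (Icc a b))
          (iteratedDerivWithin (j + 1) g (Icc a b) x) (Icc a b) x := by
        rw [iteratedDerivWithin_succ]
        exact (hC.differentiableOn_iteratedDerivWithin (by exact_mod_cast hjk)
          (uniqueDiffOn_Icc hab) x hx').hasDerivWithinAt
      have h := hd.sub (hasDerivWithinAt_taylorSynth hab.le
        (fun l : Fin (k + 1) => iteratedDerivWithin l g (Icc a b) a) hI
        (show j + 1 < k + 1 by omega) hx')
      rw [ih hx', sub_self] at h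
      exact h.mono_of_mem_nhdsWithin (Icc_mem_nhdsGE_of_mem hx)

end Taylor

/-! ## Entrywise integrals of vectors and matrices -/

section EntrywiseIntegrals

variable {a b : ℝ} {m n p q k l : Type}

/-- Entrywise interval integrability of a vector-valued function. -/
def VecIntegrable (a b : ℝ) (f : ℝ → m → ℝ) : Prop :=
  ∀ i, IntervalIntegrable (fun s => f s i) volume a b

/-- Entrywise interval integrability of a matrix-valued function. -/
def MatIntegrable (a b : ℝ) (M : ℝ → Matrix m n ℝ) : Prop :=
  ∀ i j, IntervalIntegrable (fun s => M s i j) volume a b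

/-- Entrywise square integrability of a matrix-valued function. -/
def MatL2 (a b : ℝ) (M : ℝ → Matrix m n ℝ) : Prop :=
  ∀ i j, MemLp (fun s => M s i j) 2 (volume.restrict (Icc a b))

/-- Entrywise continuity of a matrix-valued function. -/
def MatContinuous (M : ℝ → Matrix m n ℝ) : Prop :=
  ∀ i j, Continuous fun s => M s i j

/-- Agreement is asked only on the open intervals, so the value of a split kernel on the diagonal
never matters. -/
lemma integral_glue {F g h : ℝ → ℝ} {s : ℝ} (hs : s ∈ Icc a b)
    (hg : IntervalIntegrable g volume a s) (hh : IntervalIntegrable h volume s b)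
    (eg : EqOn g F (Ioo a s)) (eh : EqOn h F (Ioo s b)) :
    IntervalIntegrable F volume a b ∧
      ∫ θ in a..b, F θ = (∫ θ in a..s, g θ) + ∫ θ in s..b, h θ := by
  rw [← uIoo_of_le hs.1] at eg
  rw [← uIoo_of_le hs.2] at eh
  have h1 := hg.congr_uIoo eg
  have h2 := hh.congr_uIoo eh
  refine ⟨h1.trans h2, ?_⟩
  rw [← intervalIntegral.integral_add_adjacent_intervals h1 h2,
    intervalIntegral.integral_congr_uIoo eg, intervalIntegral.integral_congr_uIoo eh]

lemma vecInt_glue {F g h : ℝ → m → ℝ} {s : ℝ} (hs : s ∈ Icc a b)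
    (hg : VecIntegrable a s g) (hh : VecIntegrable s b h)
    (eg : EqOn g F (Ioo a s)) (eh : EqOn h F (Ioo s b)) :
    VecIntegrable a b F ∧ vecInt a b F = vecInt a s g + vecInt s b h := by
  have H := fun i => integral_glue (F := fun θ => F θ i) hs (hg i) (hh i)
    (fun θ hθ => congrFun (eg hθ) i) (fun θ hθ => congrFun (eh hθ) i)
  exact ⟨fun i => (H i).1, funext fun i => (H i).2⟩

lemma matInt_glue {F g h : ℝ → Matrix m n ℝ} {s : ℝ} (hs : s ∈ Icc a b)
    (hg : MatIntegrable a s g) (hh : MatIntegrable s b h)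
    (eg : EqOn g F (Ioo a s)) (eh : EqOn h F (Ioo s b)) :
    MatIntegrable a b F ∧ matInt a b F = matInt a s g + matInt s b h := by
  have H := fun i j => integral_glue (F := fun θ => F θ i j) hs (hg i j) (hh i j)
    (fun θ hθ => congrFun (congrFun (eg hθ) i) j) (fun θ hθ => congrFun (congrFun (eh hθ) i) j)
  exact ⟨fun i j => (H i j).1, by ext i j; exact (H i j).2⟩

lemma VecIntegrable.mono_right {f : ℝ → m → ℝ} (hf : VecIntegrable a b f) {s : ℝ}
    (hs : s ∈ Icc a b) : VecIntegrable a s f :=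
  fun i => intervalIntegrable_mono_right (hf i) hs

lemma VecIntegrable.mono_left {f : ℝ → m → ℝ} (hf : VecIntegrable a b f) {s : ℝ}
    (hs : s ∈ Icc a b) : VecIntegrable s b f :=
  fun i => intervalIntegrable_mono_left (hf i) hs

lemma MatIntegrable.mono_right {f : ℝ → Matrix m n ℝ} (hf : MatIntegrable a b f) {s : ℝ}
    (hs : s ∈ Icc a b) : MatIntegrable a s f :=
  fun i j => intervalIntegrable_mono_right (hf i j) hs

lemma MatIntegrable.mono_left {f : ℝ → Matrix m n ℝ} (hf : MatIntegrable a b f) {s : ℝ}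
    (hs : s ∈ Icc a b) : MatIntegrable s b f :=
  fun i j => intervalIntegrable_mono_left (hf i j) hs

lemma vecInt_add_vecInt {f : ℝ → m → ℝ} (hf : VecIntegrable a b f) {s : ℝ}
    (hs : s ∈ Icc a b) : vecInt a s f + vecInt s b f = vecInt a b f :=
  (vecInt_glue hs (hf.mono_right hs) (hf.mono_left hs) (eqOn_refl _ _) (eqOn_refl _ _)).2.symm

lemma VecIntegrable.add {f g : ℝ → m → ℝ} (hf : VecIntegrable a b f) (hg : VecIntegrable a b g) :
    VecIntegrable a b (fun s => f s + g s) := fun i => (hf i).add (hg i)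

lemma vecInt_add {f g : ℝ → m → ℝ} (hf : VecIntegrable a b f) (hg : VecIntegrable a b g) :
    vecInt a b (fun s => f s + g s) = vecInt a b f + vecInt a b g :=
  funext fun i => intervalIntegral.integral_add (hf i) (hg i)

lemma vecInt_sub {f g : ℝ → m → ℝ} (hf : VecIntegrable a b f) (hg : VecIntegrable a b g) :
    vecInt a b (fun s => f s - g s) = vecInt a b f - vecInt a b g :=
  funext fun i => intervalIntegral.integral_sub (hf i) (hg i)

lemma vecInt_zero : vecInt a b (fun _ => (0 : m → ℝ)) = 0 := by
  ext i; simp [vecInt]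

lemma vecInt_congr_Ioo (hab : a ≤ b) {f g : ℝ → m → ℝ} (h : EqOn f g (Ioo a b)) :
    vecInt a b f = vecInt a b g := by
  ext i
  refine intervalIntegral.integral_congr_uIoo fun θ hθ => ?_
  rw [uIoo_of_le hab] at hθ
  exact congrFun (h hθ) i

lemma vecInt_congr_ae (hab : a ≤ b) {f g : ℝ → m → ℝ}
    (h : f =ᵐ[volume.restrict (Icc a b)] g) : vecInt a b f = vecInt a b g := by
  ext i
  refine intervalIntegral.integral_congr_ae_restrict ?_
  rw [uIoc_of_le hab, restrict_Ioc_eq_restrict_Icc]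
  filter_upwards [h] with s hs
  rw [hs]

lemma VecIntegrable.mulVec [Fintype n] (M : Matrix m n ℝ) {f : ℝ → n → ℝ}
    (hf : VecIntegrable a b f) : VecIntegrable a b (fun s => M *ᵥ f s) := by
  intro i
  simp only [Matrix.mulVec, dotProduct]
  have := IntervalIntegrable.sum (μ := volume) (a := a) (b := b) Finset.univ
    (f := fun j s => M i j * f s j) fun j _ => (hf j).const_mul (M i j)
  simpa [Finset.sum_fn] using this

lemma mulVec_vecInt [Fintype n] (M : Matrix m n ℝ) {f : ℝ → n → ℝ}
    (hf : VecIntegrable a b f) :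
    M *ᵥ vecInt a b f = vecInt a b (fun s => M *ᵥ f s) := by
  ext i
  simp only [mulVec, dotProduct, vecInt]
  rw [intervalIntegral.integral_finsetSum fun j _ => (hf j).const_mul (M i j)]
  simp

lemma MatIntegrable.mulVec_const [Fintype n] {M : ℝ → Matrix m n ℝ} (hM : MatIntegrable a b M)
    (c : n → ℝ) : VecIntegrable a b (fun s => M s *ᵥ c) := by
  intro i
  simp only [mulVec, dotProduct]
  have := IntervalIntegrable.sum (μ := volume) (a := a) (b := b) Finset.univ
    (f := fun j s => M s i j * c j) fun j _ => (hM i j).mul_const (c j)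
  simpa [Finset.sum_fn] using this

lemma matInt_mulVec [Fintype n] {M : ℝ → Matrix m n ℝ} (hM : MatIntegrable a b M) (c : n → ℝ) :
    matInt a b M *ᵥ c = vecInt a b (fun s => M s *ᵥ c) := by
  ext i
  simp only [mulVec, dotProduct, vecInt, matInt, of_apply]
  rw [intervalIntegral.integral_finsetSum fun j _ => (hM i j).mul_const (c j)]
  simp

lemma MatIntegrable.mul_continuous [Fintype n] {M : ℝ → Matrix m n ℝ} (hM : MatIntegrable a b M)
    {A : ℝ → Matrix n p ℝ} (hA : MatContinuous A) :
    MatIntegrable a b (fun s => M s * A s) := by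
  intro i j
  simp only [mul_apply]
  have := IntervalIntegrable.sum (μ := volume) (a := a) (b := b) Finset.univ
    (f := fun r s => M s i r * A s r j) fun r _ => (hM i r).mul_continuousOn (hA r j).continuousOn
  simpa [Finset.sum_fn] using this

/-! ### Calculus of continuous and of square integrable matrix functions. -/

lemma MatContinuous.const (M : Matrix m n ℝ) : MatContinuous fun _ => M :=
  fun _ _ => continuous_const

lemma MatContinuous.mul [Fintype n] {A : ℝ → Matrix m n ℝ} {B : ℝ → Matrix n p ℝ}
    (hA : MatContinuous A) (hB : MatContinuous B) : MatContinuous fun s => A s * B s := by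
  intro i j
  simp only [mul_apply]
  exact continuous_finsetSum _ fun r _ => (hA i r).mul (hB r j)

lemma MatContinuous.add {A B : ℝ → Matrix m n ℝ}
    (hA : MatContinuous A) (hB : MatContinuous B) : MatContinuous fun s => A s + B s :=
  fun i j => (hA i j).add (hB i j)

lemma MatContinuous.comp {A : ℝ → Matrix m n ℝ} (hA : MatContinuous A) {g : ℝ → ℝ}
    (hg : Continuous g) : MatContinuous fun s => A (g s) :=
  fun i j => (hA i j).comp hg

lemma memLp_restrict_Icc_of_continuous {g : ℝ → ℝ} (hg : Continuous g) (r : ℝ≥0∞) :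
    MemLp g r (volume.restrict (Icc a b)) := by
  obtain ⟨C, hC⟩ := isCompact_Icc.exists_bound_of_continuousOn (hg.continuousOn (s := Icc a b))
  refine MemLp.of_bound hg.aestronglyMeasurable C ?_
  filter_upwards [ae_restrict_mem measurableSet_Icc] with s hs using hC s hs

lemma MatContinuous.matL2 {A : ℝ → Matrix m n ℝ} (hA : MatContinuous A) : MatL2 a b A :=
  fun i j => memLp_restrict_Icc_of_continuous (hA i j) 2

lemma MatL2.matIntegrable (hab : a ≤ b) {M : ℝ → Matrix m n ℝ} (hM : MatL2 a b M) :
    MatIntegrable a b M := fun i j => intervalIntegrable_of_memLp_two hab (hM i j)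

lemma MatL2.add {M M' : ℝ → Matrix m n ℝ} (hM : MatL2 a b M) (hM' : MatL2 a b M') :
    MatL2 a b fun s => M s + M' s := fun i j => (hM i j).add (hM' i j)

lemma MatL2.sub {M M' : ℝ → Matrix m n ℝ} (hM : MatL2 a b M) (hM' : MatL2 a b M') :
    MatL2 a b fun s => M s - M' s := fun i j => (hM i j).sub (hM' i j)

lemma MatL2.const_mul [Fintype n] (A : Matrix m n ℝ) {M : ℝ → Matrix n p ℝ} (hM : MatL2 a b M) :
    MatL2 a b fun s => A * M s := by
  intro i j
  simp only [mul_apply]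
  exact memLp_finsetSum _ fun r _ => (hM r j).const_mul (A i r)

lemma MatL2.mul_const [Fintype n] {M : ℝ → Matrix m n ℝ} (hM : MatL2 a b M) (A : Matrix n p ℝ) :
    MatL2 a b fun s => M s * A := by
  intro i j
  simp only [mul_apply]
  exact memLp_finsetSum _ fun r _ => (hM i r).mul_const (A r j)

lemma MatL2.fromRows {M : ℝ → Matrix m q ℝ} {M' : ℝ → Matrix n q ℝ} (hM : MatL2 a b M)
    (hM' : MatL2 a b M') : MatL2 a b fun s => Matrix.fromRows (M s) (M' s) := by
  rintro (i | i) j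
  · exact hM i j
  · exact hM' i j

lemma MatL2.integrable_mul {M : ℝ → Matrix m n ℝ} (hM : MatL2 a b M)
    {f : ℝ → p → ℝ} [Fintype p] (hf : L2Mem a b f) (i : m) (j : n) (r : p) :
    Integrable (fun s => M s i j * f s r) (volume.restrict (Icc a b)) :=
  (hM i j).integrable_mul (memLp_pi_iff.1 hf r)

lemma MatL2.mulVec (hab : a ≤ b) [Fintype n] {M : ℝ → Matrix m n ℝ} (hM : MatL2 a b M)
    {f : ℝ → n → ℝ} (hf : L2Mem a b f) : VecIntegrable a b (fun s => M s *ᵥ f s) := by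
  intro i
  rw [intervalIntegrable_iff_integrableOn_Icc_of_le hab]
  simp only [Matrix.mulVec, dotProduct]
  exact integrable_finsetSum _ fun j _ => hM.integrable_mul hf i j j

lemma L2Mem.vecIntegrable (hab : a ≤ b) [Fintype m] {f : ℝ → m → ℝ} (hf : L2Mem a b f) :
    VecIntegrable a b f := fun i => intervalIntegrable_of_memLp_two hab (memLp_pi_iff.1 hf i)

/-- Fubini's theorem for the composition of a matrix multiplier and an integral operator. -/
lemma vecInt_mulVec_vecInt (hab : a ≤ b) [Fintype l] [Fintype q]
    {ρ : ℝ → Matrix m l ℝ} {K : ℝ → ℝ → Matrix l q ℝ} {f : ℝ → q → ℝ}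
    (H : ∀ i r j, Integrable (fun z : ℝ × ℝ => ρ z.1 i r * (K z.1 z.2 r j * f z.2 j))
      ((volume.restrict (Icc a b)).prod (volume.restrict (Icc a b)))) :
    VecIntegrable a b (fun θ => ρ θ *ᵥ vecInt a b (fun η => K θ η *ᵥ f η)) ∧
    VecIntegrable a b (fun η => matInt a b (fun θ => ρ θ * K θ η) *ᵥ f η) ∧
    vecInt a b (fun θ => ρ θ *ᵥ vecInt a b (fun η => K θ η *ᵥ f η)) =
      vecInt a b (fun η => matInt a b (fun θ => ρ θ * K θ η) *ᵥ f η) := by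
  set μ := volume.restrict (Icc a b) with hμ
  have hI : ∀ g : ℝ → ℝ, ∫ s in a..b, g s = ∫ s, g s ∂μ := fun g => by
    rw [intervalIntegral.integral_of_le hab, hμ, integral_Icc_eq_integral_Ioc]
  have hint : ∀ g : ℝ → ℝ, IntervalIntegrable g volume a b ↔ Integrable g μ := fun g =>
    intervalIntegrable_iff_integrableOn_Icc_of_le hab
  have Hsum : ∀ i, Integrable (fun z : ℝ × ℝ => ∑ r, ∑ j, ρ z.1 i r * (K z.1 z.2 r j * f z.2 j))
      (μ.prod μ) := fun i =>
    integrable_finsetSum _ fun r _ => integrable_finsetSum _ fun j _ => H i r j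
  -- Integrability on the square gives integrable slices only almost everywhere, so finite sums and
  -- inner integrals may be exchanged only for almost every `θ`, respectively `η`.
  have Hr : ∀ i, ∀ᵐ θ ∂μ, ∀ r, ∀ j, Integrable (fun η => ρ θ i r * (K θ η r j * f η j)) μ :=
    fun i => ae_all_iff.2 fun r => ae_all_iff.2 fun j => (H i r j).prod_right_ae
  have Hl : ∀ i, ∀ᵐ η ∂μ, ∀ r, ∀ j, Integrable (fun θ => ρ θ i r * (K θ η r j * f η j)) μ :=
    fun i => ae_all_iff.2 fun r => ae_all_iff.2 fun j => (H i r j).prod_left_ae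
  have e1 : ∀ i, (fun θ => (ρ θ *ᵥ vecInt a b (fun η => K θ η *ᵥ f η)) i) =ᵐ[μ]
      fun θ => ∫ η, ∑ r, ∑ j, ρ θ i r * (K θ η r j * f η j) ∂μ := by
    intro i
    filter_upwards [Hr i] with θ hθ
    rw [integral_finsetSum _ fun r _ => integrable_finsetSum _ fun j _ => hθ r j]
    simp only [Matrix.mulVec, dotProduct, vecInt, hI, ← Finset.mul_sum, integral_const_mul]
  have e2 : ∀ i, (fun η => (matInt a b (fun θ => ρ θ * K θ η) *ᵥ f η) i) =ᵐ[μ]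
      fun η => ∫ θ, ∑ r, ∑ j, ρ θ i r * (K θ η r j * f η j) ∂μ := by
    intro i
    filter_upwards [Hl i] with η hη
    simp_rw [Finset.sum_comm (s := (Finset.univ : Finset l))]
    rw [integral_finsetSum _ fun j _ => integrable_finsetSum _ fun r _ => hη r j]
    simp only [Matrix.mulVec, dotProduct, matInt, hI, of_apply, mul_apply, ← mul_assoc,
      ← Finset.sum_mul, integral_mul_const]
  refine ⟨fun i => ?_, fun i => ?_, funext fun i => ?_⟩
  · rw [hint]
    exact (Hsum i).integral_prod_left.congr (e1 i).symm
  · rw [hint]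
    exact (Hsum i).integral_prod_right.congr (e2 i).symm
  · unfold vecInt at e1 ⊢
    rw [hI, hI, integral_congr_ae (e1 i), integral_congr_ae (e2 i)]
    exact integral_integral_swap (Hsum i)

end EntrywiseIntegrals

/-! ## Composition of 4-PI operators -/

section Composition

variable {a b : ℝ} {m n p q k l : Type}

/-- Kernels `R(θ, η)`, continuous in `θ`, for which `R(θ, η) f(η)` can be integrated against any
integrable function of `θ`. -/
structure VolterraKernel (a b : ℝ) (R : ℝ → ℝ → Matrix l q ℝ) (f : ℝ → q → ℝ) : Prop where
  cont : ∀ η, MatContinuous fun θ => R θ η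
  slice : ∀ θ i j, IntervalIntegrable (fun η => R θ η i j * f η j) volume a b
  prod : ∀ ρ : ℝ → ℝ, Integrable ρ (volume.restrict (Icc a b)) → ∀ i j,
    Integrable (fun z : ℝ × ℝ => ρ z.1 * (R z.1 z.2 i j * f z.2 j))
      ((volume.restrict (Icc a b)).prod (volume.restrict (Icc a b)))

/-- A continuous factor is bounded on the compact square, and the product of integrable functions of
separate variables is integrable there. -/
lemma integrable_mul_continuous_mul {ρ ψ : ℝ → ℝ} {G : ℝ × ℝ → ℝ} (hG : Continuous G)
    (hρ : Integrable ρ (volume.restrict (Icc a b)))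
    (hψ : Integrable ψ (volume.restrict (Icc a b))) :
    Integrable (fun z : ℝ × ℝ => ρ z.1 * (G z * ψ z.2))
      ((volume.restrict (Icc a b)).prod (volume.restrict (Icc a b))) := by
  obtain ⟨C, hC⟩ := (isCompact_Icc.prod isCompact_Icc).exists_bound_of_continuousOn
    (hG.continuousOn (s := Icc a b ×ˢ Icc a b))
  have h := (hρ.mul_prod hψ).bdd_mul (c := C) (f := G) hG.aestronglyMeasurable ?_
  · refine h.congr (ae_of_all _ fun z => ?_)
    simp only
    ring
  · rw [Measure.prod_restrict]
    filter_upwards [ae_restrict_mem (measurableSet_Icc.prod measurableSet_Icc)] with z hz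
    exact hC z hz

lemma VolterraKernel.zero (f : ℝ → q → ℝ) :
    VolterraKernel a b (0 : ℝ → ℝ → Matrix l q ℝ) f where
  cont _ _ _ := continuous_const
  slice _ _ _ := by simp
  prod _ _ _ _ := by simp

lemma VolterraKernel.add {R R' : ℝ → ℝ → Matrix l q ℝ} {f : ℝ → q → ℝ}
    (h : VolterraKernel a b R f) (h' : VolterraKernel a b R' f) :
    VolterraKernel a b (fun θ η => R θ η + R' θ η) f where
  cont η := (h.cont η).add (h'.cont η)
  slice θ i j := by
    simp only [Matrix.add_apply, add_mul]
    exact (h.slice θ i j).add (h'.slice θ i j)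
  prod ρ hρ i j := by
    simp only [Matrix.add_apply, add_mul, mul_add]
    exact (h.prod ρ hρ i j).add (h'.prod ρ hρ i j)

lemma VolterraKernel.of_sub [Fintype q] (hab : a ≤ b) {C : ℝ → Matrix l q ℝ}
    (hC : MatContinuous C) {f : ℝ → q → ℝ} (hf : L2Mem a b f) :
    VolterraKernel a b (fun θ η => C (θ - η)) f where
  cont η := hC.comp (by fun_prop)
  slice θ i j := (hf.vecIntegrable hab j).continuousOn_mul
    ((hC i j).comp (by fun_prop)).continuousOn
  prod ρ hρ i j := integrable_mul_continuous_mul (G := fun z => C (z.1 - z.2) i j)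
    ((hC i j).comp (by fun_prop)) hρ ((memLp_pi_iff.1 hf j).integrable (by norm_num))

lemma VolterraKernel.of_mul [Fintype n] [Fintype q] (hab : a ≤ b) {A : ℝ → Matrix l n ℝ}
    (hA : MatContinuous A) {Ψ : ℝ → Matrix n q ℝ} (hΨ : MatL2 a b Ψ) {f : ℝ → q → ℝ}
    (hf : L2Mem a b f) : VolterraKernel a b (fun θ η => A θ * Ψ η) f where
  cont η := hA.mul (.const (Ψ η))
  slice θ i j := by
    rw [intervalIntegrable_iff_integrableOn_Icc_of_le hab]
    simp only [mul_apply, Finset.sum_mul, mul_assoc]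
    exact integrable_finsetSum _ fun r _ => (hΨ.integrable_mul hf r j j).const_mul (A θ i r)
  prod ρ hρ i j := by
    simp only [mul_apply, Finset.sum_mul, mul_assoc, Finset.mul_sum]
    exact integrable_finsetSum _ fun r _ => integrable_mul_continuous_mul
      (G := fun z => A z.1 i r) ((hA i r).comp continuous_fst) hρ (hΨ.integrable_mul hf r j j)

/-- The kernel which is `R₁` below the diagonal and `R₂` above it. -/
def splitKernel (R1 R2 : ℝ → ℝ → Matrix l q ℝ) (θ η : ℝ) : Matrix l q ℝ :=
  if η < θ then R1 θ η else R2 θ η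

lemma VolterraKernel.vecIntegrable [Fintype q] {R : ℝ → ℝ → Matrix l q ℝ} {f : ℝ → q → ℝ}
    (h : VolterraKernel a b R f) (θ : ℝ) : VecIntegrable a b (fun η => R θ η *ᵥ f η) := by
  intro i
  simp only [mulVec, dotProduct]
  have := IntervalIntegrable.sum (μ := volume) (a := a) (b := b) Finset.univ
    (f := fun j η => R θ η i j * f η j) fun j _ => h.slice θ i j
  simpa [Finset.sum_fn] using this

lemma vecInt_splitKernel [Fintype q] {R1 R2 : ℝ → ℝ → Matrix l q ℝ} {f : ℝ → q → ℝ}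
    {θ : ℝ} (hθ : θ ∈ Icc a b)
    (h1 : VecIntegrable a b (fun η => R1 θ η *ᵥ f η))
    (h2 : VecIntegrable a b (fun η => R2 θ η *ᵥ f η)) :
    VecIntegrable a b (fun η => splitKernel R1 R2 θ η *ᵥ f η) ∧
    vecInt a b (fun η => splitKernel R1 R2 θ η *ᵥ f η) =
      vecInt a θ (fun η => R1 θ η *ᵥ f η) + vecInt θ b (fun η => R2 θ η *ᵥ f η) := by
  refine vecInt_glue hθ (h1.mono_right hθ) (h2.mono_left hθ) ?_ ?_
  · intro η hη
    simp [splitKernel, hη.2]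
  · intro η hη
    simp [splitKernel, not_lt.2 hη.1.le]

/-- The split kernel is pieced together along a measurable half-plane, so it inherits integrability
from its two branches although it may jump across the diagonal. -/
lemma VolterraKernel.prod_splitKernel {R1 R2 : ℝ → ℝ → Matrix l q ℝ} {f : ℝ → q → ℝ}
    (h1 : VolterraKernel a b R1 f) (h2 : VolterraKernel a b R2 f) {ρ : ℝ → ℝ}
    (hρ : Integrable ρ (volume.restrict (Icc a b))) (i : l) (j : q) :
    Integrable (fun z : ℝ × ℝ => ρ z.1 * (splitKernel R1 R2 z.1 z.2 i j * f z.2 j))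
      ((volume.restrict (Icc a b)).prod (volume.restrict (Icc a b))) := by
  classical
  have hs : MeasurableSet {z : ℝ × ℝ | z.2 < z.1} :=
    measurableSet_lt measurable_snd measurable_fst
  have h := Integrable.piecewise hs (h1.prod ρ hρ i j).integrableOn (h2.prod ρ hρ i j).integrableOn
  convert! h using 2 with z
  by_cases hz : z.2 < z.1 <;> simp [splitKernel, Set.piecewise, hz]

/-- A matrix multiplier composed with the second component of a 4-PI operator, integrated. -/
lemma vecInt_mulVec_apply (hab : a ≤ b) [Fintype n] [Fintype l] [Fintype q]
    {ρ : ℝ → Matrix m l ℝ} (hρ : MatL2 a b ρ) {Q2 : ℝ → Matrix l n ℝ} (hQ2 : MatContinuous Q2)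
    (M : Matrix l q ℝ) {R1 R2 : ℝ → ℝ → Matrix l q ℝ} {f : ℝ → q → ℝ} (hf : L2Mem a b f)
    (h1 : VolterraKernel a b R1 f) (h2 : VolterraKernel a b R2 f) (c : n → ℝ)
    {g : ℝ → l → ℝ} (hg : ∀ θ ∈ Icc a b, g θ = Q2 θ *ᵥ c + M *ᵥ f θ
      + vecInt a θ (fun η => R1 θ η *ᵥ f η) + vecInt θ b (fun η => R2 θ η *ᵥ f η)) :
    VecIntegrable a b (fun θ => ρ θ *ᵥ g θ) ∧
    VecIntegrable a b (fun θ => (ρ θ * M) *ᵥ f θ) ∧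
    VecIntegrable a b
      (fun η => matInt a b (fun θ => ρ θ * splitKernel R1 R2 θ η) *ᵥ f η) ∧
    vecInt a b (fun θ => ρ θ *ᵥ g θ) = matInt a b (fun θ => ρ θ * Q2 θ) *ᵥ c
      + vecInt a b (fun θ => (ρ θ * M) *ᵥ f θ)
      + vecInt a b (fun η => matInt a b (fun θ => ρ θ * splitKernel R1 R2 θ η) *ᵥ f η) := by
  -- The two Volterra integrals are read as one integral over `[a,b]` with the split kernel, so one
  -- application of Fubini covers both triangles.
  obtain ⟨i3, i4, e⟩ := vecInt_mulVec_vecInt hab (ρ := ρ) (K := splitKernel R1 R2) (f := f)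
    fun i r j => h1.prod_splitKernel h2 ((hρ i r).integrable (by norm_num)) r j
  have iM := (hρ.matIntegrable hab).mul_continuous hQ2
  have i1 := iM.mulVec_const c
  have i2 : VecIntegrable a b (fun θ => (ρ θ * M) *ᵥ f θ) := (hρ.mul_const M).mulVec hab hf
  have eg : EqOn (fun θ => ((ρ θ * Q2 θ) *ᵥ c + (ρ θ * M) *ᵥ f θ) +
      ρ θ *ᵥ vecInt a b (fun η => splitKernel R1 R2 θ η *ᵥ f η))
      (fun θ => ρ θ *ᵥ g θ) (Icc a b) := fun θ hθ => by
    simp only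
    rw [hg θ hθ, (vecInt_splitKernel hθ (h1.vecIntegrable θ) (h2.vecIntegrable θ)).2,
      add_assoc (Q2 θ *ᵥ c + M *ᵥ f θ), mulVec_add _ (Q2 θ *ᵥ c + _), mulVec_add _ (Q2 θ *ᵥ c),
      mulVec_mulVec, mulVec_mulVec]
  refine ⟨fun i => (((i1.add i2).add i3) i).congr_uIoo fun θ hθ => ?_, i2, i4, ?_⟩
  · rw [uIoo_of_le hab] at hθ
    exact congrFun (eg (Ioo_subset_Icc_self hθ)) i
  · rw [← vecInt_congr_Ioo hab (eg.mono Ioo_subset_Icc_self), vecInt_add (i1.add i2) i3,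
      vecInt_add i1 i2, matInt_mulVec iM, e]

/-- Here the second argument is held fixed: `θ < η` lies above the diagonal, so `R2` is integrated
over `[a,η]` and `R1` over `[η,b]`, the reverse of `vecInt_splitKernel`. -/
lemma matInt_mul_splitKernel [Fintype l] {ρ : ℝ → Matrix m l ℝ} (hρ : MatIntegrable a b ρ)
    {R1 R2 : ℝ → ℝ → Matrix l q ℝ} {η : ℝ} (h1 : MatContinuous fun θ => R1 θ η)
    (h2 : MatContinuous fun θ => R2 θ η) (hη : η ∈ Icc a b) :
    matInt a b (fun θ => ρ θ * splitKernel R1 R2 θ η) =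
      matInt a η (fun θ => ρ θ * R2 θ η) + matInt η b (fun θ => ρ θ * R1 θ η) := by
  refine (matInt_glue hη ((hρ.mono_right hη).mul_continuous h2)
    ((hρ.mono_left hη).mul_continuous h1) ?_ ?_).2
  · intro θ hθ
    simp [splitKernel, not_lt.2 hθ.2.le]
  · intro θ hθ
    simp [splitKernel, hθ.1]

/-- Regularity of the parameters of a 4-PI operator, at the argument `f`, under which it can be
composed with a multiplier from the left. -/
structure PI4.Regular [Fintype q] (a b : ℝ) (T : PI4 k n l q) (f : ℝ → q → ℝ) : Prop where
  Q1 : MatL2 a b T.Q1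
  Q2 : MatContinuous T.Q2
  R0 : ∀ s, T.R0 s = T.R0 a
  R1 : VolterraKernel a b T.R1 f
  R2 : VolterraKernel a b T.R2 f

lemma PI4.Regular.apply_snd [Fintype n] [Fintype q] {T : PI4 k n l q} {f : ℝ → q → ℝ} (hT : T.Regular a b f)
    (c : n → ℝ) (θ : ℝ) : (T.apply a b (c, f)).2 θ = T.Q2 θ *ᵥ c + T.R0 a *ᵥ f θ
      + vecInt a θ (fun η => T.R1 θ η *ᵥ f η) + vecInt θ b (fun η => T.R2 θ η *ᵥ f η) := by
  simp only [PI4.apply, hT.R0 θ]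

variable [Fintype n] [Fintype q] [Fintype k] [Fintype l]

/-- Fubini gathers everything that multiplies `f η` into the kernel `Q1` of the composite.
Integrability of that kernel against `f` is recorded because it later allows a constant matrix to be
moved under the integral. -/
lemma PI4.comp_apply_fst (hab : a ≤ b) (S : PI4 m k p l) (T : PI4 k n l q) (c : n → ℝ)
    {f : ℝ → q → ℝ} (hf : L2Mem a b f) (hS : MatL2 a b S.Q1) (hT : T.Regular a b f) :
    VecIntegrable a b (fun η => (S.comp a b T).Q1 η *ᵥ f η) ∧
      ((S.comp a b T).apply a b (c, f)).1 = (S.apply a b (T.apply a b (c, f))).1 := by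
  obtain ⟨-, i2, i3, e⟩ := vecInt_mulVec_apply hab hS hT.Q2 (T.R0 a) hf hT.R1 hT.R2 c
    (g := (T.apply a b (c, f)).2) (fun θ _ => hT.apply_snd c θ)
  have i1 := (hT.Q1.const_mul S.P).mulVec hab hf
  have hQ : VecIntegrable a b (fun θ => T.Q1 θ *ᵥ f θ) := hT.Q1.mulVec hab hf
  have eQ : EqOn (fun η => (S.comp a b T).Q1 η *ᵥ f η) (fun η =>
      (S.P * T.Q1 η) *ᵥ f η + (S.Q1 η * T.R0 a) *ᵥ f η +
        matInt a b (fun θ => S.Q1 θ * splitKernel T.R1 T.R2 θ η) *ᵥ f η) (Ioo a b) := by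
    intro η hη
    simp only [PI4.comp]
    rw [matInt_mul_splitKernel (hS.matIntegrable hab) (hT.R1.cont η) (hT.R2.cont η)
      (Ioo_subset_Icc_self hη), hT.R0 η, ← add_mulVec, ← add_mulVec]
    congr 1
    abel
  have e2 := vecInt_congr_Ioo hab eQ
  refine ⟨fun i => (((i1.add i2).add i3) i).congr_uIoo fun θ hθ => ?_, ?_⟩
  · rw [uIoo_of_le hab] at hθ
    exact congrFun (eQ hθ).symm i
  have e3 : ((S.comp a b T).apply a b (c, f)).1 = (S.comp a b T).P *ᵥ c +
    vecInt a b (fun η => (S.comp a b T).Q1 η *ᵥ f η) := rfl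
  have e4 : (S.apply a b (T.apply a b (c, f))).1 =
    S.P *ᵥ (T.P *ᵥ c + vecInt a b (fun θ => T.Q1 θ *ᵥ f θ)) +
      vecInt a b (fun θ => S.Q1 θ *ᵥ (T.apply a b (c, f)).2 θ) := rfl
  rw [e3, e4, e2, vecInt_add (i1.add i2) i3, vecInt_add i1 i2, e, mulVec_add, mulVec_vecInt _ hQ]
  simp only [PI4.comp, add_mulVec, mulVec_mulVec]
  abel

/-- For fixed `s` the two kernels of `S` form one multiplier `ρ` that switches at `θ = s`, and the
computation becomes that of the first component. Only the slices at this `s` need be square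
integrable, which is all that essentially bounded kernels provide, and only for almost every `s`. -/
lemma PI4.comp_apply_snd (hab : a ≤ b) (S : PI4 m k p l) (T : PI4 k n l q) (c : n → ℝ)
    {f : ℝ → q → ℝ} (hf : L2Mem a b f) (hT : T.Regular a b f) {s : ℝ} (hs : s ∈ Icc a b)
    (hS1 : MatL2 a b (S.R1 s)) (hS2 : MatL2 a b (S.R2 s)) :
    ((S.comp a b T).apply a b (c, f)).2 s = (S.apply a b (T.apply a b (c, f))).2 s := by
  set ρ : ℝ → Matrix p l ℝ := fun θ => splitKernel S.R1 S.R2 s θ with hρdef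
  have hρ : MatL2 a b ρ := by
    intro i j
    have h := MemLp.piecewise (s := Iio s) (μ := volume.restrict (Icc a b)) measurableSet_Iio
      ((hS1 i j).restrict _) ((hS2 i j).restrict _)
    convert! h using 2 with θ
    by_cases hθ : θ < s <;> simp [hρdef, splitKernel, Set.piecewise, hθ]
  set g := (T.apply a b (c, f)).2 with hgdef
  have hg := hT.apply_snd (a := a) (b := b) c
  obtain ⟨-, i2, i3, e⟩ := vecInt_mulVec_apply hab hρ hT.Q2 (T.R0 a) hf hT.R1 hT.R2 c
    (g := g) (fun θ _ => hg θ)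
  have iS1 := (vecInt_mulVec_apply hab hS1 hT.Q2 (T.R0 a) hf hT.R1 hT.R2 c
    (g := g) (fun θ _ => hg θ)).1
  have iS2 := (vecInt_mulVec_apply hab hS2 hT.Q2 (T.R0 a) hf hT.R1 hT.R2 c
    (g := g) (fun θ _ => hg θ)).1
  have hQ : VecIntegrable a b (fun θ => T.Q1 θ *ᵥ f θ) := hT.Q1.mulVec hab hf
  obtain ⟨iK, eK⟩ := vecInt_splitKernel hs (hT.R1.vecIntegrable s) (hT.R2.vecIntegrable s)
  have i1 := hQ.mulVec (S.Q2 s)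
  have i4 := iK.mulVec (S.R0 s)
  have esplit : vecInt a b (fun θ => ρ θ *ᵥ g θ) =
      vecInt a s (fun θ => S.R1 s θ *ᵥ g θ) + vecInt s b (fun θ => S.R2 s θ *ᵥ g θ) :=
    (vecInt_splitKernel hs iS1 iS2).2
  have eQ2 : matInt a b (fun θ => ρ θ * T.Q2 θ) =
      matInt a s (fun θ => S.R1 s θ * T.Q2 θ) + matInt s b (fun θ => S.R2 s θ * T.Q2 θ) := by
    refine (matInt_glue hs (((hS1.matIntegrable hab).mono_right hs).mul_continuous hT.Q2)
      (((hS2.matIntegrable hab).mono_left hs).mul_continuous hT.Q2) ?_ ?_).2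
    · intro θ hθ
      simp [hρdef, splitKernel, hθ.2]
    · intro θ hθ
      simp [hρdef, splitKernel, not_lt.2 hθ.1.le]
  -- The full integrand in `η` of the composite at `s`. It remains to recognise it as the
  -- composite's `R1` for `η < s` and `R2` for `η > s`.
  set L : ℝ → p → ℝ := fun η => S.Q2 s *ᵥ (T.Q1 η *ᵥ f η)
    + S.R0 s *ᵥ (splitKernel T.R1 T.R2 s η *ᵥ f η) + (ρ η * T.R0 a) *ᵥ f η
    + matInt a b (fun θ => ρ θ * splitKernel T.R1 T.R2 θ η) *ᵥ f η with hL
  have iL : VecIntegrable a b L := ((i1.add i4).add i2).add i3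
  have eL : vecInt a b L = S.Q2 s *ᵥ vecInt a b (fun θ => T.Q1 θ *ᵥ f θ)
      + S.R0 s *ᵥ vecInt a b (fun η => splitKernel T.R1 T.R2 s η *ᵥ f η)
      + vecInt a b (fun θ => (ρ θ * T.R0 a) *ᵥ f θ)
      + vecInt a b (fun η => matInt a b (fun θ => ρ θ * splitKernel T.R1 T.R2 θ η) *ᵥ f η) := by
    rw [vecInt_add ((i1.add i4).add i2) i3, vecInt_add (i1.add i4) i2, vecInt_add i1 i4,
      mulVec_vecInt _ hQ, mulVec_vecInt _ iK]
  have k1 := hS1.matIntegrable hab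
  have k2 := hS2.matIntegrable hab
  have eR1 : vecInt a s (fun η => (S.comp a b T).R1 s η *ᵥ f η) = vecInt a s L := by
    refine vecInt_congr_Ioo hs.1 fun η hη => ?_
    have hηs : η ∈ Icc a s := Ioo_subset_Icc_self hη
    have hηb : η ∈ Icc a b := ⟨hηs.1, hηs.2.trans hs.2⟩
    have hsb : s ∈ Icc η b := ⟨hηs.2, hs.2⟩
    have c1 := hT.R1.cont η
    have c2 := hT.R2.cont η
    -- The kernel of `T` switches at `θ = η` and `ρ` at `θ = s`. With `η < s` these cut `[a,b]` into
    -- the three intervals appearing in the formula for `R1`.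
    have e1 : matInt a η (fun θ => ρ θ * T.R2 θ η) = matInt a η (fun θ => S.R1 s θ * T.R2 θ η) := by
      ext i j
      refine intervalIntegral.integral_congr_uIoo fun θ hθ => ?_
      rw [uIoo_of_le hηs.1] at hθ
      simp [hρdef, splitKernel, hθ.2.trans hη.2]
    have e2 : matInt η b (fun θ => ρ θ * T.R1 θ η) = matInt η s (fun θ => S.R1 s θ * T.R1 θ η)
        + matInt s b (fun θ => S.R2 s θ * T.R1 θ η) := by
      refine (matInt_glue hsb (((k1.mono_left hηb).mono_right hsb).mul_continuous c1)
        ((k2.mono_left hs).mul_continuous c1) ?_ ?_).2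
      · intro θ hθ
        simp [hρdef, splitKernel, hθ.2]
      · intro θ hθ
        simp [hρdef, splitKernel, not_lt.2 hθ.1.le]
    simp only [hL]
    rw [matInt_mul_splitKernel (hρ.matIntegrable hab) c1 c2 hηb, e1, e2, mulVec_mulVec,
      mulVec_mulVec, ← add_mulVec, ← add_mulVec, ← add_mulVec]
    congr 1
    simp only [PI4.comp, hρdef, splitKernel, if_pos hη.2, hT.R0 η]
    abel
  have eR2 : vecInt s b (fun η => (S.comp a b T).R2 s η *ᵥ f η) = vecInt s b L := by
    refine vecInt_congr_Ioo hs.2 fun η hη => ?_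
    have hηs : η ∈ Icc s b := Ioo_subset_Icc_self hη
    have hηb : η ∈ Icc a b := ⟨hs.1.trans hηs.1, hηs.2⟩
    have hsa : s ∈ Icc a η := ⟨hs.1, hηs.1⟩
    have c1 := hT.R1.cont η
    have c2 := hT.R2.cont η
    -- The mirror case `s < η`: `ρ` already switches inside `[a,η]` and equals the second kernel of
    -- `S` on all of `[η,b]`.
    have e1 : matInt η b (fun θ => ρ θ * T.R1 θ η) = matInt η b (fun θ => S.R2 s θ * T.R1 θ η) := by
      ext i j
      refine intervalIntegral.integral_congr_uIoo fun θ hθ => ?_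
      rw [uIoo_of_le hηb.2] at hθ
      simp [hρdef, splitKernel, not_lt.2 (hη.1.trans hθ.1).le]
    have e2 : matInt a η (fun θ => ρ θ * T.R2 θ η) = matInt a s (fun θ => S.R1 s θ * T.R2 θ η)
        + matInt s η (fun θ => S.R2 s θ * T.R2 θ η) := by
      refine (matInt_glue hsa ((k1.mono_right hs).mul_continuous c2)
        (((k2.mono_right hηb).mono_left hsa).mul_continuous c2) ?_ ?_).2
      · intro θ hθ
        simp [hρdef, splitKernel, hθ.2]
      · intro θ hθ
        simp [hρdef, splitKernel, not_lt.2 hθ.1.le]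
    simp only [hL]
    rw [matInt_mul_splitKernel (hρ.matIntegrable hab) c1 c2 hηb, e1, e2, mulVec_mulVec,
      mulVec_mulVec, ← add_mulVec, ← add_mulVec, ← add_mulVec]
    congr 1
    simp only [PI4.comp, hρdef, splitKernel, if_neg (not_lt.2 hη.1.le), hT.R0 η]
    abel
  have e3 : ((S.comp a b T).apply a b (c, f)).2 s = (S.comp a b T).Q2 s *ᵥ c
    + (S.R0 s * T.R0 s) *ᵥ f s + vecInt a s (fun η => (S.comp a b T).R1 s η *ᵥ f η)
    + vecInt s b (fun η => (S.comp a b T).R2 s η *ᵥ f η) := rfl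
  have e4 : (S.apply a b (T.apply a b (c, f))).2 s =
    S.Q2 s *ᵥ (T.P *ᵥ c + vecInt a b (fun θ => T.Q1 θ *ᵥ f θ)) + S.R0 s *ᵥ g s
      + vecInt a s (fun θ => S.R1 s θ *ᵥ g θ) + vecInt s b (fun θ => S.R2 s θ *ᵥ g θ) := rfl
  have e5 : (S.comp a b T).Q2 s = S.Q2 s * T.P + S.R0 s * T.Q2 s
    + matInt a b (fun θ => ρ θ * T.Q2 θ) := by
    rw [eQ2]; simp only [PI4.comp]; abel
  rw [e3, e4, eR1, eR2, add_assoc _ (vecInt a s L), vecInt_add_vecInt iL hs, eL,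
    add_assoc _ (vecInt a s _) (vecInt s b _), ← esplit, e, e5, show g s = _ from hg s,
    add_assoc _ (vecInt a s _) (vecInt s b _), ← eK, hT.R0 s]
  simp only [mulVec_add, add_mulVec, mulVec_mulVec]
  abel

end Composition

/-! ## The state of a GPDE and its derivatives of maximal order -/

section StateMap

variable {N : ℕ} {n : Fin (N + 1) → ℕ} {nv nBC : ℕ} {a b : ℝ}

/-- The continuous derivatives of the state with boundary values `c` at `a` and derivatives of
maximal order `f`. -/
def contPart (a : ℝ) (c : ContIdx n → ℝ) (f : ℝ → StateIdx n → ℝ) (s : ℝ) : ContIdx n → ℝ :=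
  matT n (s - a) *ᵥ c + vecInt a s (fun θ => matQ n (s - θ) *ᵥ f θ)

/-- The state with boundary values `c` at `a` and derivatives of maximal order `f`. -/
def synthState (a : ℝ) (c : ContIdx n → ℝ) (f : ℝ → StateIdx n → ℝ) (s : ℝ) : StateIdx n → ℝ :=
  matG0 n *ᵥ f s + matT1 n (s - a) *ᵥ c + vecInt a s (fun θ => matQ1 n (s - θ) *ᵥ f θ)

/-- The derivatives of maximal order of a state. -/
def topDer (a b : ℝ) (xh : ℝ → StateIdx n → ℝ) (s : ℝ) : StateIdx n → ℝ :=
  fun α => dComp a b α.1 xh α s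

/-- The block matrices couple only derivatives of one and the same component. This collapses their
sums to that component and leaves scalar Taylor polynomials. -/
lemma sum_contIdx_fiber (α : StateIdx n) (F : ContIdx n → ℝ) :
    ∑ d, (if α = d.1 then F d else 0) = ∑ l, F ⟨α, l⟩ := by
  rw [Fintype.sum_sigma, Finset.sum_eq_single α]
  · simp
  · intro β _ hβ
    simp [Ne.symm hβ]
  · simp

lemma matQ_mulVec (s : ℝ) (g : StateIdx n → ℝ) (d : ContIdx n) :
    (matQ n s *ᵥ g) d = tau ((d.1.1 : ℕ) - d.2 - 1) s * g d.1 := by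
  simp [matQ, mulVec, dotProduct, ite_mul]

lemma matQ1_mulVec (s : ℝ) (g : StateIdx n → ℝ) (α : StateIdx n) :
    (matQ1 n s *ᵥ g) α = if 0 < (α.1 : ℕ) then tau ((α.1 : ℕ) - 1) s * g α else 0 := by
  simp [matQ1, mulVec, dotProduct, ite_mul, ite_and]

lemma matG0_mulVec (g : StateIdx n → ℝ) (α : StateIdx n) :
    (matG0 n *ᵥ g) α = if (α.1 : ℕ) = 0 then g α else 0 := by
  simp only [matG0, mulVec, dotProduct, of_apply, ite_mul, ite_and, one_mul, zero_mul]
  simp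

lemma matT_mulVec (s : ℝ) (c : ContIdx n → ℝ) (d : ContIdx n) :
    (matT n s *ᵥ c) d =
      ∑ l : Fin d.1.1, (if (d.2 : ℕ) ≤ l then tau ((l : ℕ) - d.2) s else 0) * c ⟨d.1, l⟩ := by
  rw [← sum_contIdx_fiber d.1 fun e => (if (d.2 : ℕ) ≤ e.2 then tau ((e.2 : ℕ) - d.2) s else 0) * c e]
  simp only [matT, mulVec, dotProduct, of_apply, ite_and, ite_mul, zero_mul]

lemma matT1_mulVec (s : ℝ) (c : ContIdx n → ℝ) (α : StateIdx n) :
    (matT1 n s *ᵥ c) α = ∑ l : Fin α.1, tau l s * c ⟨α, l⟩ := by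
  rw [← sum_contIdx_fiber α fun e => tau e.2 s * c e]
  simp only [matT1, mulVec, dotProduct, of_apply, ite_mul, zero_mul]

lemma matU1_mulVec (g : StateIdx n → ℝ) (d : DerIdx n) :
    (matU1 n *ᵥ g) d = if (d.2 : ℕ) = d.1.1 then g d.1 else 0 := by
  simp only [matU1, mulVec, dotProduct, of_apply, ite_mul, ite_and, one_mul, zero_mul]
  simp

lemma matU2_mulVec_last (c : ContIdx n → ℝ) (d : DerIdx n) (hd : (d.2 : ℕ) = d.1.1) :
    (matU2 n *ᵥ c) d = 0 := by
  simp only [matU2, mulVec, dotProduct, of_apply, ite_mul, ite_and, one_mul, zero_mul]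
  rw [sum_contIdx_fiber d.1 fun e => if (d.2 : ℕ) = e.2 then c e else 0]
  refine Finset.sum_eq_zero fun l _ => if_neg ?_
  have h : (l : ℕ) < d.1.1 := l.2
  exact fun h' => (h'.symm.trans hd).not_lt h

lemma matU2_mulVec_of_lt (c : ContIdx n → ℝ) (d : DerIdx n) (hd : (d.2 : ℕ) < d.1.1) :
    (matU2 n *ᵥ c) d = c ⟨d.1, ⟨d.2, hd⟩⟩ := by
  simp only [matU2, mulVec, dotProduct, of_apply, ite_mul, ite_and, one_mul, zero_mul]
  rw [sum_contIdx_fiber d.1 fun e => if (d.2 : ℕ) = e.2 then c e else 0,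
    Finset.sum_eq_single ⟨d.2, hd⟩]
  · simp
  · intro l _ hl
    exact if_neg fun h => hl (Fin.ext h.symm)
  · simp

lemma opF_eq (xh : ℝ → StateIdx n → ℝ) (s : ℝ) :
    opF a b xh s = matU1 n *ᵥ topDer a b xh s + matU2 n *ᵥ opC a b xh s := by
  ext d
  rw [Pi.add_apply, matU1_mulVec]
  by_cases hd : (d.2 : ℕ) = d.1.1
  · rw [if_pos hd, matU2_mulVec_last _ _ hd, add_zero]
    simp [opF, topDer, hd]
  · have := d.2.2
    rw [if_neg hd, matU2_mulVec_of_lt _ _ (by omega), zero_add]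
    simp [opF, opC]

lemma contPart_apply (c : ContIdx n → ℝ) (f : ℝ → StateIdx n → ℝ) (s : ℝ) (d : ContIdx n) :
    contPart a c f s d = taylorSynth a (fun l => c ⟨d.1, l⟩) (fun θ => f θ d.1) d.2 s := by
  simp only [contPart, taylorSynth, Pi.add_apply, matT_mulVec, vecInt, matQ_mulVec]

lemma synthState_apply_zero (c : ContIdx n → ℝ) (f : ℝ → StateIdx n → ℝ) (s : ℝ) (α : StateIdx n)
    (hα : (α.1 : ℕ) = 0) : synthState a c f s α = f s α := by
  have : IsEmpty (Fin (α.1 : ℕ)) := by rw [hα]; infer_instance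
  simp [synthState, matG0_mulVec, matT1_mulVec, matQ1_mulVec, vecInt, hα]

lemma synthState_apply_pos (c : ContIdx n → ℝ) (f : ℝ → StateIdx n → ℝ) (s : ℝ) (α : StateIdx n)
    (hα : 0 < (α.1 : ℕ)) :
    synthState a c f s α = taylorSynth a (fun l => c ⟨α, l⟩) (fun θ => f θ α) 0 s := by
  simp [synthState, matG0_mulVec, matT1_mulVec, matQ1_mulVec, vecInt, taylorSynth, hα, hα.ne']

/-- The components of `x̂` are Sobolev functions. -/
def StateSobolev (a b : ℝ) (xh : ℝ → StateIdx n → ℝ) : Prop :=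
  ∀ α : StateIdx n, SobolevMem a b α.1 (fun s => xh s α)

lemma StateSobolev.l2Mem_topDer {xh : ℝ → StateIdx n → ℝ} (h : StateSobolev a b xh) :
    L2Mem a b (topDer a b xh) :=
  memLp_pi_iff.2 fun α => (h α).memLp_top

lemma StateSobolev.l2Mem (hab : a < b) {xh : ℝ → StateIdx n → ℝ} (h : StateSobolev a b xh) :
    L2Mem a b xh := by
  refine memLp_pi_iff.2 fun α => ?_
  rcases Nat.eq_zero_or_pos (α.1 : ℕ) with hα | hα
  · have := h α
    rw [hα] at this
    exact this
  · have hc := (h α).continuousOn hab hα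
    rw [iteratedDerivWithin_zero] at hc
    obtain ⟨C, hC⟩ := isCompact_Icc.exists_bound_of_continuousOn hc
    refine MemLp.of_bound (hc.aestronglyMeasurable measurableSet_Icc) C ?_
    filter_upwards [ae_restrict_mem measurableSet_Icc] with s hs using hC s hs

lemma StateSobolev.opC_eq (hab : a < b) {xh : ℝ → StateIdx n → ℝ} (h : StateSobolev a b xh) :
    EqOn (opC a b xh) (contPart a (opC a b xh a) (topDer a b xh)) (Icc a b) := by
  intro s hs
  ext d
  rw [contPart_apply]
  exact (h d.1).eqOn_taylorSynth hab d.2.2 hs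

lemma StateSobolev.eq_synthState (hab : a < b) {xh : ℝ → StateIdx n → ℝ}
    (h : StateSobolev a b xh) :
    EqOn xh (synthState a (opC a b xh a) (topDer a b xh)) (Icc a b) := by
  intro s hs
  ext α
  rcases Nat.eq_zero_or_pos (α.1 : ℕ) with hα | hα
  · rw [synthState_apply_zero _ _ _ _ hα]
    simp [topDer, dComp, hα]
  · rw [synthState_apply_pos _ _ _ _ hα]
    have := (h α).eqOn_taylorSynth hab hα hs
    rwa [iteratedDerivWithin_zero] at this

lemma stateSobolev_synthState (hab : a < b) (c : ContIdx n → ℝ) {f : ℝ → StateIdx n → ℝ}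
    (hf : L2Mem a b f) : StateSobolev a b (synthState a c f) := by
  intro α
  have hfα := memLp_pi_iff.1 hf α
  rcases Nat.eq_zero_or_pos (α.1 : ℕ) with hα | hα
  · rw [hα]
    simp only [synthState_apply_zero c f _ α hα]
    exact hfα
  · simp only [synthState_apply_pos c f _ α hα]
    -- The order `α.1` occurs in the type of the coefficients. Both are generalised so that the
    -- order can be written as a successor, the form in which the scalar lemma is stated.
    generalize (fun l => c ⟨α, l⟩ : Fin α.1 → ℝ) = c'
    revert c' hα
    generalize (α.1 : ℕ) = k
    intro hk c'
    obtain ⟨k, rfl⟩ : ∃ j, k = j + 1 := ⟨k - 1, by omega⟩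
    exact sobolevMem_taylorSynth hab c' hfα

lemma opC_synthState (hab : a < b) (c : ContIdx n → ℝ) {f : ℝ → StateIdx n → ℝ}
    (hf : L2Mem a b f) : EqOn (opC a b (synthState a c f)) (contPart a c f) (Icc a b) := by
  intro s hs
  ext d
  have hα : 0 < (d.1.1 : ℕ) := d.2.pos
  have hI := hf.vecIntegrable hab.le d.1
  rw [contPart_apply, ← iteratedDerivWithin_taylorSynth hab _ hI d.2.2 hs]
  simp only [opC, dComp, synthState_apply_pos c f _ d.1 hα]

lemma topDer_synthState (hab : a < b) (c : ContIdx n → ℝ) {f : ℝ → StateIdx n → ℝ}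
    (hf : L2Mem a b f) : L2Eq a b (topDer a b (synthState a c f)) f := by
  have h : ∀ α : StateIdx n, (fun s => topDer a b (synthState a c f) s α)
      =ᵐ[volume.restrict (Icc a b)] fun s => f s α := by
    intro α
    have hI := hf.vecIntegrable hab.le α
    unfold topDer dComp
    rcases Nat.eq_zero_or_pos (α.1 : ℕ) with hα | hα
    · simp only [synthState_apply_zero c f _ α hα, hα, iteratedDerivWithin_zero]
      rfl
    · simp only [synthState_apply_pos c f _ α hα]
      generalize (fun l => c ⟨α, l⟩ : Fin α.1 → ℝ) = c'
      revert c' hα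
      generalize (α.1 : ℕ) = k
      intro hk c'
      obtain ⟨k, rfl⟩ : ∃ j, k = j + 1 := ⟨k - 1, by omega⟩
      exact iteratedDerivWithin_taylorSynth_top hab c' hI
  filter_upwards [ae_all_iff.2 h] with s hs
  exact funext hs

/-- The function `f` enters only under an integral, so a choice of representative of its class in
`L₂` is harmless at every point `s`. -/
lemma contPart_congr_ae {s : ℝ} (hs : s ∈ Icc a b) (c : ContIdx n → ℝ)
    {f g : ℝ → StateIdx n → ℝ} (h : L2Eq a b f g) : contPart a c f s = contPart a c g s := by
  unfold contPart
  congr 1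
  refine vecInt_congr_ae hs.1 ?_
  filter_upwards [ae_restrict_of_ae_restrict_of_subset (Icc_subset_Icc_right hs.2) h] with θ hθ
  rw [hθ]

lemma contPart_left (c : ContIdx n → ℝ) (f : ℝ → StateIdx n → ℝ) : contPart a c f a = c := by
  ext d
  rw [contPart_apply, taylorSynth_left]

/-! ### Continuity of the polynomial block matrices. -/

lemma matContinuous_matT : MatContinuous (matT n) := by
  intro d e
  simp only [matT, of_apply]
  split_ifs <;> fun_prop

lemma matContinuous_matT1 : MatContinuous (matT1 n) := by
  intro d e
  simp only [matT1, of_apply]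
  split_ifs <;> fun_prop

lemma matContinuous_matQ : MatContinuous (matQ n) := by
  intro d e
  simp only [matQ, of_apply]
  split_ifs <;> fun_prop

lemma matContinuous_matQ1 : MatContinuous (matQ1 n) := by
  intro d e
  simp only [matQ1, of_apply]
  split_ifs <;> fun_prop

end StateMap

/-! ## Boundary conditions -/

section Boundary

variable {N : ℕ} {n : Fin (N + 1) → ℕ} {nv nBC : ℕ} {a b : ℝ}

/-- Meant for the integral term of `B_Q`, which is in fact bounded: `C` is bounded on `[0, b - a]`
and `ρ` is integrable. Measurability in `s` is taken from Fubini's theorem, for the kernel `C (θ -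
s)` below the diagonal and zero above it. -/
lemma matL2_matInt_mul_sub {m l q : Type} [Fintype l] [Fintype q] (hab : a ≤ b)
    {ρ : ℝ → Matrix m l ℝ} (hρ : MatIntegrable a b ρ) {C : ℝ → Matrix l q ℝ}
    (hC : MatContinuous C) : MatL2 a b fun s => matInt s b (fun θ => ρ θ * C (θ - s)) := by
  classical
  intro i j
  -- Testing against a constant basis vector extracts column `j`.
  have hf : L2Mem a b (fun _ => Pi.single j 1 : ℝ → q → ℝ) :=
    memLp_pi_iff.2 fun r => memLp_restrict_Icc_of_continuous continuous_const 2
  have hV := VolterraKernel.of_sub hab hC hf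
  have hZ := VolterraKernel.zero (a := a) (b := b) (l := l) (fun _ => Pi.single j 1 : ℝ → q → ℝ)
  have hρ' : ∀ i r, Integrable (fun s => ρ s i r) (volume.restrict (Icc a b)) := fun i r =>
    (intervalIntegrable_iff_integrableOn_Icc_of_le hab).1 (hρ i r)
  obtain ⟨-, h2, -⟩ := vecInt_mulVec_vecInt hab (ρ := ρ)
    (K := splitKernel (fun θ η => C (θ - η)) 0) (f := fun _ => Pi.single j 1)
    fun i r j => hV.prod_splitKernel hZ (hρ' i r) r j
  have h3 := (intervalIntegrable_iff_integrableOn_Icc_of_le hab).1 (h2 i)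
  have hmeas : AEStronglyMeasurable (fun s => matInt s b (fun θ => ρ θ * C (θ - s)) i j)
      (volume.restrict (Icc a b)) := by
    refine h3.aestronglyMeasurable.congr ?_
    filter_upwards [ae_restrict_mem measurableSet_Icc] with s hs
    rw [matInt_mul_splitKernel hρ (hV.cont s) (hZ.cont s) hs]
    have : matInt a s (fun θ => ρ θ * (0 : ℝ → ℝ → Matrix l q ℝ) θ s) = 0 := by
      ext; simp [matInt]
    rw [this, zero_add]
    simp
  have hbd : ∀ r, ∃ K, ∀ x ∈ Icc (0 : ℝ) (b - a), ‖C x r j‖ ≤ K := fun r =>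
    isCompact_Icc.exists_bound_of_continuousOn (hC r j).continuousOn
  choose K hK using hbd
  have hint : IntervalIntegrable (fun θ => ∑ r, ‖ρ θ i r‖ * K r) volume a b := by
    have := IntervalIntegrable.sum (μ := volume) (a := a) (b := b) Finset.univ
      (f := fun r θ => ‖ρ θ i r‖ * K r) fun r _ => (hρ i r).norm.mul_const _
    simpa [Finset.sum_fn] using this
  have hK0 : ∀ r, 0 ≤ K r := fun r =>
    (norm_nonneg _).trans (hK r 0 ⟨le_rfl, sub_nonneg.2 hab⟩)
  refine MemLp.of_bound hmeas (∫ θ in a..b, ∑ r, ‖ρ θ i r‖ * K r) ?_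
  filter_upwards [ae_restrict_mem measurableSet_Icc] with s hs
  calc ‖matInt s b (fun θ => ρ θ * C (θ - s)) i j‖
      ≤ ∫ θ in s..b, ∑ r, ‖ρ θ i r‖ * K r := by
        simp only [matInt, of_apply, mul_apply]
        refine intervalIntegral.norm_integral_le_of_norm_le hs.2 ?_
          (intervalIntegrable_mono_left hint hs)
        refine ae_of_all _ fun θ hθ => (norm_sum_le _ _).trans (Finset.sum_le_sum fun r _ => ?_)
        rw [norm_mul]
        refine mul_le_mul_of_nonneg_left (hK r _ ?_) (norm_nonneg _)
        exact ⟨sub_nonneg.2 hθ.1.le, by linarith [hθ.2, hs.1]⟩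
    _ ≤ _ := by
        refine intervalIntegral.integral_mono_interval hs.1 hs.2 le_rfl ?_ hint
        exact ae_of_all _ fun θ => Finset.sum_nonneg fun r _ =>
          mul_nonneg (norm_nonneg _) (hK0 r)

variable {Gb : BCParams n nBC nv}

lemma matBT_mul_matBTinv (hadm : Admissible a b Gb) :
    matBT a b Gb * matBTinv a b Gb = 1 := by
  rw [matBTinv, dif_pos hadm]
  exact hadm.choose_spec.1

lemma matBTinv_mul_matBT (hadm : Admissible a b Gb) :
    matBTinv a b Gb * matBT a b Gb = 1 := by
  rw [matBTinv, dif_pos hadm]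
  exact hadm.choose_spec.2

lemma matL2_matBQ (hab : a ≤ b) (hGb : Gb.SquareIntegrable a b) : MatL2 a b (matBQ a b Gb) := by
  have hBI : MatL2 a b Gb.BI := hGb
  refine MatL2.const_mul _ (((hBI.mul_const _).add ?_).sub ?_)
  · exact matL2_matInt_mul_sub hab ((hBI.mul_const _).matIntegrable hab) matContinuous_matQ
  · refine MatL2.const_mul _ (MatL2.fromRows (MatContinuous.const 0).matL2 ?_)
    exact (matContinuous_matQ.comp (by fun_prop)).matL2

/-- The defect of the boundary conditions in terms of the boundary values at `a` and of the
derivatives of maximal order. -/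
lemma boundary_defect (hab : a ≤ b) (hGb : Gb.SquareIntegrable a b) (hadm : Admissible a b Gb)
    (c : ContIdx n → ℝ) {f : ℝ → StateIdx n → ℝ} (hf : L2Mem a b f)
    {F : ℝ → DerIdx n → ℝ}
    (hF : L2Eq a b F fun s => matU1 n *ᵥ f s + matU2 n *ᵥ contPart a c f s) :
    vecInt a b (fun s => Gb.BI s *ᵥ F s)
      - Gb.B *ᵥ Sum.elim (contPart a c f a) (contPart a c f b) =
    matBT a b Gb *ᵥ (vecInt a b (fun s => matBQ a b Gb s *ᵥ f s) - c) := by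
  have hBI : MatL2 a b Gb.BI := hGb
  have hQ : MatContinuous fun s => matU2 n * matQ n s :=
    (MatContinuous.const _).mul matContinuous_matQ
  have hV := VolterraKernel.of_sub hab hQ hf
  have hZ := VolterraKernel.zero (a := a) (b := b) (l := DerIdx n) f
  have hT : MatContinuous fun s => matU2 n * matT n (s - a) :=
    (MatContinuous.const _).mul (matContinuous_matT.comp (by fun_prop))
  have hQs : ∀ s, VecIntegrable a b (fun θ => matQ n (s - θ) *ᵥ f θ) := fun s =>
    (matContinuous_matQ.comp (g := fun θ => s - θ) (by fun_prop)).matL2.mulVec hab hf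
  -- The Taylor remainder is a Volterra integral with zero kernel above the diagonal. Exchanging the
  -- order of integration turns its contribution into the term `∫_s^b B_I U₂ Q(θ - s) dθ` of `B_Q`.
  obtain ⟨-, i2, i3, e⟩ := vecInt_mulVec_apply hab hBI hT (matU1 n) hf hV hZ c
    (g := fun s => matU1 n *ᵥ f s + matU2 n *ᵥ contPart a c f s) (fun θ hθ => by
      simp only [contPart, mulVec_add, mulVec_vecInt _ ((hQs θ).mono_right hθ), mulVec_mulVec,
        Pi.zero_apply, zero_mulVec, vecInt_zero]
      abel)
  have e0 : vecInt a b (fun s => Gb.BI s *ᵥ F s) =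
      vecInt a b (fun s => Gb.BI s *ᵥ (matU1 n *ᵥ f s + matU2 n *ᵥ contPart a c f s)) := by
    refine vecInt_congr_ae hab ?_
    filter_upwards [hF] with s hs
    rw [hs]
  -- The contribution of the remainder to the boundary values: none at `a`, hence the zero block,
  -- and `Q(b - s)` at `b`.
  set D : ℝ → Matrix (Fin nBC) (StateIdx n) ℝ := fun s =>
    Gb.B * Matrix.fromRows 0 (matQ n (b - s)) with hD
  have hDL : MatL2 a b D :=
    MatL2.const_mul _ (MatL2.fromRows (MatContinuous.const 0).matL2
      (matContinuous_matQ.comp (by fun_prop)).matL2)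
  have iD : VecIntegrable a b (fun s => D s *ᵥ f s) := hDL.mulVec hab hf
  have iQ : VecIntegrable a b (fun s => matBQ a b Gb s *ᵥ f s) :=
    (matL2_matBQ hab hGb).mulVec hab hf
  -- Multiplying by `B_T` cancels the inverse in the definition of `B_Q` and leaves exactly the
  -- `f`-terms of the boundary conditions.
  have eBQ : matBT a b Gb *ᵥ vecInt a b (fun s => matBQ a b Gb s *ᵥ f s) =
      vecInt a b (fun s => (Gb.BI s * matU1 n) *ᵥ f s)
      + vecInt a b (fun η => matInt a b (fun θ => Gb.BI θ *
        splitKernel (fun θ η => matU2 n * matQ n (θ - η)) 0 θ η) *ᵥ f η)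
      - vecInt a b (fun s => D s *ᵥ f s) := by
    rw [mulVec_vecInt _ iQ, ← vecInt_add i2 i3, ← vecInt_sub (i2.add i3) iD]
    refine vecInt_congr_Ioo hab fun s hs => ?_
    have hs' := Ioo_subset_Icc_self hs
    rw [mulVec_mulVec, matBQ, ← Matrix.mul_assoc, matBT_mul_matBTinv hadm, Matrix.one_mul,
      ← add_mulVec, ← sub_mulVec,
      matInt_mul_splitKernel (hBI.matIntegrable hab) (hV.cont s) (hZ.cont s) hs']
    have : matInt a s (fun θ => Gb.BI θ * (0 : ℝ → ℝ → Matrix (DerIdx n) (StateIdx n) ℝ) θ s)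
        = 0 := by
      ext; simp [matInt]
    rw [this, zero_add]
    simp only [hD, Matrix.mul_assoc]
  have eD : Gb.B *ᵥ Sum.elim (contPart a c f a) (contPart a c f b) =
      (Gb.B * Matrix.fromRows (matT n 0) (matT n (b - a))) *ᵥ c
        + vecInt a b (fun s => D s *ᵥ f s) := by
    have : vecInt a b (fun s => D s *ᵥ f s) = Gb.B *ᵥ Sum.elim (0 : ContIdx n → ℝ)
        (vecInt a b (fun θ => matQ n (b - θ) *ᵥ f θ)) := by
      have e1 : Sum.elim (0 : ContIdx n → ℝ) (vecInt a b (fun θ => matQ n (b - θ) *ᵥ f θ)) =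
          vecInt a b (fun θ => Matrix.fromRows 0 (matQ n (b - θ)) *ᵥ f θ) := by
        ext (i | i) <;> simp [vecInt, fromRows_mulVec]
      have i1 : VecIntegrable a b (fun θ => Matrix.fromRows (0 : Matrix (ContIdx n) (StateIdx n) ℝ)
          (matQ n (b - θ)) *ᵥ f θ) := by
        rintro (i | i)
        · simp [fromRows_mulVec]
        · simpa [fromRows_mulVec] using hQs b i
      rw [e1, mulVec_vecInt _ i1]
      simp only [hD, mulVec_mulVec]
      rfl
    rw [this, ← mulVec_mulVec, ← mulVec_add, fromRows_mulVec]
    congr 1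
    ext (i | i) <;> simp [contPart, vecInt]
  rw [e0, e, eD, mulVec_sub, eBQ]
  simp only [matBT, sub_mulVec, Matrix.mul_assoc]
  abel

/-- The boundary values at `a` which solve the boundary conditions. -/
def bdValue (a b : ℝ) (Gb : BCParams n nBC nv) (v : Fin nv → ℝ) (f : ℝ → StateIdx n → ℝ) :
    ContIdx n → ℝ :=
  (matBTinv a b Gb * Gb.Bv) *ᵥ v + vecInt a b (fun s => matBQ a b Gb s *ᵥ f s)

lemma matBT_mulVec_bdValue (hadm : Admissible a b Gb) (v : Fin nv → ℝ)
    (f : ℝ → StateIdx n → ℝ) (c : ContIdx n → ℝ) :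
    matBT a b Gb *ᵥ (bdValue a b Gb v f - c) =
      matBT a b Gb *ᵥ (vecInt a b (fun s => matBQ a b Gb s *ᵥ f s) - c) + Gb.Bv *ᵥ v := by
  rw [bdValue, add_sub_assoc, mulVec_add, mulVec_mulVec, ← Matrix.mul_assoc,
    matBT_mul_matBTinv hadm, Matrix.one_mul, add_comm]

/-- By `boundary_defect` the boundary conditions read `B_T (bdValue - 𝒞 x̂(a)) = 0`, and `B_T` is
injective. -/
lemma memXv_iff (hab : a < b) (hGb : Gb.SquareIntegrable a b) (hadm : Admissible a b Gb)
    {xh : ℝ → StateIdx n → ℝ} {v : Fin nv → ℝ} :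
    MemXv a b Gb v xh ↔
      StateSobolev a b xh ∧ opC a b xh a = bdValue a b Gb v (topDer a b xh) := by
  refine and_congr_right fun (hS : StateSobolev a b xh) => ?_
  have hf := hS.l2Mem_topDer
  have hF : L2Eq a b (opF a b xh) fun s => matU1 n *ᵥ topDer a b xh s +
      matU2 n *ᵥ contPart a (opC a b xh a) (topDer a b xh) s := by
    filter_upwards [ae_restrict_mem measurableSet_Icc] with s hs
    rw [opF_eq, hS.opC_eq hab hs]
  have h := boundary_defect hab.le hGb hadm (opC a b xh a) hf hF
  have hB : opB a b xh = Sum.elim (contPart a (opC a b xh a) (topDer a b xh) a)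
      (contPart a (opC a b xh a) (topDer a b xh) b) := by
    rw [opB, ← hS.opC_eq hab (right_mem_Icc.2 hab.le), ← hS.opC_eq hab (left_mem_Icc.2 hab.le)]
  rw [hB, add_sub_right_comm, h, ← matBT_mulVec_bdValue hadm]
  constructor
  · intro h0
    have := congrArg (fun z => matBTinv a b Gb *ᵥ z) h0
    simp only [mulVec_mulVec, matBTinv_mul_matBT hadm, one_mulVec, mulVec_zero] at this
    exact (sub_eq_zero.1 this).symm
  · intro h0
    rw [← h0, sub_self, mulVec_zero]

lemma bdValue_congr_ae (hab : a ≤ b) (v : Fin nv → ℝ) {f g : ℝ → StateIdx n → ℝ}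
    (h : L2Eq a b f g) : bdValue a b Gb v f = bdValue a b Gb v g := by
  unfold bdValue
  congr 1
  refine vecInt_congr_ae hab ?_
  filter_upwards [h] with s hs
  rw [hs]

/-- Surjectivity of the parametrisation: every `f ∈ L₂` comes from a state satisfying the boundary
conditions. That `f` is recovered only almost everywhere does no harm, since `bdValue` depends on
its class alone. -/
lemma memXv_synthState (hab : a < b) (hGb : Gb.SquareIntegrable a b) (hadm : Admissible a b Gb)
    (v : Fin nv → ℝ) {f : ℝ → StateIdx n → ℝ} (hf : L2Mem a b f) :
    MemXv a b Gb v (synthState a (bdValue a b Gb v f) f) := by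
  refine (memXv_iff hab hGb hadm).2 ⟨stateSobolev_synthState hab _ hf, ?_⟩
  rw [opC_synthState hab _ hf (left_mem_Icc.2 hab.le), contPart_left]
  exact bdValue_congr_ae hab.le v (topDer_synthState hab _ hf).symm

end Boundary

/-! ## The state map as a 4-PI operator -/

section StateOperators

variable {N : ℕ} {n : Fin (N + 1) → ℕ} {nv nr nBC : ℕ} {a b : ℝ} {Gb : BCParams n nBC nv}

lemma regular_Upsilon (hab : a ≤ b) (hGb : Gb.SquareIntegrable a b) {f : ℝ → StateIdx n → ℝ}
    (hf : L2Mem a b f) : (Upsilon a b Gb).Regular a b f where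
  Q1 := by
    have hQ := matL2_matBQ hab hGb
    refine MatL2.fromRows (MatContinuous.const 0).matL2 (hQ.fromRows ((hQ.const_mul _).add ?_))
    exact (matContinuous_matQ.comp (by fun_prop)).matL2
  Q2 := (((MatContinuous.const _).mul (matContinuous_matT.comp (by fun_prop))).mul
    (.const _)).mul (.const _)
  R0 _ := rfl
  R1 := by
    refine VolterraKernel.add ?_ ?_
    · exact .of_mul hab ((MatContinuous.const _).mul (matContinuous_matT.comp (by fun_prop)))
        (matL2_matBQ hab hGb) hf
    · exact .of_sub hab ((MatContinuous.const _).mul matContinuous_matQ) hf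
  R2 := .of_mul hab ((MatContinuous.const _).mul (matContinuous_matT.comp (by fun_prop)))
    (matL2_matBQ hab hGb) hf

lemma vecIntegrable_matBQ (hab : a ≤ b) (hGb : Gb.SquareIntegrable a b)
    {f : ℝ → StateIdx n → ℝ} (hf : L2Mem a b f) :
    VecIntegrable a b (fun s => matBQ a b Gb s *ᵥ f s) :=
  (matL2_matBQ hab hGb).mulVec hab hf

/-- Evaluation of a kernel operator of the form occurring in the state map. -/
lemma vecInt_add_vecInt_matBQ (hab : a ≤ b) (hGb : Gb.SquareIntegrable a b) {p : Type}
    {f : ℝ → StateIdx n → ℝ} (hf : L2Mem a b f) (A : Matrix p (ContIdx n) ℝ)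
    {C : ℝ → Matrix p (StateIdx n) ℝ} (hC : MatContinuous C) {s : ℝ} (hs : s ∈ Icc a b) :
    vecInt a s (fun θ => (A * matBQ a b Gb θ + C (s - θ)) *ᵥ f θ)
        + vecInt s b (fun θ => (A * matBQ a b Gb θ) *ᵥ f θ) =
      A *ᵥ vecInt a b (fun θ => matBQ a b Gb θ *ᵥ f θ)
        + vecInt a s (fun θ => C (s - θ) *ᵥ f θ) := by
  have iQ := vecIntegrable_matBQ hab hGb hf
  have iA : VecIntegrable a b (fun θ => (A * matBQ a b Gb θ) *ᵥ f θ) :=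
    ((matL2_matBQ hab hGb).const_mul A).mulVec hab hf
  have iC : VecIntegrable a b (fun θ => C (s - θ) *ᵥ f θ) :=
    (hC.comp (g := fun θ => s - θ) (by fun_prop)).matL2.mulVec hab hf
  simp only [add_mulVec]
  rw [vecInt_add (iA.mono_right hs) (iC.mono_right hs), add_right_comm, vecInt_add_vecInt iA hs,
    mulVec_vecInt _ iQ]
  simp only [mulVec_mulVec]

/-- The finite-dimensional rows of `Υ` are `v` itself and Taylor's formula at `a` and at `b`, with
`bdValue` inserted for the coefficients at `a`. -/
lemma Upsilon_apply_fst (hab : a ≤ b) (hGb : Gb.SquareIntegrable a b) (v : Fin nv → ℝ)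
    {f : ℝ → StateIdx n → ℝ} (hf : L2Mem a b f) :
    ((Upsilon a b Gb).apply a b (v, f)).1 =
      Sum.elim v (Sum.elim (contPart a (bdValue a b Gb v f) f a)
        (contPart a (bdValue a b Gb v f) f b)) := by
  have iQ := vecIntegrable_matBQ hab hGb hf
  have iC : VecIntegrable a b (fun θ => matQ n (b - θ) *ᵥ f θ) :=
    (matContinuous_matQ.comp (g := fun θ => b - θ) (by fun_prop)).matL2.mulVec hab hf
  have iT : VecIntegrable a b (fun θ => (matT n (b - a) * matBQ a b Gb θ) *ᵥ f θ) :=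
    ((matL2_matBQ hab hGb).const_mul _).mulVec hab hf
  have e : contPart a (bdValue a b Gb v f) f b =
      (matT n (b - a) * matBTinv a b Gb * Gb.Bv) *ᵥ v +
        vecInt a b (fun θ => (matT n (b - a) * matBQ a b Gb θ + matQ n (b - θ)) *ᵥ f θ) := by
    simp only [add_mulVec]
    rw [vecInt_add iT iC, contPart, bdValue, mulVec_add, mulVec_vecInt _ iQ]
    simp only [mulVec_mulVec, Matrix.mul_assoc, add_assoc]
  rw [contPart_left, e]
  ext (i | i | i) <;>
    simp [Upsilon, PI4.apply, vecInt, fromRows_mulVec, bdValue]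

lemma Upsilon_apply_snd (hab : a ≤ b) (hGb : Gb.SquareIntegrable a b) (v : Fin nv → ℝ)
    {f : ℝ → StateIdx n → ℝ} (hf : L2Mem a b f) {s : ℝ} (hs : s ∈ Icc a b) :
    ((Upsilon a b Gb).apply a b (v, f)).2 s =
      matU1 n *ᵥ f s + matU2 n *ᵥ contPart a (bdValue a b Gb v f) f s := by
  have h := vecInt_add_vecInt_matBQ hab hGb hf (matU2 n * matT n (s - a))
    ((MatContinuous.const (matU2 n)).mul matContinuous_matQ) hs
  have iC : VecIntegrable a b (fun θ => matQ n (s - θ) *ᵥ f θ) :=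
    (matContinuous_matQ.comp (g := fun θ => s - θ) (by fun_prop)).matL2.mulVec hab hf
  simp only [PI4.apply, Upsilon]
  rw [add_assoc _ (vecInt a s _), h, contPart, bdValue]
  simp only [mulVec_add, mulVec_vecInt _ (iC.mono_right hs), mulVec_mulVec, Matrix.mul_assoc]
  abel

/-- The 4-PI form of the map from derivatives of maximal order to states. -/
lemma state_operator_eq (hab : a ≤ b) (hGb : Gb.SquareIntegrable a b) (v : Fin nv → ℝ)
    {f : ℝ → StateIdx n → ℝ} (hf : L2Mem a b f) {s : ℝ} (hs : s ∈ Icc a b) :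
    matGv a b Gb s *ᵥ v + matG0 n *ᵥ f s + vecInt a s (fun θ => matG1 a b Gb s θ *ᵥ f θ)
        + vecInt s b (fun θ => matG2 a b Gb s θ *ᵥ f θ) =
      synthState a (bdValue a b Gb v f) f s := by
  have h := vecInt_add_vecInt_matBQ hab hGb hf (matT1 n (s - a)) matContinuous_matQ1 hs
  simp only [matGv, matG1, matG2, add_comm (matQ1 n _)]
  rw [add_assoc _ (vecInt a s _), h, synthState, bdValue]
  simp only [mulVec_add, mulVec_mulVec, Matrix.mul_assoc]
  abel

lemma PI4.apply_fst {m n p q : Type} [Fintype n] [Fintype q] (S : PI4 m n p q) (x : RL2 n q) :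
    (S.apply a b x).1 = S.P *ᵥ x.1 + vecInt a b (fun θ => S.Q1 θ *ᵥ x.2 θ) := rfl

lemma PI4.apply_snd {m n p q : Type} [Fintype n] [Fintype q] (S : PI4 m n p q) (x : RL2 n q)
    (s : ℝ) : (S.apply a b x).2 s = S.Q2 s *ᵥ x.1 + S.R0 s *ᵥ x.2 s
      + vecInt a s (fun θ => S.R1 s θ *ᵥ x.2 θ) + vecInt s b (fun θ => S.R2 s θ *ᵥ x.2 θ) := rfl

/-! ### The output and the right-hand side of the PDE in terms of the derivatives of maximal order.
-/

variable {Gp : PDEParams n nv nr}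

lemma memLp_two_of_memLp_top {g : ℝ → ℝ} (h : MemLp g ∞ (volume.restrict (Icc a b))) :
    MemLp g 2 (volume.restrict (Icc a b)) := h.mono_exponent le_top

/-- The essential supremum over the square bounds almost every slice, and an essentially bounded
function on a bounded interval is square integrable. -/
lemma ae_memLp_slice {g : ℝ × ℝ → ℝ} (h : MemLp g ∞
    ((volume.restrict (Icc a b)).prod (volume.restrict (Icc a b)))) :
    ∀ᵐ s ∂(volume.restrict (Icc a b)),
      MemLp (fun θ => g (s, θ)) 2 (volume.restrict (Icc a b)) := by
  have h1 := h.1.prodMk_left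
  have h2 := Measure.ae_ae_of_ae_prod (ae_le_eLpNormEssSup (f := g)
    (μ := (volume.restrict (Icc a b)).prod (volume.restrict (Icc a b))))
  have h3 : eLpNormEssSup g
      ((volume.restrict (Icc a b)).prod (volume.restrict (Icc a b))) < ∞ := by
    simpa using h.2
  filter_upwards [h1, h2] with s hs1 hs2
  refine MemLp.mono_exponent (q := ∞) ⟨hs1, ?_⟩ le_top
  rw [eLpNorm_exponent_top]
  exact (essSup_le_of_ae_le _ hs2).trans_lt h3

/-- Allowing any representative `f` serves both directions of the equivalence: from the GPDE `f` is
`topDer` itself, from the PIE it is the given state, which agrees with `topDer` only almost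
everywhere. -/
lemma topDer_operator (hab : a < b) (hGb : Gb.SquareIntegrable a b) (hadm : Admissible a b Gb)
    {xh : ℝ → StateIdx n → ℝ} {v : Fin nv → ℝ} (hxh : MemXv a b Gb v xh)
    {f : ℝ → StateIdx n → ℝ} (hf : L2Eq a b (topDer a b xh) f) :
    L2Mem a b f ∧ opB a b xh = Sum.elim (contPart a (bdValue a b Gb v f) f a)
      (contPart a (bdValue a b Gb v f) f b) ∧
    ∀ s ∈ Icc a b, opC a b xh s = contPart a (bdValue a b Gb v f) f s := by
  obtain ⟨hS, hc⟩ := (memXv_iff hab hGb hadm).1 hxh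
  have e : ∀ s ∈ Icc a b, opC a b xh s = contPart a (bdValue a b Gb v f) f s := fun s hs => by
    rw [hS.opC_eq hab hs, hc, bdValue_congr_ae hab.le v hf, contPart_congr_ae hs _ hf]
  refine ⟨hS.l2Mem_topDer.ae_eq hf, ?_, e⟩
  rw [opB, e a (left_mem_Icc.2 hab.le), e b (right_mem_Icc.2 hab.le)]

lemma opF_ae_eq (hab : a < b) (hGb : Gb.SquareIntegrable a b) (hadm : Admissible a b Gb)
    {xh : ℝ → StateIdx n → ℝ} {v : Fin nv → ℝ} (hxh : MemXv a b Gb v xh)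
    {f : ℝ → StateIdx n → ℝ} (hf : L2Eq a b (topDer a b xh) f) :
    L2Eq a b (opF a b xh) ((Upsilon a b Gb).apply a b (v, f)).2 := by
  obtain ⟨hfL, -, hC⟩ := topDer_operator hab hGb hadm hxh hf
  filter_upwards [hf, ae_restrict_mem measurableSet_Icc] with s hs hs'
  rw [opF_eq, Upsilon_apply_snd hab.le hGb v hfL hs', hs, hC s hs']

/-- The output of the PDE subsystem in terms of the derivatives of maximal order. -/
lemma pdeOut_eq (hab : a < b) (hGb : Gb.SquareIntegrable a b) (hadm : Admissible a b Gb)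
    (hGp : Gp.Bounded a b) {xh : ℝ → StateIdx n → ℝ} {v : Fin nv → ℝ} (hxh : MemXv a b Gb v xh)
    {f : ℝ → StateIdx n → ℝ} (hf : L2Eq a b (topDer a b xh) f) :
    pdeOut a b Gp xh = ((pdePI a b Gb Gp).apply a b (v, f)).1 := by
  obtain ⟨hfL, hB, -⟩ := topDer_operator hab hGb hadm hxh hf
  have hCr : MatL2 a b (Xi Gp).Q1 := fun i j => memLp_two_of_memLp_top (hGp.Cr i j)
  rw [pdePI, (PI4.comp_apply_fst hab.le _ _ _ hfL hCr (regular_Upsilon hab.le hGb hfL)).2]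
  have hF := opF_ae_eq hab hGb hadm hxh hf
  have e : vecInt a b (fun θ => Gp.Cr θ *ᵥ opF a b xh θ) = vecInt a b (fun θ =>
      Gp.Cr θ *ᵥ ((Upsilon a b Gb).apply a b (v, f)).2 θ) := by
    refine vecInt_congr_ae hab.le ?_
    filter_upwards [hF] with s hs
    rw [hs]
  rw [pdeOut, e, PI4.apply_fst (Xi Gp), Upsilon_apply_fst hab.le hGb v hfL, ← hB]
  simp only [Xi, fromCols_mulVec_sumElim, zero_mulVec, zero_add]

lemma vecIntegrable_pdePI_Q1 (hab : a ≤ b) (hGb : Gb.SquareIntegrable a b)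
    (hGp : Gp.Bounded a b) {f : ℝ → StateIdx n → ℝ} (hf : L2Mem a b f) :
    VecIntegrable a b (fun s => (pdePI a b Gb Gp).Q1 s *ᵥ f s) :=
  (PI4.comp_apply_fst hab (Xi Gp) (Upsilon a b Gb) 0 hf
    (fun i j => memLp_two_of_memLp_top (hGp.Cr i j)) (regular_Upsilon hab hGb hf)).1

/-- The right-hand side of the PDE in terms of the derivatives of maximal order. -/
lemma pdeRHS_ae_eq (hab : a < b) (hGb : Gb.SquareIntegrable a b) (hadm : Admissible a b Gb)
    (hGp : Gp.Bounded a b) {xh : ℝ → StateIdx n → ℝ} {v : Fin nv → ℝ} (hxh : MemXv a b Gb v xh)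
    {f : ℝ → StateIdx n → ℝ} (hf : L2Eq a b (topDer a b xh) f) :
    L2Eq a b (pdeRHS a b Gp v xh) ((pdePI a b Gb Gp).apply a b (v, f)).2 := by
  obtain ⟨hfL, hB, -⟩ := topDer_operator hab hGb hadm hxh hf
  have hF := opF_ae_eq hab hGb hadm hxh hf
  have hA1 : ∀ᵐ s ∂(volume.restrict (Icc a b)), MatL2 a b ((Xi Gp).R1 s) :=
    ae_all_iff.2 fun i => ae_all_iff.2 fun j => ae_memLp_slice (hGp.A1 i j)
  have hA2 : ∀ᵐ s ∂(volume.restrict (Icc a b)), MatL2 a b ((Xi Gp).R2 s) :=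
    ae_all_iff.2 fun i => ae_all_iff.2 fun j => ae_memLp_slice (hGp.A2 i j)
  filter_upwards [hF, hA1, hA2, ae_restrict_mem measurableSet_Icc] with s hs h1 h2 hs'
  rw [pdePI, PI4.comp_apply_snd hab.le _ _ _ hfL (regular_Upsilon hab.le hGb hfL) hs' h1 h2]
  have e1 : vecInt a s (fun θ => Gp.A1 s θ *ᵥ opF a b xh θ) = vecInt a s (fun θ =>
      Gp.A1 s θ *ᵥ ((Upsilon a b Gb).apply a b (v, f)).2 θ) := by
    refine vecInt_congr_ae hs'.1 ?_
    filter_upwards [ae_restrict_of_ae_restrict_of_subset (Icc_subset_Icc_right hs'.2) hF]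
      with θ hθ
    rw [hθ]
  have e2 : vecInt s b (fun θ => Gp.A2 s θ *ᵥ opF a b xh θ) = vecInt s b (fun θ =>
      Gp.A2 s θ *ᵥ ((Upsilon a b Gb).apply a b (v, f)).2 θ) := by
    refine vecInt_congr_ae hs'.2 ?_
    filter_upwards [ae_restrict_of_ae_restrict_of_subset (Icc_subset_Icc_left hs'.1) hF]
      with θ hθ
    rw [hθ]
  simp only [pdeRHS]
  rw [e1, e2, hs, PI4.apply_snd (Xi Gp), Upsilon_apply_fst hab.le hGb v hfL, ← hB]
  simp only [Xi, fromCols_mulVec_sumElim]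
  abel

lemma MemXv.eq_synthState (hab : a < b) (hGb : Gb.SquareIntegrable a b)
    (hadm : Admissible a b Gb) {xh : ℝ → StateIdx n → ℝ} {v : Fin nv → ℝ}
    (hxh : MemXv a b Gb v xh) :
    EqOn xh (synthState a (bdValue a b Gb v (topDer a b xh)) (topDer a b xh)) (Icc a b) := by
  obtain ⟨hS, hc⟩ := (memXv_iff hab hGb hadm).1 hxh
  rw [← hc]
  exact hS.eq_synthState hab

end StateOperators

/-! ## Signals in time -/

section Signals

variable {a b : ℝ}

/-- Scalar version of `W1e`. -/
def ScalarW1e (g : ℝ → ℝ) : Prop :=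
  ∀ T : ℝ, 0 ≤ T → MemLp g 2 (volume.restrict (Icc 0 T)) ∧
    AbsolutelyContinuousOnInterval g 0 T ∧ MemLp (deriv g) 2 (volume.restrict (Icc 0 T))

lemma w1e_iff {ι : Type} [Fintype ι] {f : ℝ → ι → ℝ} :
    W1e f ↔ ∀ i, ScalarW1e fun t => f t i := by
  constructor
  · intro h i T hT
    exact ⟨memLp_pi_iff.1 (h.1 T hT) i, h.2 T hT i⟩
  · intro h
    exact ⟨fun T hT => memLp_pi_iff.2 fun i => (h i T hT).1, fun T hT i => (h i T hT).2⟩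

lemma ae_restrict_Icc_of_ac {g : ℝ → ℝ} {T : ℝ} (hT : 0 ≤ T)
    (h : AbsolutelyContinuousOnInterval g 0 T) :
    ∀ᵐ t ∂(volume.restrict (Icc 0 T)), DifferentiableAt ℝ g t := by
  rw [ae_restrict_iff' measurableSet_Icc, ← uIcc_of_le hT]
  exact h.ae_differentiableAt

lemma scalarW1e_zero : ScalarW1e fun _ => 0 := fun T _ =>
  ⟨by simp, ContDiffOn.absolutelyContinuousOnInterval contDiffOn_const, by simp⟩

lemma ScalarW1e.add {g h : ℝ → ℝ} (hg : ScalarW1e g) (hh : ScalarW1e h) :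
    ScalarW1e fun t => g t + h t := by
  intro T hT
  obtain ⟨g1, g2, g3⟩ := hg T hT
  obtain ⟨h1, h2, h3⟩ := hh T hT
  refine ⟨g1.add h1, g2.fun_add h2, (g3.add h3).ae_eq ?_⟩
  -- `deriv` is zero by convention where no derivative exists, so it is additive only where both
  -- functions are differentiable; absolute continuity makes that almost everywhere.
  filter_upwards [ae_restrict_Icc_of_ac hT g2, ae_restrict_Icc_of_ac hT h2] with t ht ht'
  rw [Pi.add_apply, deriv_fun_add ht ht']

lemma ScalarW1e.const_mul {g : ℝ → ℝ} (hg : ScalarW1e g) (c : ℝ) :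
    ScalarW1e fun t => c * g t := by
  intro T hT
  obtain ⟨g1, g2, g3⟩ := hg T hT
  refine ⟨g1.const_mul c, g2.const_mul c, (g3.const_mul c).ae_eq ?_⟩
  filter_upwards [ae_restrict_Icc_of_ac hT g2] with t ht
  rw [deriv_const_mul _ ht]

lemma scalarW1e_sum {κ : Type} (s : Finset κ) {g : κ → ℝ → ℝ} (hg : ∀ k, ScalarW1e (g k)) :
    ScalarW1e fun t => ∑ k ∈ s, g k t := by
  classical
  induction s using Finset.induction_on with
  | empty => simpa using scalarW1e_zero
  | insert k s hk ih =>
    simp only [Finset.sum_insert hk]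
    exact (hg k).add ih

lemma W1e.mulVec {ι κ : Type} [Fintype ι] [Fintype κ] {f : ℝ → ι → ℝ} (hf : W1e f)
    (M : Matrix κ ι ℝ) : W1e fun t => M *ᵥ f t := by
  rw [w1e_iff] at hf ⊢
  intro i
  simp only [Matrix.mulVec, dotProduct]
  exact scalarW1e_sum _ fun j => (hf j).const_mul (M i j)

lemma W1e.ae_differentiableAt {ι : Type} [Fintype ι] {f : ℝ → ι → ℝ} (hf : W1e f) :
    ∀ᵐ t ∂(volume.restrict (Ici (0 : ℝ))), DifferentiableAt ℝ f t := by
  have h : ∀ i, ∀ k : ℕ, ∀ᵐ t, t ∈ uIcc (0 : ℝ) k → DifferentiableAt ℝ (fun t => f t i) t :=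
    fun i k => (hf.2 k k.cast_nonneg i).1.ae_differentiableAt
  rw [ae_restrict_iff' measurableSet_Ici]
  filter_upwards [ae_all_iff.2 fun i => ae_all_iff.2 (h i)] with t ht ht0
  obtain ⟨k, hk⟩ := exists_nat_ge t
  refine differentiableAt_pi.2 fun i => ht i k ?_
  rw [uIcc_of_le (ht0.trans hk)]
  exact ⟨ht0, hk⟩

lemma L2e.congr_ae {ι : Type} [Fintype ι] {f g : ℝ → ι → ℝ} (hf : L2e f)
    (h : f =ᵐ[volume.restrict (Ici (0 : ℝ))] g) : L2e g := fun T hT =>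
  (hf T hT).ae_eq (ae_restrict_of_ae_restrict_of_subset Icc_subset_Ici_self h)

/-- Time derivatives are two-sided while states are controlled only at times `t ≥ 0`. Discarding `t
= 0` puts a whole neighbourhood of `t` among the controlled times. -/
lemma ae_restrict_Ici_pos : ∀ᵐ t ∂(volume.restrict (Ici (0 : ℝ))), 0 < t := by
  rw [← restrict_Ioi_eq_restrict_Ici]
  exact ae_restrict_mem measurableSet_Ioi

/-- A vector-valued signal is in `W1e` if all the polynomials in `s` formed with its entries are. -/
lemma w1e_of_matT1_mulVec {N : ℕ} {n : Fin (N + 1) → ℕ} (hab : a < b) {c : ℝ → ContIdx n → ℝ}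
    (h : ∀ s ∈ Icc a b, W1e fun t => matT1 n (s - a) *ᵥ c t) : W1e c := by
  rw [w1e_iff]
  rintro ⟨α, l⟩
  -- Component `α` of `T₁(s - a) c` is a polynomial with `α.1` coefficients, so that many distinct
  -- nodes determine it. These are equally spaced and, shifted by `a`, lie in `[a,b]`.
  set x : Fin α.1 → ℝ := fun i => (b - a) * ((i : ℕ) / ((α.1 : ℕ) : ℝ)) with hx
  have hk0 : (0 : ℝ) < (α.1 : ℕ) := by exact_mod_cast l.pos
  have hxinj : Function.Injective x := by
    intro i j hij
    have h1 : ((i : ℕ) / ((α.1 : ℕ) : ℝ)) = (j : ℕ) / ((α.1 : ℕ) : ℝ) :=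
      mul_left_cancel₀ (sub_pos.2 hab).ne' hij
    have h2 := (div_left_inj' hk0.ne').1 h1
    exact Fin.ext (by exact_mod_cast h2)
  have hxmem : ∀ i, x i + a ∈ Icc a b := by
    intro i
    have h1 : (0 : ℝ) ≤ (i : ℕ) / ((α.1 : ℕ) : ℝ) := by positivity
    have h2 : ((i : ℕ) : ℝ) / (α.1 : ℕ) ≤ 1 := by
      rw [div_le_one hk0]
      exact_mod_cast i.2.le
    constructor <;> simp only [hx] <;> nlinarith
  have hdet : IsUnit (vandermonde x).det := (det_vandermonde_ne_zero_iff.2 hxinj).isUnit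
  have hinv := nonsing_inv_mul _ hdet
  -- The inverse Vandermonde matrix returns the coefficient of degree `l`, and the factor `l!`
  -- undoes the normalisation of `τ_l`. The weights do not depend on `t`.
  have e : ∀ t, c t ⟨α, l⟩ =
      ∑ i, ((l : ℕ)! * (vandermonde x)⁻¹ l i) * (matT1 n (x i + a - a) *ᵥ c t) α := by
    intro t
    have h1 : ∀ l' : Fin α.1, ∑ i, (vandermonde x)⁻¹ l i * x i ^ (l' : ℕ) =
        if l = l' then 1 else 0 := fun l' => by
      have := congrFun (congrFun hinv l) l'
      simpa [mul_apply, vandermonde_apply, one_apply] using this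
    calc c t ⟨α, l⟩ = ∑ l' : Fin α.1, (if l = l' then 1 else 0) *
          ((l : ℕ)! / (l' : ℕ)! * c t ⟨α, l'⟩) := by
            have : ((l : ℕ)! : ℝ) ≠ 0 := by positivity
            simp [this]
      _ = _ := by
        simp only [matT1_mulVec, add_sub_cancel_right, Finset.mul_sum]
        rw [Finset.sum_comm]
        refine Finset.sum_congr rfl fun l' _ => ?_
        rw [← h1 l', Finset.sum_mul]
        refine Finset.sum_congr rfl fun i _ => ?_
        simp only [tau]
        ring
  rw [funext e]
  exact scalarW1e_sum _ fun i => (w1e_iff.1 (h _ (hxmem i)) α).const_mul _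

lemma HasL2DerivAt.congr {ι : Type} [Fintype ι] {f g : ℝ → ℝ → ι → ℝ} {d e : ℝ → ι → ℝ} {t : ℝ}
    (h : HasL2DerivAt a b f d t) (hfg : ∀ᶠ τ in 𝓝 t, L2Eq a b (f τ) (g τ))
    (hde : L2Eq a b d e) : HasL2DerivAt a b g e t := by
  refine ⟨h.1.ae_eq hde, h.2.congr' ?_⟩
  have hlim : Tendsto (fun h : ℝ => t + h) (𝓝[≠] 0) (𝓝 t) := by
    have : Tendsto (fun h : ℝ => t + h) (𝓝 0) (𝓝 (t + 0)) :=
      (continuous_const.add continuous_id).tendsto 0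
    rw [add_zero] at this
    exact this.mono_left nhdsWithin_le_nhds
  filter_upwards [hlim.eventually hfg] with h hh
  refine eLpNorm_congr_ae ?_
  filter_upwards [hh, hfg.self_of_nhds, hde] with s h1 h2 h3
  rw [h1, h2, h3]

/-- Membership in `L₂` near `t` is assumed because the triangle inequality for `eLpNorm` requires
measurable difference quotients. -/
lemma HasL2DerivAt.add {ι : Type} [Fintype ι] {f g : ℝ → ℝ → ι → ℝ} {d e : ℝ → ι → ℝ} {t : ℝ}
    (h : HasL2DerivAt a b f d t) (h' : HasL2DerivAt a b g e t)
    (hf : ∀ᶠ τ in 𝓝 t, L2Mem a b (f τ)) (hg : ∀ᶠ τ in 𝓝 t, L2Mem a b (g τ)) :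
    HasL2DerivAt a b (fun τ => f τ + g τ) (d + e) t := by
  refine ⟨MemLp.add h.1 h'.1, ?_⟩
  have hlim : Tendsto (fun h : ℝ => t + h) (𝓝[≠] 0) (𝓝 t) := by
    have : Tendsto (fun h : ℝ => t + h) (𝓝 0) (𝓝 (t + 0)) :=
      (continuous_const.add continuous_id).tendsto 0
    rw [add_zero] at this
    exact this.mono_left nhdsWithin_le_nhds
  have hs := h.2.add h'.2
  rw [add_zero] at hs
  refine tendsto_of_tendsto_of_tendsto_of_le_of_le' tendsto_const_nhds hs
    (Eventually.of_forall fun _ => zero_le) ?_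
  filter_upwards [hlim.eventually hf, hlim.eventually hg] with τ h1 h2
  have m1 : MemLp (fun s => τ⁻¹ • (f (t + τ) s - f t s) - d s) 2 (volume.restrict (Icc a b)) :=
    ((MemLp.sub h1 hf.self_of_nhds).const_smul τ⁻¹).sub h.1
  have m2 : MemLp (fun s => τ⁻¹ • (g (t + τ) s - g t s) - e s) 2 (volume.restrict (Icc a b)) :=
    ((MemLp.sub h2 hg.self_of_nhds).const_smul τ⁻¹).sub h'.1
  refine le_trans (le_of_eq ?_) (eLpNorm_add_le m1.1 m2.1 (by norm_num))
  congr 1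
  ext s i
  simp only [Pi.add_apply, Pi.sub_apply, Pi.smul_apply, smul_eq_mul]
  ring

lemma HasL2DerivAt.neg {ι : Type} [Fintype ι] {f : ℝ → ℝ → ι → ℝ} {d : ℝ → ι → ℝ} {t : ℝ}
    (h : HasL2DerivAt a b f d t) : HasL2DerivAt a b (fun τ => -f τ) (-d) t := by
  refine ⟨MemLp.neg h.1, h.2.congr fun τ => ?_⟩
  rw [← eLpNorm_neg]
  congr 1
  ext s i
  simp only [Pi.neg_apply, Pi.sub_apply, Pi.smul_apply, smul_eq_mul]
  ring

lemma MatContinuous.l2Mem_mulVec {ι κ : Type} [Fintype ι] [Fintype κ] {G : ℝ → Matrix ι κ ℝ}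
    (hG : MatContinuous G) (y : κ → ℝ) : L2Mem a b (fun s => G s *ᵥ y) := by
  refine memLp_pi_iff.2 fun i => memLp_restrict_Icc_of_continuous ?_ 2
  simp only [mulVec, dotProduct]
  exact continuous_finsetSum _ fun j _ => (hG i j).mul continuous_const

/-- A differentiable signal multiplied by a continuous matrix function of the space variable. -/
lemma hasL2DerivAt_mulVec {ι κ : Type} [Fintype ι] [Fintype κ] {G : ℝ → Matrix ι κ ℝ}
    (hG : MatContinuous G) {g : ℝ → κ → ℝ} {g' : κ → ℝ} {t : ℝ} (hg : HasDerivAt g g' t) :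
    HasL2DerivAt a b (fun τ s => G s *ᵥ g τ) (fun s => G s *ᵥ g') t := by
  refine ⟨hG.l2Mem_mulVec g', ?_⟩
  have hbd : ∀ i j, ∃ C, ∀ s ∈ Icc a b, ‖G s i j‖ ≤ C := fun i j =>
    isCompact_Icc.exists_bound_of_continuousOn (hG i j).continuousOn
  choose C hC using hbd
  -- A crude bound for the operator norm of `G s`, uniform in `s`. It turns convergence of the
  -- difference quotient of `g` into uniform convergence in `s`, hence convergence in `L₂` on the
  -- bounded interval.
  set K : ℝ := ∑ i, ∑ j, |C i j| with hK
  have hle : ∀ y : κ → ℝ, ∀ s ∈ Icc a b, ‖G s *ᵥ y‖ ≤ K * ‖y‖ := by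
    intro y s hs
    refine (pi_norm_le_iff_of_nonneg (by positivity)).2 fun i => ?_
    calc ‖(G s *ᵥ y) i‖ ≤ ∑ j, |C i j| * ‖y‖ := by
          simp only [mulVec, dotProduct]
          refine (norm_sum_le _ _).trans (Finset.sum_le_sum fun j _ => ?_)
          rw [norm_mul]
          exact mul_le_mul ((hC i j s hs).trans (le_abs_self _)) (norm_le_pi_norm y j)
            (norm_nonneg _) (abs_nonneg _)
      _ = (∑ j, |C i j|) * ‖y‖ := by rw [Finset.sum_mul]
      _ ≤ K * ‖y‖ := by
          refine mul_le_mul_of_nonneg_right ?_ (norm_nonneg _)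
          exact Finset.single_le_sum (f := fun i => ∑ j, |C i j|)
            (fun i _ => Finset.sum_nonneg fun j _ => abs_nonneg _) (Finset.mem_univ i)
  have hq : Tendsto (fun h : ℝ => ‖h⁻¹ • (g (t + h) - g t) - g'‖) (𝓝[≠] 0) (𝓝 0) := by
    have := (hasDerivAt_iff_tendsto_slope_zero.1 hg).sub_const g'
    simpa using this.norm
  set μ := volume.restrict (Icc a b) with hμ
  have hlim : Tendsto (fun h : ℝ => μ univ ^ ((2 : ℝ≥0∞).toReal⁻¹) *
      ENNReal.ofReal (K * ‖h⁻¹ • (g (t + h) - g t) - g'‖)) (𝓝[≠] 0) (𝓝 0) := by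
    have h1 := ENNReal.tendsto_ofReal (hq.const_mul K)
    rw [mul_zero, ENNReal.ofReal_zero] at h1
    have h2 := ENNReal.Tendsto.const_mul (a := μ univ ^ ((2 : ℝ≥0∞).toReal⁻¹)) h1
      (Or.inr (ENNReal.rpow_ne_top_of_nonneg (by positivity) (measure_ne_top _ _)))
    rwa [mul_zero] at h2
  refine tendsto_of_tendsto_of_tendsto_of_le_of_le tendsto_const_nhds hlim
    (fun _ => zero_le) fun h => ?_
  refine eLpNorm_le_of_ae_bound ?_
  filter_upwards [ae_restrict_mem measurableSet_Icc] with s hs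
  rw [← mulVec_sub, ← mulVec_smul, ← mulVec_sub]
  exact hle _ s hs

end Signals

/-! ## Equivalence of the GPDE and its PIE -/

section Equivalence

variable {N : ℕ} {n : Fin (N + 1) → ℕ} {nx nw nu nz ny nv nr nBC : ℕ} {a b : ℝ}
  {Go : ODEParams nx nw nu nz ny nv nr} {Gb : BCParams n nBC nv} {Gp : PDEParams n nv nr}

/-- The output `r` as a function of `v` and the derivatives of maximal order. -/
def rSig (a b : ℝ) (Gb : BCParams n nBC nv) (Gp : PDEParams n nv nr) (v : Fin nv → ℝ)
    (f : ℝ → StateIdx n → ℝ) : Fin nr → ℝ :=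
  ((pdePI a b Gb Gp).apply a b (v, f)).1

/-- Both outputs and the ODE dynamics of the associated PIE are of this form. -/
lemma mulVec_rSig {m : Type} (hab : a ≤ b) (hGb : Gb.SquareIntegrable a b)
    (hGp : Gp.Bounded a b) {f : ℝ → StateIdx n → ℝ} (hf : L2Mem a b f)
    (C : Matrix m (Fin nx) ℝ) (Dw : Matrix m (Fin nw) ℝ) (Du : Matrix m (Fin nu) ℝ)
    (Dr : Matrix m (Fin nr) ℝ) (x : Fin nx → ℝ) (w : Fin nw → ℝ) (u : Fin nu → ℝ) :
    (C + Dr * (pdePI a b Gb Gp).P * Go.Cv) *ᵥ x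
        + vecInt a b (fun θ => (Dr * (pdePI a b Gb Gp).Q1 θ) *ᵥ f θ)
        + (Dw + Dr * (pdePI a b Gb Gp).P * Go.Dvw) *ᵥ w
        + (Du + Dr * (pdePI a b Gb Gp).P * Go.Dvu) *ᵥ u =
      C *ᵥ x + Dw *ᵥ w + Du *ᵥ u + Dr *ᵥ rSig a b Gb Gp (vSig Go x w u) f := by
  have h := mulVec_vecInt Dr (vecIntegrable_pdePI_Q1 hab hGb hGp hf)
  simp only [mulVec_mulVec] at h
  rw [← h, rSig, PI4.apply_fst, vSig]
  simp only [mulVec_add, add_mulVec, mulVec_mulVec, Matrix.mul_assoc]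
  abel

/-! ### Evaluation of the operators of the associated PIE. -/

lemma associatedPIE_T_fst (x : RL2 (Fin nx) (StateIdx n)) :
    ((associatedPIE a b Go Gb Gp).T.apply a b x).1 = x.1 := by
  simp [associatedPIE, PI4.apply, vecInt_zero]

lemma associatedPIE_Tw_fst (w : Fin nw → ℝ) :
    ((associatedPIE a b Go Gb Gp).Tw.apply a b (.ofVec w)).1 = 0 := by
  simp [associatedPIE, PI4.apply, vecInt_zero]

lemma associatedPIE_Tu_fst (u : Fin nu → ℝ) :
    ((associatedPIE a b Go Gb Gp).Tu.apply a b (.ofVec u)).1 = 0 := by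
  simp [associatedPIE, PI4.apply, vecInt_zero]

/-- Factored so that the time dependence sits in `B_v D_vw w`, the signal whose regularity is
assumed, and the space dependence in a continuous matrix function. -/
lemma associatedPIE_Tw_snd (w : Fin nw → ℝ) (s : ℝ) :
    ((associatedPIE a b Go Gb Gp).Tw.apply a b (.ofVec w)).2 s =
      (matT1 n (s - a) * matBTinv a b Gb) *ᵥ ((Gb.Bv * Go.Dvw) *ᵥ w) := by
  simp [associatedPIE, PI4.apply, vecInt_zero, RL2.ofVec, matGv, Matrix.mul_assoc]

lemma associatedPIE_Tu_snd (u : Fin nu → ℝ) (s : ℝ) :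
    ((associatedPIE a b Go Gb Gp).Tu.apply a b (.ofVec u)).2 s =
      (matT1 n (s - a) * matBTinv a b Gb) *ᵥ ((Gb.Bv * Go.Dvu) *ᵥ u) := by
  simp [associatedPIE, PI4.apply, vecInt_zero, RL2.ofVec, matGv, Matrix.mul_assoc]

lemma matContinuous_matT1_mul_matBTinv (a b : ℝ) (Gb : BCParams n nBC nv) :
    MatContinuous fun s => matT1 n (s - a) * matBTinv a b Gb :=
  (matContinuous_matT1.comp (g := fun s => s - a) (by fun_prop)).mul (.const _)

/-- The term `G_v v` splits along `v = C_v x + D_vw w + D_vu u`; the three pieces are those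
distributed over `𝒯`, `𝒯_w` and `𝒯_u`. -/
lemma associatedPIE_state (hab : a ≤ b) (hGb : Gb.SquareIntegrable a b)
    {x : RL2 (Fin nx) (StateIdx n)} (hx : L2Mem a b x.2) (w : Fin nw → ℝ) (u : Fin nu → ℝ)
    {s : ℝ} (hs : s ∈ Icc a b) :
    ((associatedPIE a b Go Gb Gp).T.apply a b x).2 s
        + ((associatedPIE a b Go Gb Gp).Tw.apply a b (.ofVec w)).2 s
        + ((associatedPIE a b Go Gb Gp).Tu.apply a b (.ofVec u)).2 s =
      synthState a (bdValue a b Gb (vSig Go x.1 w u) x.2) x.2 s := by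
  rw [← state_operator_eq hab hGb _ hx hs, associatedPIE_Tw_snd, associatedPIE_Tu_snd,
    PI4.apply_snd]
  simp only [associatedPIE, vSig, matGv, mulVec_add, mulVec_mulVec, Matrix.mul_assoc]
  abel

lemma associatedPIE_rhs_fst (hab : a ≤ b) (hGb : Gb.SquareIntegrable a b)
    (hGp : Gp.Bounded a b) {x : RL2 (Fin nx) (StateIdx n)} (hx : L2Mem a b x.2)
    (w : Fin nw → ℝ) (u : Fin nu → ℝ) :
    ((associatedPIE a b Go Gb Gp).A.apply a b x
        + (associatedPIE a b Go Gb Gp).B1.apply a b (.ofVec w)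
        + (associatedPIE a b Go Gb Gp).B2.apply a b (.ofVec u)).1 =
      Go.A *ᵥ x.1 + Go.Bxw *ᵥ w + Go.Bxu *ᵥ u
        + Go.Bxr *ᵥ rSig a b Gb Gp (vSig Go x.1 w u) x.2 := by
  rw [← mulVec_rSig hab hGb hGp hx]
  simp [associatedPIE, PI4.apply, vecInt_zero, RL2.ofVec]

lemma associatedPIE_rhs_snd (x : RL2 (Fin nx) (StateIdx n)) (w : Fin nw → ℝ) (u : Fin nu → ℝ)
    (s : ℝ) :
    ((associatedPIE a b Go Gb Gp).A.apply a b x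
        + (associatedPIE a b Go Gb Gp).B1.apply a b (.ofVec w)
        + (associatedPIE a b Go Gb Gp).B2.apply a b (.ofVec u)).2 s =
      ((pdePI a b Gb Gp).apply a b (vSig Go x.1 w u, x.2)).2 s := by
  rw [PI4.apply_snd, vSig]
  simp [associatedPIE, PI4.apply, vecInt_zero, RL2.ofVec, mulVec_add]
  abel

lemma associatedPIE_output_z (hab : a ≤ b) (hGb : Gb.SquareIntegrable a b)
    (hGp : Gp.Bounded a b) {x : RL2 (Fin nx) (StateIdx n)} (hx : L2Mem a b x.2)
    (w : Fin nw → ℝ) (u : Fin nu → ℝ) :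
    ((associatedPIE a b Go Gb Gp).C1.apply a b x
        + (associatedPIE a b Go Gb Gp).D11.apply a b (.ofVec w)
        + (associatedPIE a b Go Gb Gp).D12.apply a b (.ofVec u)).1 =
      Go.Cz *ᵥ x.1 + Go.Dzw *ᵥ w + Go.Dzu *ᵥ u
        + Go.Dzr *ᵥ rSig a b Gb Gp (vSig Go x.1 w u) x.2 := by
  rw [← mulVec_rSig hab hGb hGp hx]
  simp [associatedPIE, PI4.apply, vecInt_zero, RL2.ofVec]

lemma associatedPIE_output_y (hab : a ≤ b) (hGb : Gb.SquareIntegrable a b)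
    (hGp : Gp.Bounded a b) {x : RL2 (Fin nx) (StateIdx n)} (hx : L2Mem a b x.2)
    (w : Fin nw → ℝ) (u : Fin nu → ℝ) :
    ((associatedPIE a b Go Gb Gp).C2.apply a b x
        + (associatedPIE a b Go Gb Gp).D21.apply a b (.ofVec w)
        + (associatedPIE a b Go Gb Gp).D22.apply a b (.ofVec u)).1 =
      Go.Cy *ᵥ x.1 + Go.Dyw *ᵥ w + Go.Dyu *ᵥ u
        + Go.Dyr *ᵥ rSig a b Gb Gp (vSig Go x.1 w u) x.2 := by
  rw [← mulVec_rSig hab hGb hGp hx]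
  simp [associatedPIE, PI4.apply, vecInt_zero, RL2.ofVec]

/-- The initial condition holds only in `L₂`. A component of positive order is continuous, so it
vanishes on all of `[a,b]` and its derivatives with it; a component of order zero is its own
derivative of maximal order. -/
lemma StateSobolev.topDer_ae_zero (hab : a < b) {xh : ℝ → StateIdx n → ℝ}
    (hS : StateSobolev a b xh) (h : L2Eq a b xh 0) : L2Eq a b (topDer a b xh) 0 := by
  have H : ∀ α : StateIdx n, (fun s => topDer a b xh s α) =ᵐ[volume.restrict (Icc a b)] 0 := by
    intro α
    have hα0 : (fun s => xh s α) =ᵐ[volume.restrict (Icc a b)] fun _ => 0 := by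
      filter_upwards [h] with s hs
      rw [hs]; rfl
    rcases Nat.eq_zero_or_pos (α.1 : ℕ) with hα | hα
    · simp only [topDer, dComp, hα, iteratedDerivWithin_zero]
      exact hα0
    · have hc := (hS α).continuousOn hab hα
      rw [iteratedDerivWithin_zero] at hc
      have heq := Measure.eqOn_Icc_of_ae_eq volume hab.ne hα0 hc continuousOn_const
      filter_upwards [ae_restrict_mem measurableSet_Icc] with s hs
      simp only [topDer, dComp]
      rw [iteratedDerivWithin_congr heq hs]
      simp
  filter_upwards [ae_all_iff.2 H] with s hs
  exact funext hs

lemma topDer_zero : topDer a b (0 : ℝ → StateIdx n → ℝ) = 0 := by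
  ext s α
  simp [topDer, dComp]

lemma opC_zero (s : ℝ) : opC a b (0 : ℝ → StateIdx n → ℝ) s = 0 := by
  ext d
  simp [opC, dComp]

/-! ### Translation of trajectories in both directions. -/

variable {w : ℝ → Fin nw → ℝ} {u : ℝ → Fin nu → ℝ}

/-- A solution of the GPDE with zero initial condition gives one of the associated PIE. -/
theorem IsGPDESolutionCore.isPIESolution (hab : a < b) (hGb : Gb.SquareIntegrable a b)
    (hGp : Gp.Bounded a b) (hadm : Admissible a b Gb)
    {x : ℝ → Fin nx → ℝ} {xh : ℝ → ℝ → StateIdx n → ℝ} {z : ℝ → Fin nz → ℝ}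
    {y : ℝ → Fin ny → ℝ} {v : ℝ → Fin nv → ℝ} {r : ℝ → Fin nr → ℝ}
    (h : IsGPDESolutionCore a b Go Gb Gp 0 0 w u x xh z y v r) :
    IsPIESolution a b (associatedPIE a b Go Gb Gp) 0 w u
        (fun t => (x t, topDer a b (xh t))) z y ∧
      v =ᵐ[volume.restrict (Ici (0 : ℝ))] pieV Go w u (fun t => (x t, topDer a b (xh t))) ∧
      r =ᵐ[volume.restrict (Ici (0 : ℝ))]
        pieR a b Go Gb Gp w u (fun t => (x t, topDer a b (xh t))) := by
  set X : ℝ → RL2 (Fin nx) (StateIdx n) := fun t => (x t, topDer a b (xh t)) with hX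
  have hmem : ∀ t, 0 ≤ t → MemXv a b Gb (vSig Go (x t) (w t) (u t)) (xh t) := h.state_mem
  have hSob : ∀ t, 0 ≤ t → StateSobolev a b (xh t) := fun t ht => (hmem t ht).1
  have hXL : ∀ t, 0 ≤ t → L2Mem a b (X t).2 := fun t ht => (hSob t ht).l2Mem_topDer
  have hout : ∀ t, 0 ≤ t → pdeOut a b Gp (xh t) =
      rSig a b Gb Gp (vSig Go (x t) (w t) (u t)) (X t).2 := fun t ht =>
    pdeOut_eq hab hGb hadm hGp (hmem t ht) (ae_eq_refl _)
  have hv : v =ᵐ[volume.restrict (Ici (0 : ℝ))] pieV Go w u X := h.output_v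
  have hr : r =ᵐ[volume.restrict (Ici (0 : ℝ))] fun t =>
      rSig a b Gb Gp (vSig Go (x t) (w t) (u t)) (X t).2 := by
    filter_upwards [h.output_r, ae_restrict_mem measurableSet_Ici] with t ht ht0
    rw [ht, hout t ht0]
  have hGc := matContinuous_matT1_mul_matBTinv a b Gb
  refine ⟨⟨h.w_mem, h.u_mem, ?_, ?_, ?_, h.z_mem, h.y_mem, hXL, ?_, ?_, ?_, ?_⟩, hv, hr⟩
  · intro s _
    simp only [associatedPIE_Tw_fst, associatedPIE_Tw_snd]
    exact ⟨w1e_iff.2 fun _ => scalarW1e_zero, h.Bw_mem.mulVec _⟩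
  · intro s _
    simp only [associatedPIE_Tu_fst, associatedPIE_Tu_snd]
    exact ⟨w1e_iff.2 fun _ => scalarW1e_zero, h.Bu_mem.mulVec _⟩
  · exact MemLp.zero
  · exact ⟨h.init_x, (hSob 0 le_rfl).topDer_ae_zero hab h.init_xh⟩
  · filter_upwards [h.ode, h.pde, h.Bw_mem.ae_differentiableAt, h.Bu_mem.ae_differentiableAt,
      ae_restrict_Ici_pos, hv, hr] with t hode hpde hw' hu' ht0 hvt hrt
    have hw2 := hasL2DerivAt_mulVec (a := a) (b := b) hGc hw'.hasDerivAt
    have hu2 := hasL2DerivAt_mulVec (a := a) (b := b) hGc hu'.hasDerivAt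
    set dw := deriv (fun t => (Gb.Bv * Go.Dvw) *ᵥ w t) t
    set du := deriv (fun t => (Gb.Bv * Go.Dvu) *ᵥ u t) t
    have hpos : ∀ᶠ τ in 𝓝 t, 0 < τ := eventually_gt_nhds ht0
    -- The distributed part of `𝒯 x` is `x̂ - 𝒯_w w - 𝒯_u u`, so its derivative is the right-hand
    -- side of the PDE minus the derivatives of the two input terms.
    refine ⟨(Go.A *ᵥ x t + Go.Bxw *ᵥ w t + Go.Bxu *ᵥ u t + Go.Bxr *ᵥ r t,
        pdeRHS a b Gp (v t) (xh t) + -(fun s => (matT1 n (s - a) * matBTinv a b Gb) *ᵥ dw)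
          + -(fun s => (matT1 n (s - a) * matBTinv a b Gb) *ᵥ du)),
      (0, fun s => (matT1 n (s - a) * matBTinv a b Gb) *ᵥ dw),
      (0, fun s => (matT1 n (s - a) * matBTinv a b Gb) *ᵥ du), ⟨?_, ?_⟩, ⟨?_, ?_⟩, ⟨?_, ?_⟩, ?_⟩
    · simp only [associatedPIE_T_fst]
      exact hode
    · have h1 : ∀ᶠ τ in 𝓝 t, L2Mem a b (xh τ) := by
        filter_upwards [hpos] with τ hτ using (hSob τ hτ.le).l2Mem hab
      have h2 : ∀ᶠ τ in 𝓝 t, L2Mem a b (-(fun s => (matT1 n (s - a) * matBTinv a b Gb) *ᵥ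
          ((Gb.Bv * Go.Dvw) *ᵥ w τ))) :=
        Eventually.of_forall fun τ => MemLp.neg (hGc.l2Mem_mulVec _)
      have h3 : ∀ᶠ τ in 𝓝 t, L2Mem a b (-(fun s => (matT1 n (s - a) * matBTinv a b Gb) *ᵥ
          ((Gb.Bv * Go.Dvu) *ᵥ u τ))) :=
        Eventually.of_forall fun τ => MemLp.neg (hGc.l2Mem_mulVec _)
      refine ((hpde.add hw2.neg h1 h2).add hu2.neg ?_ h3).congr ?_ (ae_eq_refl _)
      · filter_upwards [h1, h2] with τ h1 h2 using MemLp.add h1 h2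
      · filter_upwards [hpos] with τ hτ
        filter_upwards [ae_restrict_mem measurableSet_Icc] with s hs
        have e := associatedPIE_state (Go := Go) (Gp := Gp) hab.le hGb (hXL τ hτ.le) (w τ) (u τ) hs
        rw [← (hmem τ hτ.le).eq_synthState hab hGb hadm hs, associatedPIE_Tw_snd,
          associatedPIE_Tu_snd] at e
        simp only [Pi.add_apply, Pi.neg_apply]
        rw [← e]
        abel
    · simp only [associatedPIE_Tw_fst]
      exact hasDerivAt_const _ _
    · exact hw2.congr (Eventually.of_forall fun τ => ae_of_all _ fun s =>
        (associatedPIE_Tw_snd _ s).symm) (ae_eq_refl _)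
    · simp only [associatedPIE_Tu_fst]
      exact hasDerivAt_const _ _
    · exact hu2.congr (Eventually.of_forall fun τ => ae_of_all _ fun s =>
        (associatedPIE_Tu_snd _ s).symm) (ae_eq_refl _)
    · constructor
      · rw [Prod.fst_sub, associatedPIE_rhs_fst hab.le hGb hGp (hXL t ht0.le)]
        simp [hrt, hX]
      · have hm := hmem t ht0.le
        filter_upwards [pdeRHS_ae_eq hab hGb hadm hGp hm (ae_eq_refl _)] with s hs
        rw [Prod.snd_sub, Pi.sub_apply, associatedPIE_rhs_snd]
        simp only [Pi.add_apply, Pi.neg_apply, Prod.snd_add, hvt]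
        have e : pieV Go w u X t = vSig Go (x t) (w t) (u t) := rfl
        rw [e, hs]
        simp only [hX]
        abel
  · filter_upwards [h.output_z, hr, ae_restrict_mem measurableSet_Ici] with t ht hrt ht0
    rw [associatedPIE_output_z hab.le hGb hGp (hXL t ht0), ht, hrt]
  · filter_upwards [h.output_y, hr, ae_restrict_mem measurableSet_Ici] with t ht hrt ht0
    rw [associatedPIE_output_y hab.le hGb hGp (hXL t ht0), ht, hrt]

/-- A solution of the associated PIE with zero initial condition and compatible inputs gives one
of the GPDE. -/
theorem IsPIESolution.isGPDESolutionCore (hab : a < b) (hGb : Gb.SquareIntegrable a b)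
    (hGp : Gp.Bounded a b) (hadm : Admissible a b Gb)
    (hBw : W1e (fun t => (Gb.Bv * Go.Dvw) *ᵥ w t))
    (hcomp : MemXwu a b Go Gb (w 0) (u 0) 0 0)
    {x : ℝ → RL2 (Fin nx) (StateIdx n)} {z : ℝ → Fin nz → ℝ} {y : ℝ → Fin ny → ℝ}
    (h : IsPIESolution a b (associatedPIE a b Go Gb Gp) 0 w u x z y) :
    IsGPDESolutionCore a b Go Gb Gp 0 0 w u (fun t => (x t).1)
      (fun t => synthState a (bdValue a b Gb (pieV Go w u x t) (x t).2) (x t).2) z y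
      (pieV Go w u x) (pieR a b Go Gb Gp w u x) := by
  set xh : ℝ → ℝ → StateIdx n → ℝ := fun t =>
    synthState a (bdValue a b Gb (pieV Go w u x t) (x t).2) (x t).2 with hxh
  have hxL : ∀ t, 0 ≤ t → L2Mem a b (x t).2 := h.x_mem
  have hmem : ∀ t, 0 ≤ t → MemXv a b Gb (pieV Go w u x t) (xh t) := fun t ht =>
    memXv_synthState hab hGb hadm _ (hxL t ht)
  have htop : ∀ t, 0 ≤ t → L2Eq a b (topDer a b (xh t)) (x t).2 := fun t ht =>
    topDer_synthState hab _ (hxL t ht)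
  have hr : ∀ t, pieR a b Go Gb Gp w u x t =
      rSig a b Gb Gp (vSig Go (x t).1 (w t) (u t)) (x t).2 := fun _ => rfl
  refine ⟨hcomp, h.w_mem, h.u_mem, hBw, ?_, h.z_mem, h.y_mem, hmem, h.init.1, ?_, ?_, ?_, ?_,
    ae_of_all _ fun _ => rfl, ?_, ?_⟩
  · have h1 : W1e fun t => matBTinv a b Gb *ᵥ ((Gb.Bv * Go.Dvu) *ᵥ u t) := by
      refine w1e_of_matT1_mulVec hab fun s hs => ?_
      have := (h.Tu_mem s hs).2
      simp only [associatedPIE_Tu_snd] at this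
      simpa only [mulVec_mulVec, Matrix.mul_assoc] using this
    have h2 := h1.mulVec (matBT a b Gb)
    simpa only [mulVec_mulVec, ← Matrix.mul_assoc, matBT_mul_matBTinv hadm, Matrix.one_mul]
      using h2
  · have h0 : L2Eq a b (x 0).2 0 := h.init.2
    have hv0 : pieV Go w u x 0 = vSig Go 0 (w 0) (u 0) := by
      rw [pieV, h.init.1]; rfl
    -- Compatibility says that the zero state satisfies the boundary conditions at `t = 0`, so by
    -- uniqueness its zero boundary values are the ones given by `bdValue`.
    have hc0 : bdValue a b Gb (pieV Go w u x 0) (x 0).2 = 0 := by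
      have := ((memXv_iff hab hGb hadm).1 hcomp).2
      rw [topDer_zero, opC_zero] at this
      rw [bdValue_congr_ae hab.le _ h0, hv0, ← this]
    simp only [hxh, hc0]
    filter_upwards [h0, ae_restrict_mem measurableSet_Icc] with s hs hs'
    have e : vecInt a s (fun θ => matQ1 n (s - θ) *ᵥ (x 0).2 θ) = vecInt a s (fun _ => 0) := by
      refine vecInt_congr_ae hs'.1 ?_
      filter_upwards [ae_restrict_of_ae_restrict_of_subset (Icc_subset_Icc_right hs'.2) h0]
        with θ hθ
      rw [hθ, Pi.zero_apply, mulVec_zero]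
    rw [synthState, e, hs, vecInt_zero]
    simp
  · filter_upwards [h.dynamics, ae_restrict_Ici_pos] with t ⟨dx, dw, du, h1, h2, h3, h4⟩ ht0
    have e1 := h1.1
    have e2 := h2.1
    have e3 := h3.1
    simp only [associatedPIE_T_fst] at e1
    simp only [associatedPIE_Tw_fst] at e2
    simp only [associatedPIE_Tu_fst] at e3
    have e4 := h4.1
    -- The inputs do not enter the finite-dimensional part of `𝒯_w w` and `𝒯_u u`. These parts are
    -- constantly zero, and uniqueness of derivatives makes the corresponding components of `dw` and
    -- `du` vanish.
    rw [Prod.fst_sub, associatedPIE_rhs_fst hab.le hGb hGp (hxL t ht0.le), Prod.fst_add,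
      e2.unique (hasDerivAt_const _ _), e3.unique (hasDerivAt_const _ _), add_zero,
      sub_zero] at e4
    rw [e4] at e1
    exact e1
  · filter_upwards [h.output_z, ae_restrict_mem measurableSet_Ici] with t ht ht0
    rw [ht, associatedPIE_output_z hab.le hGb hGp (hxL t ht0), hr]
  · filter_upwards [h.output_y, ae_restrict_mem measurableSet_Ici] with t ht ht0
    rw [ht, associatedPIE_output_y hab.le hGb hGp (hxL t ht0), hr]
  · filter_upwards [h.dynamics, ae_restrict_Ici_pos] with t ⟨dx, dw, du, h1, h2, h3, h4⟩ ht0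
    have hpos : ∀ᶠ τ in 𝓝 t, 0 < τ := eventually_gt_nhds ht0
    have hGc := matContinuous_matT1_mul_matBTinv a b Gb
    have m2 : ∀ τ, L2Mem a b
        ((associatedPIE a b Go Gb Gp).Tw.apply a b (.ofVec (w τ))).2 := fun τ => by
      rw [funext (associatedPIE_Tw_snd (w τ))]
      exact hGc.l2Mem_mulVec _
    have m3 : ∀ τ, L2Mem a b
        ((associatedPIE a b Go Gb Gp).Tu.apply a b (.ofVec (u τ))).2 := fun τ => by
      rw [funext (associatedPIE_Tu_snd (u τ))]
      exact hGc.l2Mem_mulVec _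
    have est : ∀ τ, 0 < τ → L2Eq a b (((associatedPIE a b Go Gb Gp).T.apply a b (x τ)).2
        + ((associatedPIE a b Go Gb Gp).Tw.apply a b (.ofVec (w τ))).2
        + ((associatedPIE a b Go Gb Gp).Tu.apply a b (.ofVec (u τ))).2) (xh τ) := by
      intro τ hτ
      filter_upwards [ae_restrict_mem measurableSet_Icc] with s hs
      exact associatedPIE_state hab.le hGb (hxL τ hτ.le) _ _ hs
    -- Obtained by difference: the reconstructed state is a Sobolev function and the two input terms
    -- are continuous in `s`.
    have m1 : ∀ᶠ τ in 𝓝 t, L2Mem a b ((associatedPIE a b Go Gb Gp).T.apply a b (x τ)).2 := by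
      filter_upwards [hpos] with τ hτ
      have hL : L2Mem a b (xh τ) := StateSobolev.l2Mem hab (hmem τ hτ.le).1
      refine MemLp.ae_eq ?_ (MemLp.sub (MemLp.sub hL (m3 τ)) (m2 τ))
      filter_upwards [est τ hτ] with s hs
      simp only [Pi.sub_apply, ← hs, Pi.add_apply]
      abel
    refine ((h1.2.add h2.2 m1 (Eventually.of_forall m2)).add h3.2 ?_
      (Eventually.of_forall m3)).congr ?_ ?_
    · filter_upwards [m1] with τ hτ using MemLp.add hτ (m2 τ)
    · filter_upwards [hpos] with τ hτ using est τ hτ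
    · filter_upwards [h4.2, pdeRHS_ae_eq hab hGb hadm hGp (hmem t ht0.le) (htop t ht0.le)]
        with s hs hs'
      rw [Pi.add_apply, Pi.add_apply, hs, Prod.snd_sub, Pi.sub_apply, associatedPIE_rhs_snd, hs']
      simp only [Prod.snd_add, Pi.add_apply, pieV]
      abel
  · filter_upwards [ae_restrict_mem measurableSet_Ici] with t ht0
    exact (pdeOut_eq hab hGb hadm hGp (hmem t ht0) (htop t ht0)).symm

end Equivalence

/-! ## Input-output properties -/

section InputOutput

variable {N : ℕ} {n : Fin (N + 1) → ℕ} {nx nw nu nz ny nv nr nBC : ℕ} {a b : ℝ}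
  {Go : ODEParams nx nw nu nz ny nv nr} {Gb : BCParams n nBC nv} {Gp : PDEParams n nv nr}
  {w : ℝ → Fin nw → ℝ}

/-- A property of the outputs holds for all solutions of the GPDE if and only if it holds for all
solutions of the associated PIE with compatible inputs. -/
theorem forall_isGPDESolution_iff (hab : a < b) (hGb : Gb.SquareIntegrable a b)
    (hGp : Gp.Bounded a b) (hadm : Admissible a b Gb)
    (hBw : W1e (fun t => (Gb.Bv * Go.Dvw) *ᵥ w t))
    (K : (ℝ → Fin ny → ℝ) → (ℝ → Fin nu → ℝ)) (Φ : (ℝ → Fin nz → ℝ) → Prop) :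
    (∀ x xh z y v r, IsGPDESolution a b Go Gb Gp 0 0 w (K y) x xh z y v r → Φ z) ↔
      ∀ x z y, IsPIESolution a b (associatedPIE a b Go Gb Gp) 0 w (K y) x z y →
        MemXwu a b Go Gb (w 0) (K y 0) 0 0 →
        L2e (pieV Go w (K y) x) → L2e (pieR a b Go Gb Gp w (K y) x) → Φ z := by
  constructor
  · intro H x z y h hc hv hr
    exact H _ _ z y _ _ ⟨h.isGPDESolutionCore hab hGb hGp hadm hBw hc, hv, hr⟩
  · intro H x xh z y v r h
    obtain ⟨h1, h2, h3⟩ := h.toIsGPDESolutionCore.isPIESolution hab hGb hGp hadm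
    exact H _ z y h1 h.init_mem (h.v_mem.congr_ae h2) (h.r_mem.congr_ae h3)

theorem forall_isGPDESolutionCore_iff (hab : a < b) (hGb : Gb.SquareIntegrable a b)
    (hGp : Gp.Bounded a b) (hadm : Admissible a b Gb)
    (hBw : W1e (fun t => (Gb.Bv * Go.Dvw) *ᵥ w t))
    (K : (ℝ → Fin ny → ℝ) → (ℝ → Fin nu → ℝ)) (Φ : (ℝ → Fin nz → ℝ) → Prop) :
    (∀ x xh z y v r, IsGPDESolutionCore a b Go Gb Gp 0 0 w (K y) x xh z y v r → Φ z) ↔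
      ∀ x z y, IsPIESolution a b (associatedPIE a b Go Gb Gp) 0 w (K y) x z y →
        MemXwu a b Go Gb (w 0) (K y 0) 0 0 → Φ z := by
  constructor
  · intro H x z y h hc
    exact H _ _ z y _ _ (h.isGPDESolutionCore hab hGb hGp hadm hBw hc)
  · intro H x xh z y v r h
    exact H _ z y (h.isPIESolution hab hGb hGp hadm).1 h.init_mem

end InputOutput

end GPDE

end

theorem corollary3 {N : ℕ} (n : Fin (N + 1) → ℕ) {nx nw nu nz ny nv nr nBC : ℕ}
    (a b : ℝ) (hab : a < b)
    (Go : GPDE.ODEParams nx nw nu nz ny nv nr)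
    (Gb : GPDE.BCParams n nBC nv) (hGb : Gb.SquareIntegrable a b)
    (Gp : GPDE.PDEParams n nv nr) (hGp : Gp.Bounded a b)
    (hadm : GPDE.Admissible a b Gb)
    (w : ℝ → Fin nw → ℝ) (hw : GPDE.L2e w)
    (hBw : GPDE.W1e (fun t => (Gb.Bv * Go.Dvw) *ᵥ w t))
    (γ : ℝ≥0) :
    -- open loop
    (GPDE.MemXwu a b Go Gb (w 0) 0 0 0 →
      ((∀ x xh z y v r, GPDE.IsGPDESolution a b Go Gb Gp 0 0 w 0 x xh z y v r →
          GPDE.L2norm z ≤ γ * GPDE.L2norm w) ↔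
        (∀ x z y, GPDE.IsPIESolution a b (GPDE.associatedPIE a b Go Gb Gp) 0 w 0 x z y →
          GPDE.L2e (GPDE.pieV Go w 0 x) → GPDE.L2e (GPDE.pieR a b Go Gb Gp w 0 x) →
          GPDE.L2norm z ≤ γ * GPDE.L2norm w)) ∧
      ((∀ x xh z y v r, GPDE.IsGPDESolutionCore a b Go Gb Gp 0 0 w 0 x xh z y v r →
          GPDE.L2norm z ≤ γ * GPDE.L2norm w) ↔
        (∀ x z y, GPDE.IsPIESolution a b (GPDE.associatedPIE a b Go Gb Gp) 0 w 0 x z y →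
          GPDE.L2norm z ≤ γ * GPDE.L2norm w))) ∧
    -- closed loop with `u = K y`
    (∀ K : (ℝ → Fin ny → ℝ) → (ℝ → Fin nu → ℝ), (∀ y, GPDE.L2e y → GPDE.L2e (K y)) →
      ((∀ x xh z y v r, GPDE.IsGPDESolution a b Go Gb Gp 0 0 w (K y) x xh z y v r →
          GPDE.L2norm z ≤ γ * GPDE.L2norm w) ↔
        (∀ x z y, GPDE.IsPIESolution a b (GPDE.associatedPIE a b Go Gb Gp) 0 w (K y) x z y →
          GPDE.MemXwu a b Go Gb (w 0) (K y 0) 0 0 →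
          GPDE.L2e (GPDE.pieV Go w (K y) x) → GPDE.L2e (GPDE.pieR a b Go Gb Gp w (K y) x) →
          GPDE.L2norm z ≤ γ * GPDE.L2norm w)) ∧
      ((∀ x xh z y v r, GPDE.IsGPDESolutionCore a b Go Gb Gp 0 0 w (K y) x xh z y v r →
          GPDE.L2norm z ≤ γ * GPDE.L2norm w) ↔
        (∀ x z y, GPDE.IsPIESolution a b (GPDE.associatedPIE a b Go Gb Gp) 0 w (K y) x z y →
          GPDE.MemXwu a b Go Gb (w 0) (K y 0) 0 0 →
          GPDE.L2norm z ≤ γ * GPDE.L2norm w))) := by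
  refine ⟨fun hc => ⟨?_, ?_⟩, fun K _ => ⟨?_, ?_⟩⟩
  · rw [GPDE.forall_isGPDESolution_iff hab hGb hGp hadm hBw (fun _ => 0)
      (fun z => GPDE.L2norm z ≤ γ * GPDE.L2norm w)]
    exact ⟨fun H x z y h => H x z y h hc, fun H x z y h _ => H x z y h⟩
  · rw [GPDE.forall_isGPDESolutionCore_iff hab hGb hGp hadm hBw (fun _ => 0)
      (fun z => GPDE.L2norm z ≤ γ * GPDE.L2norm w)]
    exact ⟨fun H x z y h => H x z y h hc, fun H x z y h _ => H x z y h⟩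
  · exact GPDE.forall_isGPDESolution_iff hab hGb hGp hadm hBw K
      (fun z => GPDE.L2norm z ≤ γ * GPDE.L2norm w)
  · exact GPDE.forall_isGPDESolutionCore_iff hab hGb hGp hadm hBw K
      (fun z => GPDE.L2norm z ≤ γ * GPDE.L2norm w)
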